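/- **Setting.** Let $T$ be a locally finite rooted tree with root $\mathfrak r$, with edges oriented away from the root, and let $\ell:E(T)\to(0,\infty)$ be a length function. Write $\bar v v$ for the edge from the parent $\bar v$ of a vertex $v\ne\mathfrak r$ to $v$, and $T_v$ for the subtree of $v$ and its descendants, rooted at $v$. A vertex is *branching* if it has at least two children, and a *leaf* if it has no children. A *strict path* of a rooted tree is a maximal oriented path from the root without branching vertices in its interior; each edge at the root lies in exactly one strict path. The pair $(T,\ell)$ is *weakly complete* if for every vertex $v$ every infinite strict path of $T_v$ has infinite $\ell$-length. It is *transient* if the random walk on $T$ started at $\mathfrak r$, which moves from $u$ to a neighbour $v$ with probability $c(u,v)/\sum_{w\sim u}c(u,w)$, where the conductance $c$ of an edge is the inverse of its length, almost surely visits $\mathfrak r$ only finitely many times. **Flows and harmonic measure.** A *unit flow* is a function $\theta:E(T)\to[0,\infty)$ with $\theta(\bar v v)=\sum_{vu\in E(T)}\theta(vu)$ for all $v\neq\mathfrak r$ and $\sum_{\mathfrak r u\in E(T)}\theta(\mathfrak r u)=1$; its *energy* is $\|\theta\|^2=\sum_e\ell(e)\theta(e)^2$. The *unit current flow* $\eta$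 is the unit flow of finite energy with minimum energy. Let $\partial T$ be the set of infinite oriented paths from $\mathfrak r$, and $\widetilde\partial T$ the union of $\partial T$ with the set of paths from $\mathfrak r$ to a leaf, both with the topology generated by the sets $B_v$ of the elements that contain the vertex $v$. The *harmonic measure* $\mu_{\rm har}$ is the Borel probability measure on $\partial T$ with $\mu_{\rm har}(B_v)=\eta(\bar v v)$ for all $v\ne\mathfrak r$. **Factorial weighting sequences.** These are sequences of partial weightings $\omega_n$ of the edges by positive integers, with chosen vertices $x_n$, constructed as follows. Let $T_n$ be the subtree formed by the root and the edges weighted by $\omega_n$. No edge is weighted by $\omega_0$, and $x_0=\mathfrak r$; $\omega_1$ gives weight $1$ to the edges of one strict path of $T$. For $n\ge1$, let $x_n$ be a vertex that minimizes $\sum_{e\in[\mathfrak r,x]}\omega_n(e)\ell(e)$ among the vertices $x$ of $T_n$ with an edge to a child not weighted by $\omega_n$. If some edge from $x_n$ to a child is weighted, choose an unweighted edge from $x_n$ to a child and give weight $1$ to the edges of the strict path of $T_{x_n}$ that contains it; if none is weighted, choose two edges from $x_n$ to children and give weight $1$ to the edges of the two strict paths of $T_{x_n}$ that contain them. In both cases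 the weights on $[\mathfrak r,x_n]$ increase by $1$ and all others are unchanged; the result is $\omega_{n+1}$. Put $n!_\Gamma:=\sum_{e\in[\mathfrak r,x_n]}\omega_n(e)\ell(e)$, and set $\omega_n(e)=0$ on unweighted edges when forming $\omega_n/n$. A Borel probability measure $\mu$ on $\widetilde\partial T$ is *consistent* with $\omega_n/n$ if $\mu(B_v)=\omega_n(\bar v v)/n$ for every vertex $v\neq\mathfrak r$ of $T_n$ that has a child in $T_n$. **Factorial-determining sequences.** For distinct $\rho,\tau\in\widetilde\partial T$ let $\langle\rho,\tau\rangle$ be the sum of the lengths of their common edges. A *factorial-determining sequence* is a sequence $\rho_0,\rho_1,\dots$ in $\widetilde\partial T$ such that, for every $n$, $\rho_n$ minimizes $\sum_{j<n}\langle\rho,\rho_j\rangle$ among the $\rho\in\widetilde\partial T\setminus\{\rho_0,\dots,\rho_{n-1}\}$. **Theorem.** Let $(T,\ell)$ be a locally finite rooted tree with a (positive) length function that is transient and weakly complete. Then the unit current flow $\eta$ and the harmonic measure $\mu_{\rm har}$ exist and are unique; infinite factorial weighting sequences exist; for every $n$ the number $n!_\Gamma$ is the same for all factorial weighting sequences,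 and is equal to $\sum_{j<n}\langle\rho_n,\rho_j\rangle$ for every factorial-determining sequence $(\rho_j)$. Moreover: 1. for every factorial weighting sequence $(\omega_n)$ and every edge $e$, $\lim_{n\to\infty}\omega_n(e)/n=\eta(e)$; 2. for every factorial weighting sequence $(\omega_n)$ and all probability measures $\mu_n$ on $\widetilde\partial T$ with $\mu_n$ consistent with $\omega_n/n$ for $n\geq 1$, $\mu_n$ converges weakly on $\widetilde\partial T$ to $\mu_{\rm har}$ (viewed as a measure on $\widetilde\partial T$ through $\partial T\subseteq\widetilde\partial T$); and every factorial-determining sequence $(\rho_j)$ is equidistributed with respect to $\mu_{\rm har}$, that is, $\frac1n\sum_{j<n}\delta_{\rho_j}$ converges weakly to $\mu_{\rm har}$; 3. $H(T,\ell):=\lim_{n\to\infty}\frac1n\,n!_\Gamma=\|\eta\|^2$. -/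

import Mathlib

open Filter Topology MeasureTheory
open scoped BoundedContinuousFunction

namespace TreeFactorial

/-- Edges of a rooted tree, oriented away from the root `⊥`.  In a `RootedTree` the order is the
ancestor order and `Order.pred v` is the parent of `v`, so an edge `uv` is determined by its
target `v ≠ ⊥`, and its source is `Order.pred v`. -/
def Edge (T : RootedTree) : Type _ := {v : T // v ≠ ⊥}

variable {T : RootedTree}

/-- The end-point of an edge that is farther from the root. -/
def Edge.tgt (e : Edge T) : T := e.1

/-- The end-point of an edge that is closer to the root. -/
def Edge.src (e : Edge T) : T := Order.pred e.1

/-- Every vertex has finitely many children. -/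
def IsLocallyFinite (T : RootedTree) : Prop := ∀ v : T, {e : Edge T | e.src = v}.Finite

/-- A vertex with at least two children. -/
def IsBranching (v : T) : Prop := ∃ e f : Edge T, e.src = v ∧ f.src = v ∧ e ≠ f

/-- A vertex without children.  (The root is a leaf only if the tree is a single vertex.) -/
def IsLeaf (v : T) : Prop := ∀ e : Edge T, e.src ≠ v

/-- The set of edges of the strict path that starts with the edge `e` in the subtree of all
descendants of `e.src`: the maximal oriented path beginning with `e` which has no branching vertex
in its interior. -/
def strictPath (e : Edge T) : Set (Edge T) :=
  {f | e.tgt ≤ f.tgt ∧ ∀ z : T, e.tgt ≤ z → z < f.tgt → ¬ IsBranching z}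

/-- Every infinite strict path, in the subtree of descendants of any vertex, has infinite length. -/
def IsWeaklyComplete (ℓ : Edge T → ℝ) : Prop :=
  ∀ e : Edge T, (strictPath e).Infinite → ¬ Summable (fun f : strictPath e => ℓ f)

section RandomWalk

instance instMeasurableSpaceVertex (T : RootedTree) : MeasurableSpace T := ⊤

/-- `e` joins `u` and `v`, in one of the two orientations. -/
def Edge.Joins (e : Edge T) (u v : T) : Prop :=
  (e.src = u ∧ e.tgt = v) ∨ (e.src = v ∧ e.tgt = u)

/-- The transition probability `c(u,v) / ∑_{w ∼ u} c(u,w)`, where the conductance `c` of an edge is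
the inverse of its length (and `c(u,v) = 0` if `u` and `v` are not adjacent). -/
noncomputable def transitionProb (ℓ : Edge T → ℝ) (u v : T) : ℝ :=
  (∑ᶠ (e : Edge T) (_ : e.Joins u v), (ℓ e)⁻¹) /
    (∑ᶠ (e : Edge T) (_ : e.src = u ∨ e.tgt = u), (ℓ e)⁻¹)

/-- `P` is the law, on the space of trajectories, of the random walk started at the root with
transition probabilities `transitionProb ℓ`.  (For a tree with more than one vertex there is exactly
one such law.) -/
def IsRandomWalkLaw (ℓ : Edge T → ℝ) (P : Measure (ℕ → T)) : Prop :=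
  IsProbabilityMeasure P ∧ P {X | X 0 = ⊥} = 1 ∧
    ∀ (n : ℕ) (x : ℕ → T), x 0 = ⊥ →
      P {X | ∀ i ≤ n, X i = x i} =
        ENNReal.ofReal (∏ i ∈ Finset.range n, transitionProb ℓ (x i) (x (i + 1)))

/-- Almost surely, the random walk visits the root only a finite number of times. -/
def IsTransient (ℓ : Edge T → ℝ) : Prop :=
  ∃ P : Measure (ℕ → T), IsRandomWalkLaw ℓ P ∧ ∀ᵐ X ∂P, {n : ℕ | X n = ⊥}.Finite

end RandomWalk

section Flows

/-- A flow of total amount one. -/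
structure IsUnitFlow (θ : Edge T → ℝ) : Prop where
  nonneg : ∀ e, 0 ≤ θ e
  conserve : ∀ e : Edge T, θ e = ∑ᶠ (f : Edge T) (_ : f.src = e.tgt), θ f
  total : ∑ᶠ (f : Edge T) (_ : f.src = ⊥), θ f = 1

/-- The energy `‖θ‖²` (meaningful when the sum converges). -/
noncomputable def energy (ℓ θ : Edge T → ℝ) : ℝ := ∑' e, ℓ e * θ e ^ 2

/-- A unit flow of bounded energy. -/
def IsBoundedUnitFlow (ℓ θ : Edge T → ℝ) : Prop :=
  IsUnitFlow θ ∧ Summable fun e => ℓ e * θ e ^ 2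

/-- A unit current flow: a unit flow of bounded energy whose energy is minimal. -/
def IsUnitCurrentFlow (ℓ η : Edge T → ℝ) : Prop :=
  IsBoundedUnitFlow ℓ η ∧ ∀ θ, IsBoundedUnitFlow ℓ θ → energy ℓ η ≤ energy ℓ θ

end Flows

section Boundary

/-- The vertex set of an infinite oriented path starting at the root. -/
def IsRay (s : Set T) : Prop :=
  ∃ p : ℕ → T, p 0 = ⊥ ∧ (∀ n, p n ⋖ p (n + 1)) ∧ s = Set.range p

/-- The vertex set of the path from the root to a leaf. -/
def IsLeafPath (s : Set T) : Prop := ∃ v : T, IsLeaf v ∧ s = Set.Iic v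

/-- The boundary `∂T`. -/
def Boundary (T : RootedTree) : Type _ := {s : Set T // IsRay s}

/-- The extended boundary: infinite oriented paths from the root, and paths from the root to a
leaf. -/
def ExtBoundary (T : RootedTree) : Type _ := {s : Set T // IsRay s ∨ IsLeafPath s}

/-- The inclusion of the boundary in the extended boundary. -/
def Boundary.toExt (s : Boundary T) : ExtBoundary T := ⟨s.1, Or.inl s.2⟩

/-- The set `B_v` of the boundary points that pass through `v`. -/
def Boundary.cyl (v : T) : Set (Boundary T) := {s | v ∈ s.1}

/-- The set `B_v` of the extended boundary points that pass through `v`. -/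
def ExtBoundary.cyl (v : T) : Set (ExtBoundary T) := {s | v ∈ s.1}

instance : TopologicalSpace (Boundary T) :=
  TopologicalSpace.generateFrom (Set.range Boundary.cyl)

instance : TopologicalSpace (ExtBoundary T) :=
  TopologicalSpace.generateFrom (Set.range ExtBoundary.cyl)

instance : MeasurableSpace (Boundary T) := borel _

instance : BorelSpace (Boundary T) := ⟨rfl⟩

instance : MeasurableSpace (ExtBoundary T) := borel _

instance : BorelSpace (ExtBoundary T) := ⟨rfl⟩

/-- `μ` is the Borel measure of total mass one on the boundary that is associated to the unit flow
`θ`.  For the unit current flow `θ = η` this is the harmonic measure. -/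
def IsFlowMeasure (θ : Edge T → ℝ) (μ : Measure (Boundary T)) : Prop :=
  IsProbabilityMeasure μ ∧ ∀ e : Edge T, μ (Boundary.cyl e.tgt) = ENNReal.ofReal (θ e)

/-- Weak convergence, on the extended boundary, of `μ n` to the measure `ν` on the boundary. -/
def WeaklyTendsTo (μ : ℕ → Measure (ExtBoundary T)) (ν : Measure (Boundary T)) : Prop :=
  ∀ f : ExtBoundary T →ᵇ ℝ, Tendsto (fun n => ∫ s, f s ∂(μ n)) atTop (𝓝 (∫ s, f s.toExt ∂ν))

/-- Equidistribution: the averages of the Dirac masses at `ρ 0, …, ρ (n - 1)` converge weakly to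
`ν`. -/
def IsEquidistributed (ρ : ℕ → ExtBoundary T) (ν : Measure (Boundary T)) : Prop :=
  ∀ f : ExtBoundary T →ᵇ ℝ,
    Tendsto (fun n : ℕ => (∑ j ∈ Finset.range n, f (ρ j)) / n) atTop (𝓝 (∫ s, f s.toExt ∂ν))

end Boundary

section Weighting

/-! A weight function is a function `ω : Edge T → ℕ`; an unweighted edge is one with `ω e = 0`
(the weights given in the weighting process are all positive). All leaves have capacity one. -/

/-- `v` is a vertex of `T_ω`, the subtree formed by the root and all weighted edges. -/
def InTree (ω : Edge T → ℕ) (v : T) : Prop := v = ⊥ ∨ ∃ e : Edge T, e.tgt = v ∧ ω e ≠ 0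

/-- All the edges from `v` to its children are unweighted. -/
def IsClear (ω : Edge T → ℕ) (v : T) : Prop := ∀ e : Edge T, e.src = v → ω e = 0

/-- `v` is a vertex of `T_ω` at which an edge to a child is still unweighted. -/
def IsUnsaturated (ω : Edge T → ℕ) (v : T) : Prop :=
  InTree ω v ∧ ∃ e : Edge T, e.src = v ∧ ω e = 0

/-- The weighted length of the path from the root to `v`. -/
noncomputable def weightedLength (ℓ : Edge T → ℝ) (ω : Edge T → ℕ) (v : T) : ℝ :=
  ∑ᶠ (e : Edge T) (_ : e.tgt ≤ v), (ω e : ℝ) * ℓ e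

open Classical in
/-- Give weight one to the edges in `S`, and add one to the weights on the path from the root
to `x`. -/
noncomputable def reweight (ω : Edge T → ℕ) (x : T) (S : Set (Edge T)) : Edge T → ℕ :=
  fun e => if e ∈ S then 1 else if e.tgt ≤ x then ω e + 1 else ω e

/-- One step of the weighting process: `x` is an unsaturated vertex of `T_ω` at minimum weighted
length from the root, and `ω'` is obtained from `ω` by weighting a new strict path at `x` if `x` is
not clear, and two strict paths at `x` if `x` is clear. -/
def IsWeightingStep (ℓ : Edge T → ℝ) (ω : Edge T → ℕ) (x : T) (ω' : Edge T → ℕ) : Prop :=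
  IsUnsaturated ω x ∧
  (∀ v, IsUnsaturated ω v → weightedLength ℓ ω x ≤ weightedLength ℓ ω v) ∧
  ((¬ IsClear ω x ∧ ∃ e : Edge T, e.src = x ∧ ω e = 0 ∧ ω' = reweight ω x (strictPath e)) ∨
   (IsClear ω x ∧ ∃ e f : Edge T, e.src = x ∧ f.src = x ∧ e ≠ f ∧
      ω' = reweight ω x (strictPath e ∪ strictPath f)))

/-- `ω 0, ω 1, …` is an (infinite) factorial weighting sequence, with the vertices `x n` chosen in
the process.  At stage `0` one strict path at the root is weighted. -/
structure IsWeightingSequence (ℓ : Edge T → ℝ) (ω : ℕ → Edge T → ℕ) (x : ℕ → T) : Prop where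
  zero : ω 0 = 0
  first_vertex : x 0 = ⊥
  first : ∃ e : Edge T, e.src = ⊥ ∧ ω 1 = reweight (ω 0) ⊥ (strictPath e)
  step : ∀ n, 1 ≤ n → IsWeightingStep ℓ (ω n) (x n) (ω (n + 1))

/-- The normalized weight `ω_n / n`. -/
noncomputable def normalizedWeight (ω : ℕ → Edge T → ℕ) (n : ℕ) (e : Edge T) : ℝ :=
  (ω n e : ℝ) / n

/-- `μ`, a measure of total mass one on the extended boundary, is consistent with `ω_n / n`:
`μ(B_v)` is the normalized weight of the edge ending in `v`, for all internal vertices `v ≠ ⊥` of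
`T_{ω_n}`. -/
def IsConsistent (ω : ℕ → Edge T → ℕ) (n : ℕ) (μ : Measure (ExtBoundary T)) : Prop :=
  IsProbabilityMeasure μ ∧
    ∀ e : Edge T, InTree (ω n) e.tgt → ¬ IsClear (ω n) e.tgt →
      μ (ExtBoundary.cyl e.tgt) = ENNReal.ofReal (normalizedWeight ω n e)

end Weighting

section Greedy

/-- The intersection pairing: the total length of the edges common to `ρ` and `τ`.  It is used only
for `ρ ≠ τ`, where there are finitely many such edges. -/
noncomputable def pairing (ℓ : Edge T → ℝ) (ρ τ : ExtBoundary T) : ℝ :=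
  ∑ᶠ (e : Edge T) (_ : e.tgt ∈ ρ.1 ∧ e.tgt ∈ τ.1), ℓ e

/-- `ρ 0, ρ 1, …` is an (infinite) factorial-determining sequence: each `ρ n` minimizes
`∑_{j < n} ⟨ρ, ρ j⟩` among the points of the extended boundary different from
`ρ 0, …, ρ (n - 1)`. -/
def IsFactorialDetermining (ℓ : Edge T → ℝ) (ρ : ℕ → ExtBoundary T) : Prop :=
  ∀ n, (∀ j < n, ρ n ≠ ρ j) ∧
    ∀ τ : ExtBoundary T, (∀ j < n, τ ≠ ρ j) →
      ∑ j ∈ Finset.range n, pairing ℓ (ρ n) (ρ j) ≤ ∑ j ∈ Finset.range n, pairing ℓ τ (ρ j)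

end Greedy

/-- `a n` is the (logarithmic) factorial `n!` of `(T, ℓ)`, for every `n`: the number produced at
stage `n` by the weighting process (which does not break off), whatever the choices made in it, and
also the number produced by any factorial-determining sequence. -/
structure IsFactorialSequence (ℓ : Edge T → ℝ) (a : ℕ → ℝ) : Prop where
  exists_weighting : ∃ ω x, IsWeightingSequence ℓ ω x
  eq_weighting : ∀ ω x, IsWeightingSequence ℓ ω x → ∀ n, weightedLength ℓ (ω n) (x n) = a n
  eq_determining : ∀ ρ, IsFactorialDetermining ℓ ρ →
    ∀ n, ∑ j ∈ Finset.range n, pairing ℓ (ρ n) (ρ j) = a n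

end TreeFactorial

/-!
# The factorial of a transient tree and its harmonic measure

**Flows.** A random walk that is transient escapes from the root with positive probability.  The
probability of never visiting the root is harmonic off the root and increases away from it, so its
gradient is, up to a factor, a unit flow; on every finite subtree its energy is at most the flow
through the exits, because the potential is at most one.  This gives a unit flow of finite energy
(`IsTransient.exists_isBoundedUnitFlow`).  A minimizer of the energy exists by compactness and is
unique by the parallelogram law.  Its potential at every vertex reached by the flow is at most the
minimal energy `H` (`IsUnitCurrentFlow.pot_le`): otherwise it could be improved by moving mass
away from this vertex.

**Weightings.** A weight function `ω_n` of the process is an integral flow of strength `n`, except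
at the ends of strict paths of weight one.  Its discrete energy `∑ ℓ ω (ω - 1) / 2` grows by
`n!` at step `n`.  The greedy choice of `x_n` makes `ω_n` a minimizer of the discrete energy among
all such integral flows: from any other one a unit path can be removed that costs at least the
minimal weighted length of an unsaturated vertex.  Hence `∑_{j < n} j!` is the minimum of a problem
which involves no choices, and `n!` is the same for all weighting sequences
(`IsWeightingSequence.weightedLength_unique`).

**Asymptotics.** Consider the finite subtree of the edges of weight at least two.  The weighted
length `n!` is compared with the flow of `η` and with the flow of `ω_n` through the exits of this
subtree; summation by parts (`sum_exitEdges`) and the bound on the potential of `η` give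
`limsup n! / n ≤ H`.  Every limit point of `ω_n / n` is a unit flow of energy at most `H`, hence
it is `η`; Fatou's lemma and the monotonicity of `n!` then give `n! / n → H`
(`IsWeightingSequence.tendsto_weightedLength_div`).

**Measures.** The harmonic measure is the image of Lebesgue measure on the unit interval under a
map that sends nested intervals of lengths `η(e)` to the sets `B_v`.  Convergence of the masses of
all `B_v`, which form a π-system and a basis of the topology, implies weak convergence
(`IsWeightingSequence.weaklyTendsTo`).

**Greedy points.** The edges weighted along a factorial-determining sequence carry the number of
earlier points that pass through them, and the next point leaves the earlier ones at a vertex of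
minimal weighted length.  So every such sequence comes from a weighting sequence
(`IsFactorialDetermining.exists_isWeightingSequence`), with which its empirical measures are
consistent.
-/

namespace TreeFactorial
variable {T : RootedTree}
open scoped Classical

/-! ### Rooted trees and finite sets of edges -/

theorem Edge.ext_tgt {e f : Edge T} (h : e.tgt = f.tgt) : e = f := Subtype.ext h

theorem Edge.tgt_ne_bot (e : Edge T) : e.tgt ≠ ⊥ := e.2

theorem Edge.src_covBy_tgt (e : Edge T) : e.src ⋖ e.tgt :=
  Order.pred_covBy_of_not_isMin fun h => e.2 (isMin_iff_eq_bot.mp h)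

theorem Edge.src_lt_tgt (e : Edge T) : e.src < e.tgt := e.src_covBy_tgt.lt

theorem Edge.le_src_iff {e : Edge T} {v : T} : v ≤ e.src ↔ v < e.tgt :=
  ⟨fun h => h.trans_lt e.src_lt_tgt, fun h => Order.le_pred_of_lt h⟩

theorem le_total_of_le {a b v : T} (ha : a ≤ v) (hb : b ≤ v) : a ≤ b ∨ b ≤ a :=
  (le_total_of_directed ha hb).symm

/-- Induction along the edges of a rooted tree, starting from the root. -/
theorem tree_induction {P : T → Prop} (bot : P ⊥) (step : ∀ e : Edge T, P e.src → P e.tgt)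
    (v : T) : P v := by
  obtain ⟨n, hn⟩ := (bot_le (a := v)).exists_pred_iterate
  induction n generalizing v with
  | zero => simp only [Function.iterate_zero, id_eq] at hn; rwa [hn]
  | succ n ih =>
    by_cases hv : v = ⊥
    · rwa [hv]
    · exact step ⟨v, hv⟩ (ih _ hn)

theorem Iic_tgt (e : Edge T) : Set.Iic e.tgt = insert e.tgt (Set.Iic e.src) := by
  ext v
  rw [Set.mem_Iic, Set.mem_insert_iff, Set.mem_Iic, Edge.le_src_iff, le_iff_eq_or_lt]

theorem finite_Iic (v : T) : (Set.Iic v).Finite := by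
  induction v using tree_induction with
  | bot => simp
  | step e ih => rw [Iic_tgt]; exact ih.insert _

theorem exists_child_le {u v : T} (h : u < v) : ∃ e : Edge T, e.src = u ∧ e.tgt ≤ v := by
  induction v using tree_induction with
  | bot => exact absurd h not_lt_bot
  | step e ih =>
    rcases (Edge.le_src_iff.mpr h).eq_or_lt with h' | h'
    · exact ⟨e, h'.symm, le_rfl⟩
    · obtain ⟨f, hf, hle⟩ := ih h'
      exact ⟨f, hf, hle.trans e.src_lt_tgt.le⟩

theorem Edge.eq_of_le_of_le {e f : Edge T} {v : T} (h : e.src = f.src) (he : e.tgt ≤ v)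
    (hf : f.tgt ≤ v) : e = f := by
  rcases le_total_of_le he hf with h' | h'
  · rcases h'.eq_or_lt with h'' | h''
    · exact Edge.ext_tgt h''
    · exact absurd e.src_lt_tgt (not_lt_of_ge (h ▸ Edge.le_src_iff.mpr h''))
  · rcases h'.eq_or_lt with h'' | h''
    · exact Edge.ext_tgt h''.symm
    · exact absurd f.src_lt_tgt (not_lt_of_ge (h ▸ Edge.le_src_iff.mpr h''))

theorem Edge.eq_of_le {e f : Edge T} (h : e.src = f.src) (hef : e.tgt ≤ f.tgt) : e = f :=
  Edge.eq_of_le_of_le h hef le_rfl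

theorem exists_edge_tgt {v : T} (hv : v ≠ ⊥) : ∃ e : Edge T, e.tgt = v := ⟨⟨v, hv⟩, rfl⟩

theorem finite_edges_le (v : T) : {e : Edge T | e.tgt ≤ v}.Finite :=
  Set.Finite.of_finite_image ((finite_Iic v).subset (by rintro _ ⟨e, he, rfl⟩; exact he))
    (fun _ _ _ _ h => Edge.ext_tgt h)

/-- The edges of the path from the root to `v`. -/
noncomputable def pathEdges (v : T) : Finset (Edge T) := (finite_edges_le v).toFinset

@[simp] theorem mem_pathEdges {v : T} {e : Edge T} : e ∈ pathEdges v ↔ e.tgt ≤ v := by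
  simp [pathEdges]

theorem pathEdges_bot : pathEdges (⊥ : T) = ∅ := by
  ext e; simp [e.tgt_ne_bot]

theorem pathEdges_tgt (e : Edge T) : pathEdges e.tgt = insert e (pathEdges e.src) := by
  ext f
  rw [Finset.mem_insert, mem_pathEdges, mem_pathEdges, Edge.le_src_iff, le_iff_eq_or_lt]
  exact or_congr_left ⟨Edge.ext_tgt, congrArg Edge.tgt⟩

theorem not_mem_pathEdges_src (e : Edge T) : e ∉ pathEdges e.src := by
  simpa using e.src_lt_tgt.not_ge

/-- The potential of a function on the edges: the sum of its values on the path from the root. -/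
noncomputable def pot (g : Edge T → ℝ) (v : T) : ℝ := ∑ e ∈ pathEdges v, g e

theorem pot_bot (g : Edge T → ℝ) : pot g ⊥ = 0 := by simp [pot, pathEdges_bot]

theorem pot_tgt (g : Edge T → ℝ) (e : Edge T) : pot g e.tgt = pot g e.src + g e := by
  rw [pot, pathEdges_tgt, Finset.sum_insert (not_mem_pathEdges_src e), add_comm]; rfl

theorem pot_mono {g : Edge T → ℝ} (hg : ∀ e, 0 ≤ g e) {u v : T} (h : u ≤ v) :
    pot g u ≤ pot g v :=
  Finset.sum_le_sum_of_subset_of_nonneg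
    (fun e he => by simp only [mem_pathEdges] at he ⊢; exact he.trans h) fun e _ _ => hg e

theorem weightedLength_eq_pot (ℓ : Edge T → ℝ) (ω : Edge T → ℕ) (v : T) :
    weightedLength ℓ ω v = pot (fun e => (ω e : ℝ) * ℓ e) v := by
  rw [weightedLength, pot]
  exact finsum_mem_eq_finite_toFinset_sum _ (finite_edges_le v)

variable (hT : IsLocallyFinite T)

/-- The edges from `v` to its children. -/
noncomputable def childEdges (v : T) : Finset (Edge T) := (hT v).toFinset

@[simp] theorem mem_childEdges {v : T} {e : Edge T} : e ∈ childEdges hT v ↔ e.src = v := by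
  simp [childEdges]

theorem finsum_childEdges {M : Type*} [AddCommMonoid M] (θ : Edge T → M) (v : T) :
    ∑ᶠ (f : Edge T) (_ : f.src = v), θ f = ∑ f ∈ childEdges hT v, θ f :=
  finsum_mem_eq_finite_toFinset_sum _ (hT v)

/-- The edges ending at distance at most `n` from the root. -/
def ballEdges (T : RootedTree) (n : ℕ) : Set (Edge T) := {e | Order.pred^[n] e.tgt = ⊥}

theorem ballEdges_src {n : ℕ} {e : Edge T} :
    e ∈ ballEdges T (n + 1) ↔ Order.pred^[n] e.src = ⊥ := by
  simp only [ballEdges, Set.mem_ofPred_eq, Function.iterate_succ_apply]; rfl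

include hT in
theorem finite_ballEdges (n : ℕ) : (ballEdges T n).Finite := by
  induction n with
  | zero => exact (Set.finite_empty).subset fun e he => e.tgt_ne_bot he
  | succ n ih =>
    refine ((hT ⊥).union (ih.biUnion fun e _ => hT e.tgt)).subset fun e he => ?_
    rw [ballEdges_src] at he
    by_cases h : e.src = ⊥
    · exact Or.inl h
    · exact Or.inr (Set.mem_iUnion₂.mpr ⟨⟨e.src, h⟩, he, rfl⟩)

theorem exists_mem_ballEdges (e : Edge T) : ∃ n, e ∈ ballEdges T n :=
  (bot_le (a := e.tgt)).exists_pred_iterate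

include hT in
theorem countable_edge : Countable (Edge T) := by
  have : (Set.univ : Set (Edge T)) = ⋃ n, ballEdges T n := by
    ext e; simpa using exists_mem_ballEdges e
  rw [← Set.countable_univ_iff, this]
  exact Set.countable_iUnion fun n => (finite_ballEdges hT n).countable

include hT in
theorem countable_vertex : Countable T := by
  have := countable_edge hT
  refine Set.countable_univ_iff.mp
    (((Set.countable_range (Edge.tgt (T := T))).insert ⊥).mono fun v _ => ?_)
  by_cases h : v = ⊥
  · exact Or.inl h
  · exact Or.inr ⟨⟨v, h⟩, rfl⟩

/-- The finite set `D` of edges is closed under passing to ancestors. -/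
def IsLowerEdges (D : Finset (Edge T)) : Prop :=
  ∀ ⦃e f : Edge T⦄, e.tgt ≤ f.tgt → f ∈ D → e ∈ D

/-- The vertices of the subtree with edge set `D`. -/
noncomputable def treeVertices (D : Finset (Edge T)) : Finset T := insert ⊥ (D.image Edge.tgt)

/-- The edges through which one leaves the subtree with edge set `D`. -/
noncomputable def exitEdges (D : Finset (Edge T)) : Finset (Edge T) :=
  (treeVertices D).biUnion (childEdges hT) \ D

theorem mem_treeVertices {D : Finset (Edge T)} {v : T} :
    v ∈ treeVertices D ↔ v = ⊥ ∨ ∃ e ∈ D, e.tgt = v := by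
  simp [treeVertices]

theorem mem_exitEdges {D : Finset (Edge T)} {f : Edge T} :
    f ∈ exitEdges hT D ↔ (f.src = ⊥ ∨ ∃ e ∈ D, e.tgt = f.src) ∧ f ∉ D := by
  simp only [exitEdges, Finset.mem_sdiff, Finset.mem_biUnion, mem_childEdges, mem_treeVertices]
  exact and_congr_left fun _ => ⟨by rintro ⟨a, h, rfl⟩; exact h, fun h => ⟨_, h, rfl⟩⟩

/-- Summation by parts on a finite subtree, for a flow `θ` and a function `g` on the vertices: the
flow through the exits, weighted by `g`, is determined by the increments of `g`. -/
theorem sum_exitEdges {D : Finset (Edge T)} (hD : IsLowerEdges D) {θ : Edge T → ℝ}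
    (hθ : ∀ e ∈ D, θ e = ∑ f ∈ childEdges hT e.tgt, θ f) (g : T → ℝ) :
    ∑ f ∈ exitEdges hT D, θ f * g f.src =
      g ⊥ * ∑ f ∈ childEdges hT ⊥, θ f + ∑ e ∈ D, θ e * (g e.tgt - g e.src) := by
  have hdisj : ∀ u ∈ treeVertices D, ∀ v ∈ treeVertices D, u ≠ v →
      Disjoint (childEdges hT u) (childEdges hT v) := by
    intro u _ v _ huv
    refine Finset.disjoint_left.mpr fun e h1 h2 => huv ?_
    rw [mem_childEdges] at h1 h2
    rw [← h1, h2]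
  have hsub : D ⊆ (treeVertices D).biUnion (childEdges hT) := by
    intro e he
    refine Finset.mem_biUnion.mpr ⟨e.src, mem_treeVertices.mpr ?_, by simp⟩
    by_cases h : e.src = ⊥
    · exact Or.inl h
    · exact Or.inr ⟨⟨e.src, h⟩, hD (f := e) e.src_lt_tgt.le he, rfl⟩
  have hbot : (⊥ : T) ∉ D.image Edge.tgt := by
    simp only [Finset.mem_image, not_exists, not_and]
    exact fun e _ => e.tgt_ne_bot
  have h1 : ∑ f ∈ (treeVertices D).biUnion (childEdges hT), θ f * g f.src =
      g ⊥ * ∑ f ∈ childEdges hT ⊥, θ f + ∑ e ∈ D, θ e * g e.tgt := by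
    rw [Finset.sum_biUnion hdisj, treeVertices, Finset.sum_insert hbot,
      Finset.sum_image fun _ _ _ _ h => Edge.ext_tgt h, Finset.mul_sum]
    congr 1
    · refine Finset.sum_congr rfl fun f hf => ?_
      rw [(mem_childEdges hT).mp hf, mul_comm]
    · refine Finset.sum_congr rfl fun e he => ?_
      rw [hθ e he, Finset.sum_mul]
      refine Finset.sum_congr rfl fun f hf => ?_
      rw [(mem_childEdges hT).mp hf]
  rw [exitEdges, Finset.sum_sdiff_eq_sub hsub, h1]
  simp only [mul_sub, Finset.sum_sub_distrib]
  ring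

theorem sum_exitEdges_one {D : Finset (Edge T)} (hD : IsLowerEdges D) {θ : Edge T → ℝ}
    (hθ : ∀ e ∈ D, θ e = ∑ f ∈ childEdges hT e.tgt, θ f) :
    ∑ f ∈ exitEdges hT D, θ f = ∑ f ∈ childEdges hT ⊥, θ f := by
  simpa using sum_exitEdges hT hD hθ fun _ => 1

theorem sum_exitEdges_pot {D : Finset (Edge T)} (hD : IsLowerEdges D) {θ : Edge T → ℝ}
    (hθ : ∀ e ∈ D, θ e = ∑ f ∈ childEdges hT e.tgt, θ f) (g : Edge T → ℝ) :
    ∑ f ∈ exitEdges hT D, θ f * pot g f.src = ∑ e ∈ D, θ e * g e := by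
  rw [sum_exitEdges hT hD hθ, pot_bot, zero_mul, zero_add]
  simp [pot_tgt]

/-! ### Strict paths -/

theorem mem_strictPath_self (e : Edge T) : e ∈ strictPath e :=
  ⟨le_rfl, fun _ h1 h2 => absurd h2 h1.not_gt⟩

theorem mem_strictPath_of_le {e f g : Edge T} (hg : g ∈ strictPath e) (h1 : e.tgt ≤ f.tgt)
    (h2 : f.tgt ≤ g.tgt) : f ∈ strictPath e :=
  ⟨h1, fun z hz hzf => hg.2 z hz (hzf.trans_le h2)⟩

theorem child_mem_strictPath {e f g : Edge T} (hg : g ∈ strictPath e) (hb : ¬ IsBranching g.tgt)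
    (hf : f.src = g.tgt) : f ∈ strictPath e := by
  refine ⟨hg.1.trans (hf ▸ f.src_lt_tgt.le), fun z hz hzf => ?_⟩
  have : z ≤ g.tgt := hf ▸ Edge.le_src_iff.mpr hzf
  rcases this.eq_or_lt with h | h
  · rwa [h]
  · exact hg.2 z hz h

theorem strictPath_le_total {e f g : Edge T} (hf : f ∈ strictPath e) (hg : g ∈ strictPath e) :
    f.tgt ≤ g.tgt ∨ g.tgt ≤ f.tgt := by
  rcases eq_or_ne f g with rfl | hne
  · exact Or.inl le_rfl
  by_contra! hcon
  -- where the two paths separate there is a branching vertex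
  have hinf : f.tgt ⊓ g.tgt < f.tgt := lt_of_le_of_ne inf_le_left fun h => hcon.1 (h ▸ inf_le_right)
  have hinf' : f.tgt ⊓ g.tgt < g.tgt :=
    lt_of_le_of_ne inf_le_right fun h => hcon.2 (h ▸ inf_le_left)
  obtain ⟨a, ha, haf⟩ := exists_child_le hinf
  obtain ⟨b, hb, hbg⟩ := exists_child_le hinf'
  refine hf.2 _ (le_inf hf.1 hg.1) hinf ⟨a, b, ha, hb, ?_⟩
  rintro rfl
  exact absurd (le_inf haf hbg) (ha ▸ a.src_lt_tgt).not_ge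

theorem eq_of_branching_ends {e f g : Edge T} (hf : f ∈ strictPath e) (hg : g ∈ strictPath e)
    (hbf : IsBranching f.tgt) (hbg : IsBranching g.tgt) : f = g := by
  rcases strictPath_le_total hf hg with h | h
  · rcases h.eq_or_lt with h' | h'
    · exact Edge.ext_tgt h'
    · exact absurd hbf (hg.2 _ hf.1 h')
  · rcases h.eq_or_lt with h' | h'
    · exact (Edge.ext_tgt h').symm
    · exact absurd hbg (hf.2 _ hg.1 h')

theorem childEdges_eq_singleton {v : T} (hb : ¬ IsBranching v) {f : Edge T} (hf : f.src = v) :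
    childEdges hT v = {f} := by
  ext g
  simp only [mem_childEdges, Finset.mem_singleton]
  exact ⟨fun hg => by_contra fun h => hb ⟨g, f, hg, hf, h⟩, fun h => h ▸ hf⟩

theorem exists_child_of_not_isLeaf {v : T} (h : ¬ IsLeaf v) : ∃ e : Edge T, e.src = v := by
  simpa [IsLeaf] using h

end TreeFactorial

namespace TreeFactorial
variable {T : RootedTree}
open scoped Classical

/-! ### Unit flows of finite energy -/

theorem edge_antitone {M : Type*} [Preorder M] {w : Edge T → M}
    (h : ∀ e f : Edge T, f.src = e.tgt → w f ≤ w e) {e f : Edge T} (hef : e.tgt ≤ f.tgt) :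
    w f ≤ w e := by
  suffices H : ∀ v : T, ∀ f : Edge T, f.tgt = v → e.tgt ≤ f.tgt → w f ≤ w e from H _ f rfl hef
  intro v
  induction v using tree_induction with
  | bot => exact fun f hf => absurd hf f.tgt_ne_bot
  | step g ih =>
    intro f hf hle
    obtain rfl := Edge.ext_tgt hf
    rcases hle.eq_or_lt with h' | h'
    · rw [Edge.ext_tgt h']
    · have h1 := Edge.le_src_iff.mpr h'
      have h2 : f.src ≠ ⊥ := fun h0 => e.tgt_ne_bot (le_bot_iff.mp (h0 ▸ h1))
      obtain ⟨p, hp⟩ := exists_edge_tgt h2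
      exact (h p f hp.symm).trans (ih p hp (hp ▸ h1))

theorem exists_ultrafilter_limit {ι : Type*} (𝓤 : Ultrafilter ℕ) {θ : ℕ → ι → ℝ}
    (h : ∀ e, ∀ᶠ n in (𝓤 : Filter ℕ), θ n e ∈ Set.Icc (0 : ℝ) 1) :
    ∃ φ : ι → ℝ, ∀ e, Tendsto (fun n => θ n e) 𝓤 (𝓝 (φ e)) := by
  have : ∀ e, ∃ y, Tendsto (fun n => θ n e) 𝓤 (𝓝 y) := by
    intro e
    obtain ⟨y, -, hy⟩ := (isCompact_Icc (a := (0 : ℝ)) (b := 1)).ultrafilter_le_nhds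
      (𝓤.map fun n => θ n e) (by rw [Filter.le_principal_iff]; exact h e)
    exact ⟨y, hy⟩
  exact ⟨fun e => (this e).choose, fun e => (this e).choose_spec⟩

variable (hT : IsLocallyFinite T)

namespace IsUnitFlow

variable {θ : Edge T → ℝ} (hθ : IsUnitFlow θ)

include hθ

theorem conserve_sum (e : Edge T) : θ e = ∑ f ∈ childEdges hT e.tgt, θ f := by
  rw [← finsum_childEdges]; exact hθ.conserve e

theorem total_sum : ∑ f ∈ childEdges hT ⊥, θ f = 1 := by
  rw [← finsum_childEdges]; exact hθ.total

include hT in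
theorem antitone {e f : Edge T} (hef : e.tgt ≤ f.tgt) : θ f ≤ θ e :=
  edge_antitone (w := θ) (fun e f hf => by
    rw [hθ.conserve_sum hT e]
    exact Finset.single_le_sum (fun g _ => hθ.nonneg g) ((mem_childEdges hT).mpr hf)) hef

include hT in
theorem le_one (e : Edge T) : θ e ≤ 1 := by
  obtain ⟨f, hf, hfe⟩ := exists_child_le (bot_lt_iff_ne_bot.mpr e.tgt_ne_bot)
  refine (hθ.antitone hT hfe).trans ?_
  rw [← hθ.total_sum hT]
  exact Finset.single_le_sum (fun g _ => hθ.nonneg g) ((mem_childEdges hT).mpr hf)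

theorem eq_zero_of_isLeaf {e : Edge T} (h : IsLeaf e.tgt) : θ e = 0 := by
  rw [hθ.conserve e]
  simp [h _]

include hT in
theorem eq_on_strictPath {e f : Edge T} (hf : f ∈ strictPath e) : θ f = θ e := by
  suffices H : ∀ v : T, ∀ f : Edge T, f.tgt = v → f ∈ strictPath e → θ f = θ e from H _ f rfl hf
  intro v
  induction v using tree_induction with
  | bot => exact fun f hf => absurd hf f.tgt_ne_bot
  | step g ih =>
    intro f hf hfe
    obtain rfl := Edge.ext_tgt hf
    rcases hfe.1.eq_or_lt with h' | h'
    · rw [Edge.ext_tgt h']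
    · have h1 := Edge.le_src_iff.mpr h'
      have h2 : f.src ≠ ⊥ := fun h0 => e.tgt_ne_bot (le_bot_iff.mp (h0 ▸ h1))
      obtain ⟨p, hp⟩ := exists_edge_tgt h2
      have hb : ¬ IsBranching p.tgt := hp ▸ hfe.2 _ h1 f.src_lt_tgt
      have hps : p ∈ strictPath e :=
        mem_strictPath_of_le hfe (hp ▸ h1) (hp ▸ f.src_lt_tgt.le)
      rw [← ih p hp hps, hθ.conserve_sum hT p, childEdges_eq_singleton hT hb hp.symm,
        Finset.sum_singleton]

end IsUnitFlow

include hT in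
theorem isUnitFlow_of_tendsto {l : Filter ℕ} [l.NeBot] {θ : ℕ → Edge T → ℝ} {φ : Edge T → ℝ}
    (hφ : ∀ e, Tendsto (fun n => θ n e) l (𝓝 (φ e))) (hnn : ∀ᶠ n in l, ∀ e, 0 ≤ θ n e)
    (hc : ∀ e : Edge T, Tendsto (fun n => θ n e - ∑ f ∈ childEdges hT e.tgt, θ n f) l (𝓝 0))
    (ht : Tendsto (fun n => ∑ f ∈ childEdges hT ⊥, θ n f) l (𝓝 1)) : IsUnitFlow φ where
  nonneg e := ge_of_tendsto (hφ e) (hnn.mono fun n h => h e)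
  conserve e := by
    rw [finsum_childEdges hT]
    have := tendsto_nhds_unique (hc e) ((hφ e).sub (tendsto_finsetSum _ fun f _ => hφ f))
    linarith
  total := by
    rw [finsum_childEdges hT]
    exact tendsto_nhds_unique (tendsto_finsetSum _ fun f _ => hφ f) ht

variable {ℓ : Edge T → ℝ} (hℓ : ∀ e, 0 < ℓ e)

include hℓ in
theorem summable_energy_of_sum_le {φ : Edge T → ℝ} {E : ℝ}
    (h : ∀ s : Finset (Edge T), ∑ e ∈ s, ℓ e * φ e ^ 2 ≤ E) :
    (Summable fun e => ℓ e * φ e ^ 2) ∧ energy ℓ φ ≤ E := by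
  have hs : Summable fun e => ℓ e * φ e ^ 2 :=
    summable_of_sum_le (fun e => mul_nonneg (hℓ e).le (sq_nonneg _)) h
  exact ⟨hs, hs.tsum_le_of_sum_le h⟩

include hℓ in
theorem summable_mul_mul {φ ψ : Edge T → ℝ} (hφ : Summable fun e => ℓ e * φ e ^ 2)
    (hψ : Summable fun e => ℓ e * ψ e ^ 2) : Summable fun e => ℓ e * (φ e * ψ e) := by
  refine Summable.of_norm_bounded (hφ.add hψ) fun e => ?_
  rw [Real.norm_eq_abs, abs_mul, abs_of_pos (hℓ e), ← mul_add]
  refine mul_le_mul_of_nonneg_left ?_ (hℓ e).le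
  rw [abs_le]
  constructor <;> nlinarith [sq_nonneg (φ e + ψ e), sq_nonneg (φ e - ψ e), sq_nonneg (φ e),
    sq_nonneg (ψ e)]

include hℓ in
theorem summable_energy_lin {φ ψ : Edge T → ℝ} (hφ : Summable fun e => ℓ e * φ e ^ 2)
    (hψ : Summable fun e => ℓ e * ψ e ^ 2) (s t : ℝ) :
    (Summable fun e => ℓ e * (s * φ e + t * ψ e) ^ 2) ∧
      energy ℓ (fun e => s * φ e + t * ψ e) = s ^ 2 * energy ℓ φ +
        2 * (s * t) * ∑' e, ℓ e * (φ e * ψ e) + t ^ 2 * energy ℓ ψ := by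
  have h : HasSum (fun e => ℓ e * (s * φ e + t * ψ e) ^ 2) (s ^ 2 * energy ℓ φ +
        2 * (s * t) * ∑' e, ℓ e * (φ e * ψ e) + t ^ 2 * energy ℓ ψ) := by
    refine HasSum.congr_fun ?_ (fun e => ?_)
      (f := fun e => s ^ 2 * (ℓ e * φ e ^ 2) + 2 * (s * t) * (ℓ e * (φ e * ψ e)) +
        t ^ 2 * (ℓ e * ψ e ^ 2))
    · exact ((hφ.hasSum.mul_left _).add ((summable_mul_mul hℓ hφ hψ).hasSum.mul_left _)).add
        (hψ.hasSum.mul_left _)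
    · ring
  exact ⟨h.summable, h.tsum_eq⟩

theorem isUnitFlow_combine {φ ψ : Edge T → ℝ} (hφ : IsUnitFlow φ) (hψ : IsUnitFlow ψ) {s t : ℝ}
    (hst : s + t = 1) (hnn : ∀ e, 0 ≤ s * φ e + t * ψ e) (hT : IsLocallyFinite T) :
    IsUnitFlow fun e => s * φ e + t * ψ e where
  nonneg := hnn
  conserve e := by
    rw [finsum_childEdges hT, Finset.sum_add_distrib, ← Finset.mul_sum, ← Finset.mul_sum,
      ← hφ.conserve_sum hT, ← hψ.conserve_sum hT]
  total := by
    rw [finsum_childEdges hT, Finset.sum_add_distrib, ← Finset.mul_sum, ← Finset.mul_sum,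
      hφ.total_sum hT, hψ.total_sum hT, mul_one, mul_one, hst]

include hℓ in
theorem energy_nonneg (θ : Edge T → ℝ) : 0 ≤ energy ℓ θ :=
  tsum_nonneg fun e => mul_nonneg (hℓ e).le (sq_nonneg _)

include hT hℓ in
/-- A minimizing sequence of flows converges pointwise along an ultrafilter, and the energy is lower
semicontinuous. -/
theorem exists_isUnitCurrentFlow (hex : ∃ θ, IsBoundedUnitFlow ℓ θ) :
    ∃ η, IsUnitCurrentFlow ℓ η := by
  set S : Set ℝ := energy ℓ '' {θ | IsBoundedUnitFlow ℓ θ} with hS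
  have hne : S.Nonempty := hex.elim fun θ hθ => ⟨_, θ, hθ, rfl⟩
  have hbdd : BddBelow S := ⟨0, by rintro _ ⟨θ, -, rfl⟩; exact energy_nonneg hℓ θ⟩
  obtain ⟨u, -, hu, huS⟩ := exists_seq_tendsto_sInf hne hbdd
  choose θ hθ hθu using huS
  obtain ⟨φ, hφ⟩ := exists_ultrafilter_limit (hyperfilter ℕ) (θ := θ)
    fun e => Eventually.of_forall fun n => ⟨(hθ n).1.nonneg e, (hθ n).1.le_one hT e⟩
  have hu' : Tendsto u (hyperfilter ℕ : Filter ℕ) (𝓝 (sInf S)) :=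
    hu.mono_left (Nat.hyperfilter_le_atTop)
  have hflow : IsUnitFlow φ := by
    refine isUnitFlow_of_tendsto hT hφ (Eventually.of_forall fun n => (hθ n).1.nonneg)
      (fun e => ?_) ?_
    · simp [← (hθ _).1.conserve_sum hT]
    · simp [(hθ _).1.total_sum hT]
  have hen := summable_energy_of_sum_le hℓ (φ := φ) (E := sInf S) fun s => by
    refine le_of_tendsto_of_tendsto' (tendsto_finsetSum s fun e _ =>
      ((hφ e).pow 2).const_mul (ℓ e)) hu' fun n => ?_
    rw [← hθu n]
    exact (hθ n).2.sum_le_tsum s fun e _ => mul_nonneg (hℓ e).le (sq_nonneg _)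
  exact ⟨φ, ⟨hflow, hen.1⟩, fun ψ hψ => hen.2.trans (csInf_le hbdd ⟨ψ, hψ, rfl⟩)⟩

include hT hℓ in
/-- Strict convexity of the energy. -/
theorem IsUnitCurrentFlow.eq_of_energy_le {η θ : Edge T → ℝ} (hη : IsUnitCurrentFlow ℓ η)
    (hθ : IsBoundedUnitFlow ℓ θ) (hle : energy ℓ θ ≤ energy ℓ η) : θ = η := by
  have h1 := summable_energy_lin hℓ hη.1.2 hθ.2 (1 / 2) (1 / 2)
  have h2 := summable_energy_lin hℓ hη.1.2 hθ.2 1 (-1)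
  have h3 := hη.2 _ ⟨isUnitFlow_combine hη.1.1 hθ.1 (s := 1 / 2) (t := 1 / 2) (by norm_num)
    (fun e => by have := hη.1.1.nonneg e; have := hθ.1.nonneg e; positivity) hT, h1.1⟩
  rw [h1.2] at h3
  have h4 : energy ℓ (fun e => 1 * η e + -1 * θ e) = 0 :=
    le_antisymm (by rw [h2.2]; linarith) (energy_nonneg hℓ _)
  funext e
  have h5 := (h2.1.hasSum_iff.mpr h4)
  rw [hasSum_zero_iff_of_nonneg fun e => mul_nonneg (hℓ e).le (sq_nonneg _)] at h5
  have h6 := congrFun h5 e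
  simp only [Pi.zero_apply, mul_eq_zero, (hℓ e).ne', false_or] at h6
  have := pow_eq_zero_iff (two_ne_zero) |>.mp h6
  linarith

/-- The flow obtained from `η` by forcing it through the edge `a`. -/
noncomputable def forcedFlow (η : Edge T → ℝ) (a e : Edge T) : ℝ :=
  if e.tgt ≤ a.tgt then 1 else if a.tgt ≤ e.tgt then η e / η a else 0

include hT in
theorem sum_childEdges_forcedFlow {η : Edge T → ℝ} {a : Edge T} {u : T} (h : u < a.tgt) :
    ∑ f ∈ childEdges hT u, forcedFlow η a f = 1 := by
  obtain ⟨c, hc, hca⟩ := exists_child_le h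
  rw [Finset.sum_eq_single_of_mem c ((mem_childEdges hT).mpr hc)]
  · simp [forcedFlow, hca]
  · intro f hf hne
    rw [mem_childEdges] at hf
    have h1 : ¬ f.tgt ≤ a.tgt := fun h' =>
      hne (Edge.eq_of_le_of_le (hf.trans hc.symm) h' hca)
    have h2 : ¬ a.tgt ≤ f.tgt := fun h' => by
      rcases h'.eq_or_lt with h'' | h''
      · exact h1 h''.symm.le
      · exact absurd h (not_lt_of_ge (hf ▸ Edge.le_src_iff.mpr h''))
    simp [forcedFlow, h1, h2]

include hT in
theorem isUnitFlow_forcedFlow {η : Edge T → ℝ} (hη : IsUnitFlow η) {a : Edge T} (ha : 0 < η a) :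
    IsUnitFlow (forcedFlow η a) where
  nonneg e := by
    unfold forcedFlow
    split_ifs
    · exact zero_le_one
    · exact div_nonneg (hη.nonneg e) ha.le
    · exact le_rfl
  total := by
    rw [finsum_childEdges hT]
    exact sum_childEdges_forcedFlow hT (bot_lt_iff_ne_bot.mpr a.tgt_ne_bot)
  conserve e := by
    rw [finsum_childEdges hT]
    by_cases h1 : e.tgt < a.tgt
    · rw [sum_childEdges_forcedFlow hT h1, forcedFlow, if_pos h1.le]
    by_cases h2 : a.tgt ≤ e.tgt
    · have h3 : forcedFlow η a e = η e / η a := by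
        unfold forcedFlow
        split_ifs with h
        · rw [Edge.ext_tgt (le_antisymm h h2), div_self ha.ne']
        · rfl
      rw [h3, hη.conserve_sum hT e, Finset.sum_div]
      refine Finset.sum_congr rfl fun f hf => ?_
      rw [mem_childEdges] at hf
      have h4 : a.tgt < f.tgt := h2.trans_lt (hf ▸ f.src_lt_tgt)
      simp [forcedFlow, h4.le, h4.not_ge]
    · have h3 : ¬ e.tgt ≤ a.tgt := fun h => h.eq_or_lt.elim (fun h' => h2 h'.symm.le) h1
      rw [forcedFlow, if_neg h3, if_neg h2]
      refine (Finset.sum_eq_zero fun f hf => ?_).symm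
      rw [mem_childEdges] at hf
      have h4 : e.tgt < f.tgt := hf ▸ f.src_lt_tgt
      have h5 : ¬ f.tgt ≤ a.tgt := fun h => h3 (h4.le.trans h)
      have h6 : ¬ a.tgt ≤ f.tgt := fun h => h.eq_or_lt.elim (fun h' => h5 h'.symm.le)
        fun h' => h2 (hf ▸ Edge.le_src_iff.mpr h')
      rw [forcedFlow, if_neg h5, if_neg h6]

include hT in
theorem forcedFlow_le {η : Edge T → ℝ} (hη : IsUnitFlow η) {a : Edge T} (ha : 0 < η a)
    (e : Edge T) : forcedFlow η a e ≤ η e / η a := by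
  unfold forcedFlow
  split_ifs with h
  · exact (one_le_div ha).mpr (hη.antitone hT h)
  · exact le_rfl
  · exact div_nonneg (hη.nonneg e) ha.le

include hT hℓ in
/-- The potential of the unit current flow is bounded by its energy, the total voltage drop:
otherwise moving some current away from `v` would decrease the energy. -/
theorem IsUnitCurrentFlow.pot_le {η : Edge T → ℝ} (hη : IsUnitCurrentFlow ℓ η) (v : T) :
    pot (fun e => ℓ e * η e) v ≤ energy ℓ η := by
  induction v using tree_induction with
  | bot => rw [pot_bot]; exact energy_nonneg hℓ η
  | step a ih =>
    rcases (hη.1.1.nonneg a).eq_or_lt with ha | ha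
    · rw [pot_tgt, ← ha, mul_zero, add_zero]; exact ih
    set ψ := forcedFlow η a
    have hψ : IsUnitFlow ψ := isUnitFlow_forcedFlow hT hη.1.1 ha
    have hψs : Summable fun e => ℓ e * ψ e ^ 2 := by
      refine Summable.of_nonneg_of_le (fun e => mul_nonneg (hℓ e).le (sq_nonneg _)) (fun e => ?_)
        (hη.1.2.mul_right ((η a)⁻¹ ^ 2))
      rw [mul_assoc, ← mul_pow, ← div_eq_mul_inv]
      exact mul_le_mul_of_nonneg_left
        (pow_le_pow_left₀ (hψ.nonneg e) (forcedFlow_le hT hη.1.1 ha e) 2) (hℓ e).le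
    set X := ∑' e, ℓ e * (η e * ψ e) with hX
    have hkey : ∀ t : ℝ, 0 < t → t ≤ η a →
        0 ≤ 2 * (energy ℓ η - X) + t * (energy ℓ η - 2 * X + energy ℓ ψ) := by
      intro t ht hta
      have h1 := summable_energy_lin hℓ hη.1.2 hψs (1 + t) (-t)
      have h2 := hη.2 _ ⟨isUnitFlow_combine hη.1.1 hψ (s := 1 + t) (t := -t) (by ring)
        (fun e => ?_) hT, h1.1⟩
      · rw [h1.2] at h2
        have : 0 ≤ t * (2 * (energy ℓ η - X) + t * (energy ℓ η - 2 * X + energy ℓ ψ)) := by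
          rw [← hX] at h2; nlinarith
        exact nonneg_of_mul_nonneg_right this ht
      · have h3 := forcedFlow_le hT hη.1.1 ha e
        rw [le_div_iff₀ ha] at h3
        have h4 : t * ψ e ≤ η a * ψ e := mul_le_mul_of_nonneg_right hta (hψ.nonneg e)
        have h5 : 0 ≤ t * η e := mul_nonneg ht.le (hη.1.1.nonneg e)
        have h6 : ψ e * η a = η a * ψ e := mul_comm _ _
        have : ψ e = forcedFlow η a e := rfl
        rw [← this] at h3
        nlinarith
    have hXle : X ≤ energy ℓ η := by
      have hlim : Tendsto (fun t : ℝ => 2 * (energy ℓ η - X) +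
          t * (energy ℓ η - 2 * X + energy ℓ ψ)) (𝓝[>] 0)
          (𝓝 (2 * (energy ℓ η - X) + 0 * (energy ℓ η - 2 * X + energy ℓ ψ))) :=
        ((tendsto_id.mono_left nhdsWithin_le_nhds).mul_const _).const_add _
      have := ge_of_tendsto hlim (Filter.mem_of_superset (Ioc_mem_nhdsGT ha)
        fun t ht => hkey t ht.1 ht.2)
      linarith
    refine le_trans ?_ hXle
    have h1 : pot (fun e => ℓ e * η e) a.tgt = ∑ e ∈ pathEdges a.tgt, ℓ e * (η e * ψ e) :=
      Finset.sum_congr rfl fun e he => by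
        rw [show ψ e = 1 from if_pos (mem_pathEdges.mp he), mul_one]
    rw [h1]
    exact (summable_mul_mul hℓ hη.1.2 hψs).sum_le_tsum _ fun e _ =>
      mul_nonneg (hℓ e).le (mul_nonneg (hη.1.1.nonneg e) (hψ.nonneg e))

omit hℓ in
include hT in
/-- In a weakly complete tree, a strict path carrying some flow of finite energy is finite and ends
at a branching vertex. -/
theorem exists_branching_of_pos (hwc : IsWeaklyComplete ℓ) {θ : Edge T → ℝ}
    (hθ : IsBoundedUnitFlow ℓ θ) {e : Edge T} (he : 0 < θ e) :
    ∃ g ∈ strictPath e, IsBranching g.tgt := by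
  have hfin : (strictPath e).Finite := by
    by_contra hinf
    refine hwc e hinf ?_
    have h1 : Summable fun f : strictPath e => ℓ f * θ f ^ 2 := hθ.2.subtype _
    have h2 : Summable fun f : strictPath e => ℓ f * θ f ^ 2 * (θ e ^ 2)⁻¹ := h1.mul_right _
    refine h2.congr fun f => ?_
    rw [hθ.1.eq_on_strictPath hT f.2, mul_assoc, mul_inv_cancel₀ (by positivity), mul_one]
  by_contra! hcon
  obtain ⟨g, hg, hmax⟩ := hfin.exists_maximalFor Edge.tgt _ ⟨e, mem_strictPath_self e⟩
  have hleaf : ¬ IsLeaf g.tgt := fun h =>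
    he.ne' ((hθ.1.eq_on_strictPath hT hg).symm.trans (hθ.1.eq_zero_of_isLeaf h))
  obtain ⟨f, hf⟩ := exists_child_of_not_isLeaf hleaf
  have h1 := hmax (child_mem_strictPath hg (hcon g hg) hf) (hf ▸ f.src_lt_tgt.le)
  exact absurd (hf ▸ f.src_lt_tgt) h1.not_gt

end TreeFactorial

namespace TreeFactorial
variable {T : RootedTree}
open scoped Classical

variable (hT : IsLocallyFinite T)

/-! ### The states of the weighting process -/

/-- The properties of the weight function reached after `n` steps of the weighting process that
are used below: it is an integral flow of total amount `n` on the weighted subtree, ending in vertices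
with incoming weight one that are leaves or branching vertices of the whole tree. -/
structure IsPartialWeighting (ω : Edge T → ℕ) (n : ℕ) : Prop where
  total : ∑ f ∈ childEdges hT ⊥, ω f = n
  conserve : ∀ e : Edge T, ¬ IsClear ω e.tgt → ω e = ∑ f ∈ childEdges hT e.tgt, ω f
  clear : ∀ e : Edge T, ω e ≠ 0 → IsClear ω e.tgt → ω e = 1 ∧ (IsLeaf e.tgt ∨ IsBranching e.tgt)
  finite_two : {e | 2 ≤ ω e}.Finite
  finite_unsaturated : {v | IsUnsaturated ω v}.Finite

/-- `S` is a union of strict paths issuing from `x`. -/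
structure IsNewPaths (x : T) (S : Set (Edge T)) : Prop where
  gt : ∀ f ∈ S, x < f.tgt
  top : ∀ f ∈ S, f.src = x ∨ ∃ g ∈ S, g.tgt = f.src
  next : ∀ f ∈ S, ∀ g : Edge T, g.src = f.tgt → (g ∈ S ↔ ¬ IsBranching f.tgt)
  finite_ends : {v | IsBranching v ∧ ∃ f ∈ S, f.tgt = v}.Finite

/-- `S` is an admissible set of new edges for a step of the weighting process at `x`. -/
structure IsExtension (ω : Edge T → ℕ) (x : T) (S : Set (Edge T)) : Prop where
  inTree : InTree ω x
  new : IsNewPaths x S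
  zero : ∀ f ∈ S, ω f = 0
  card : ((childEdges hT x).filter (· ∈ S)).card = if x ≠ ⊥ ∧ IsClear ω x then 2 else 1

theorem isNewPaths_strictPath (e : Edge T) : IsNewPaths e.src (strictPath e) where
  gt f hf := e.src_lt_tgt.trans_le hf.1
  top f hf := by
    rcases hf.1.eq_or_lt with h | h
    · exact Or.inl (by rw [Edge.ext_tgt h])
    · have h1 := Edge.le_src_iff.mpr h
      obtain ⟨p, hp⟩ := exists_edge_tgt fun h0 => e.tgt_ne_bot (le_bot_iff.mp (h0 ▸ h1))
      exact Or.inr ⟨p, mem_strictPath_of_le hf (hp ▸ h1) (hp ▸ f.src_lt_tgt.le), hp⟩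
  next f hf g hg :=
    ⟨fun h => h.2 _ hf.1 (hg ▸ g.src_lt_tgt), fun h => child_mem_strictPath hf h hg⟩
  finite_ends := by
    refine Set.Subsingleton.finite ?_
    rintro _ ⟨hb, f, hf, rfl⟩ _ ⟨hb', g, hg, rfl⟩
    rw [eq_of_branching_ends hf hg hb hb']

theorem IsNewPaths.union {x : T} {e f : Edge T} (he : e.src = x) (hf : f.src = x) (hne : e ≠ f) :
    IsNewPaths x (strictPath e ∪ strictPath f) := by
  have h1 := he ▸ isNewPaths_strictPath e
  have h2 := hf ▸ isNewPaths_strictPath f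
  -- the two paths lie in different branches at `x`
  have key : ∀ {e f : Edge T}, e.src = x → f.src = x → e ≠ f → ∀ a ∈ strictPath e,
      ∀ b : Edge T, b.src = a.tgt → b ∉ strictPath f := by
    intro e f he hf hne a ha b hb hbf
    exact hne (Edge.eq_of_le_of_le (he.trans hf.symm)
      (ha.1.trans (hb ▸ b.src_lt_tgt.le)) hbf.1)
  constructor
  · rintro a (ha | ha)
    exacts [h1.gt a ha, h2.gt a ha]
  · rintro a (ha | ha)
    · exact (h1.top a ha).imp_right fun ⟨g, hg, h⟩ => ⟨g, Or.inl hg, h⟩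
    · exact (h2.top a ha).imp_right fun ⟨g, hg, h⟩ => ⟨g, Or.inr hg, h⟩
  · rintro a (ha | ha) g hg
    · rw [← h1.next a ha g hg]
      exact or_iff_left (key he hf hne a ha g hg)
    · rw [← h2.next a ha g hg]
      exact or_iff_right (key hf he hne.symm a ha g hg)
  · refine (h1.finite_ends.union h2.finite_ends).subset ?_
    rintro v ⟨hb, a, ha | ha, rfl⟩
    exacts [Or.inl ⟨hb, a, ha, rfl⟩, Or.inr ⟨hb, a, ha, rfl⟩]

theorem filter_childEdges_strictPath {x : T} {e : Edge T} (he : e.src = x) :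
    (childEdges hT x).filter (· ∈ strictPath e) = {e} := by
  ext f
  simp only [Finset.mem_filter, mem_childEdges, Finset.mem_singleton]
  constructor
  · rintro ⟨h1, h2⟩
    exact (Edge.eq_of_le (he.trans h1.symm) h2.1).symm
  · rintro rfl
    exact ⟨he, mem_strictPath_self _⟩

theorem isExtension_one {ω : Edge T → ℕ} (hmono : ∀ ⦃e f : Edge T⦄, e.tgt ≤ f.tgt → ω f ≤ ω e)
    {x : T} (hx : InTree ω x) (hc : x = ⊥ ∨ ¬ IsClear ω x) {e : Edge T} (he : e.src = x)
    (h0 : ω e = 0) : IsExtension hT ω x (strictPath e) where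
  inTree := hx
  new := he ▸ isNewPaths_strictPath e
  zero f hf := Nat.le_zero.mp (h0 ▸ hmono hf.1)
  card := by
    rw [filter_childEdges_strictPath hT he, if_neg, Finset.card_singleton]
    rintro ⟨h1, h2⟩
    exact hc.elim h1 fun h => h h2

theorem isExtension_two {ω : Edge T → ℕ} (hmono : ∀ ⦃e f : Edge T⦄, e.tgt ≤ f.tgt → ω f ≤ ω e)
    {x : T} (hx : InTree ω x) (hx0 : x ≠ ⊥) (hc : IsClear ω x) {e f : Edge T} (he : e.src = x)
    (hf : f.src = x) (hne : e ≠ f) : IsExtension hT ω x (strictPath e ∪ strictPath f) where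
  inTree := hx
  new := IsNewPaths.union he hf hne
  zero g hg := hg.elim (fun h => Nat.le_zero.mp (hc e he ▸ hmono h.1))
    fun h => Nat.le_zero.mp (hc f hf ▸ hmono h.1)
  card := by
    rw [if_pos ⟨hx0, hc⟩]
    simp only [Set.mem_union, Finset.filter_or]
    rw [filter_childEdges_strictPath hT he, filter_childEdges_strictPath hT hf]
    exact Finset.card_pair hne

theorem sum_boole_of_lt {x v : T} (h : v < x) :
    ∑ c ∈ childEdges hT v, (if c.tgt ≤ x then 1 else 0) = 1 := by
  obtain ⟨c, hc, hcx⟩ := exists_child_le h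
  rw [Finset.sum_eq_single_of_mem c ((mem_childEdges hT).mpr hc), if_pos hcx]
  intro d hd hne
  exact if_neg fun hdx => hne (Edge.eq_of_le_of_le (((mem_childEdges hT).mp hd).trans hc.symm)
    hdx hcx)

section Reweight

variable {ω : Edge T → ℕ} {x : T} {S : Set (Edge T)}

theorem reweight_of_mem {e : Edge T} (h : e ∈ S) : reweight ω x S e = 1 := if_pos h

theorem reweight_of_le (hS : IsNewPaths x S) {e : Edge T} (h : e.tgt ≤ x) :
    reweight ω x S e = ω e + 1 := by
  rw [reweight, if_neg fun h' => (hS.gt e h').not_ge h, if_pos h]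

theorem reweight_of_not {e : Edge T} (h : e ∉ S) (h' : ¬ e.tgt ≤ x) :
    reweight ω x S e = ω e := by
  rw [reweight, if_neg h, if_neg h']

variable {hT}

theorem IsExtension.le_reweight (h : IsExtension hT ω x S) (e : Edge T) :
    ω e ≤ reweight ω x S e := by
  unfold reweight
  split_ifs with h1
  · simp [h.zero e h1]
  · exact Nat.le_succ _
  · exact le_rfl

theorem IsPartialWeighting.le_parent {n : ℕ} (h : IsPartialWeighting hT ω n) {e f : Edge T}
    (hf : f.src = e.tgt) : ω f ≤ ω e := by
  by_cases hc : IsClear ω e.tgt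
  · rw [hc f hf]; exact Nat.zero_le _
  · rw [h.conserve e hc]
    exact Finset.single_le_sum (fun g _ => Nat.zero_le _) ((mem_childEdges hT).mpr hf)

theorem IsPartialWeighting.antitone {n : ℕ} (h : IsPartialWeighting hT ω n) ⦃e f : Edge T⦄
    (hef : e.tgt ≤ f.tgt) : ω f ≤ ω e :=
  edge_antitone (w := ω) (fun _ _ => h.le_parent) hef

theorem IsPartialWeighting.ne_zero_of_le {n : ℕ} (h : IsPartialWeighting hT ω n) {v : T}
    (hv : InTree ω v) {e : Edge T} (he : e.tgt ≤ v) : ω e ≠ 0 := by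
  rcases hv with rfl | ⟨a, rfl, ha⟩
  · exact absurd (le_bot_iff.mp he) e.tgt_ne_bot
  · have := h.antitone he
    omega

theorem IsPartialWeighting.not_isClear_bot {n : ℕ} (h : IsPartialWeighting hT ω n) (hn : n ≠ 0) :
    ¬ IsClear ω (⊥ : T) := by
  intro hc
  refine hn ?_
  rw [← h.total]
  exact Finset.sum_eq_zero fun f hf => hc f ((mem_childEdges hT).mp hf)

theorem isPartialWeighting_zero : IsPartialWeighting hT (0 : Edge T → ℕ) 0 where
  total := by simp
  conserve e h := absurd (fun _ _ => rfl) h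
  clear e h := absurd rfl h
  finite_two := by simp
  finite_unsaturated := by
    refine (Set.finite_singleton (⊥ : T)).subset ?_
    rintro v ⟨rfl | ⟨e, -, he⟩, -⟩
    · rfl
    · exact absurd rfl he

/-- The properties of a partial weighting are preserved by a step of the weighting process. -/
theorem IsPartialWeighting.reweight {n : ℕ} (h : IsPartialWeighting hT ω n)
    (hS : IsExtension hT ω x S) : IsPartialWeighting hT (reweight ω x S) (n + 1) := by
  have hlt : ∀ {v : T}, v < x → ∀ c : Edge T, c.src = v → c ∉ S := fun {v} hv c hc hcS =>
    absurd hv (not_lt_of_ge (hc ▸ Edge.le_src_iff.mpr (hS.new.gt c hcS)))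
  have hsum_lt : ∀ {v : T}, v < x → ∑ c ∈ childEdges hT v, TreeFactorial.reweight ω x S c =
      ∑ c ∈ childEdges hT v, ω c + 1 := by
    intro v hv
    rw [← sum_boole_of_lt hT hv, ← Finset.sum_add_distrib]
    refine Finset.sum_congr rfl fun c hc => ?_
    have := hlt hv c ((mem_childEdges hT).mp hc)
    unfold TreeFactorial.reweight
    rw [if_neg this]
    split_ifs <;> rfl
  have hsum_eq : ∑ c ∈ childEdges hT x, TreeFactorial.reweight ω x S c =
      ∑ c ∈ childEdges hT x, ω c + ((childEdges hT x).filter (· ∈ S)).card := by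
    rw [Finset.card_filter, ← Finset.sum_add_distrib]
    refine Finset.sum_congr rfl fun c hc => ?_
    have hcx : ¬ c.tgt ≤ x := ((mem_childEdges hT).mp hc ▸ c.src_lt_tgt).not_ge
    by_cases hcS : c ∈ S
    · simp [reweight_of_mem hcS, hS.zero c hcS, hcS]
    · simp [reweight_of_not hcS hcx, hcS]
  have hother : ∀ {e : Edge T}, e ∉ S → ¬ e.tgt ≤ x → ∀ c : Edge T, c.src = e.tgt →
      TreeFactorial.reweight ω x S c = ω c := by
    intro e he hex c hc
    have hcS : c ∉ S := fun hcS => (hS.new.top c hcS).elim (fun h' => hex (hc ▸ h').le)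
      fun ⟨g, hg, hgc⟩ => he (Edge.ext_tgt (hgc.trans hc) ▸ hg)
    exact reweight_of_not hcS fun h' => hex ((hc ▸ c.src_lt_tgt).le.trans h')
  have hnext : ∀ {e : Edge T}, e ∈ S → ∀ c : Edge T, c.src = e.tgt →
      TreeFactorial.reweight ω x S c = if IsBranching e.tgt then 0 else 1 := by
    intro e he c hc
    by_cases hb : IsBranching e.tgt
    · rw [if_pos hb, reweight_of_not (fun h' => (hS.new.next e he c hc).mp h' hb)]
      · exact Nat.le_zero.mp (hS.zero e he ▸ h.le_parent hc)
      · exact fun h' => (hS.new.gt e he).not_ge ((hc ▸ c.src_lt_tgt).le.trans h')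
    · rw [if_neg hb, reweight_of_mem ((hS.new.next e he c hc).mpr hb)]
  have hnonclear : ∀ e : Edge T, e.tgt ≤ x → ¬ IsClear (TreeFactorial.reweight ω x S) e.tgt := by
    intro e hex hc
    rcases hex.eq_or_lt with h' | h'
    · have hpos : 0 < ((childEdges hT x).filter (· ∈ S)).card := by
        rw [hS.card]; split_ifs <;> norm_num
      obtain ⟨c, hcm⟩ := Finset.card_pos.mp hpos
      rw [Finset.mem_filter, mem_childEdges] at hcm
      have := hc c (hcm.1.trans h'.symm)
      rw [reweight_of_mem hcm.2] at this
      exact one_ne_zero this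
    · obtain ⟨c, hce, hcx⟩ := exists_child_le h'
      have := hc c hce
      rw [reweight_of_le hS.new hcx] at this
      omega
  refine ⟨?_, ?_, ?_, ?_, ?_⟩
  · rcases eq_or_ne x ⊥ with hx | hx
    · have h1 := hS.card
      rw [if_neg fun h' => h'.1 hx] at h1
      rw [← h.total, ← hx, hsum_eq, h1]
    · rw [hsum_lt (bot_lt_iff_ne_bot.mpr hx), h.total]
  · intro e hc
    by_cases heS : e ∈ S
    · have hb : ¬ IsBranching e.tgt := fun hb => hc fun c hce => by rw [hnext heS c hce, if_pos hb]
      unfold IsClear at hc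
      push Not at hc
      obtain ⟨c, hce, -⟩ := hc
      rw [childEdges_eq_singleton hT hb hce, Finset.sum_singleton, hnext heS c hce, if_neg hb,
        reweight_of_mem heS]
    by_cases hex : e.tgt ≤ x
    · rw [reweight_of_le hS.new hex]
      rcases hex.eq_or_lt with h' | h'
      · rw [h', hsum_eq, hS.card]
        by_cases hcl : IsClear ω x
        · rw [if_pos ⟨h' ▸ e.tgt_ne_bot, hcl⟩,
            (h.clear e (h.ne_zero_of_le hS.inTree hex) (h' ▸ hcl)).1,
            Finset.sum_eq_zero fun f hf => hcl f ((mem_childEdges hT).mp hf)]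
        · rw [if_neg fun h' => hcl h'.2, h.conserve e (h' ▸ hcl), h']
      · rw [hsum_lt h', h.conserve e]
        obtain ⟨c, hce, hcx⟩ := exists_child_le h'
        exact fun hcl => h.ne_zero_of_le hS.inTree hcx (hcl c hce)
    · rw [reweight_of_not heS hex, Finset.sum_congr rfl fun c hce =>
        hother heS hex c ((mem_childEdges hT).mp hce)]
      exact h.conserve e fun hcl => hc fun c hce => (hother heS hex c hce).trans (hcl c hce)
  · intro e he hc
    by_cases heS : e ∈ S
    · refine ⟨reweight_of_mem heS, ?_⟩
      by_contra! hcon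
      obtain ⟨c, hce⟩ := exists_child_of_not_isLeaf hcon.1
      have := hc c hce
      rw [hnext heS c hce, if_neg hcon.2] at this
      exact one_ne_zero this
    by_cases hex : e.tgt ≤ x
    · exact absurd hc (hnonclear e hex)
    · rw [reweight_of_not heS hex] at he ⊢
      exact h.clear e he fun c hce => (hother heS hex c hce).symm.trans (hc c hce)
  · refine (h.finite_two.union (finite_edges_le x)).subset fun e he => ?_
    by_cases hex : e.tgt ≤ x
    · exact Or.inr hex
    · have h2 : 2 ≤ TreeFactorial.reweight ω x S e := he
      have heS : e ∉ S := fun heS => by rw [reweight_of_mem heS] at h2; omega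
      rw [reweight_of_not heS hex] at h2
      exact Or.inl h2
  · refine (h.finite_unsaturated.union hS.new.finite_ends).subset ?_
    rintro v ⟨hv, c, hcv, hc⟩
    have hc' : ω c = 0 := Nat.le_zero.mp (hc ▸ hS.le_reweight c)
    rcases hv with hv | ⟨e, rfl, he⟩
    · exact Or.inl ⟨Or.inl hv, c, hcv, hc'⟩
    by_cases heS : e ∈ S
    · refine Or.inr ⟨?_, e, heS, rfl⟩
      by_contra hb
      rw [hnext heS c hcv, if_neg hb] at hc
      exact one_ne_zero hc
    · refine Or.inl ⟨Or.inr ⟨e, rfl, ?_⟩, c, hcv, hc'⟩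
      by_cases hex : e.tgt ≤ x
      · exact h.ne_zero_of_le hS.inTree hex
      · rwa [reweight_of_not heS hex] at he

end Reweight

/-- A step of the weighting process is given by an admissible set of new edges. -/
theorem IsWeightingStep.exists_isExtension {ℓ : Edge T → ℝ} {ω ω' : Edge T → ℕ} {x : T} {n : ℕ}
    (h : IsPartialWeighting hT ω n) (hn : n ≠ 0) (hs : IsWeightingStep ℓ ω x ω') :
    ∃ S, IsExtension hT ω x S ∧ ω' = reweight ω x S := by
  obtain ⟨hu, -, ⟨hc, e, he, h0, rfl⟩ | ⟨hc, e, f, he, hf, hne, rfl⟩⟩ := hs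
  · exact ⟨_, isExtension_one hT h.antitone hu.1 (Or.inr hc) he h0, rfl⟩
  · exact ⟨_, isExtension_two hT h.antitone hu.1
      (fun h0 => h.not_isClear_bot hn (h0 ▸ hc)) hc he hf hne, rfl⟩

theorem IsWeightingSequence.isPartialWeighting {ℓ : Edge T → ℝ} {ω : ℕ → Edge T → ℕ} {x : ℕ → T}
    (h : IsWeightingSequence ℓ ω x) (n : ℕ) : IsPartialWeighting hT (ω n) n ∧
      ∃ S, IsExtension hT (ω n) (x n) S ∧ ω (n + 1) = reweight (ω n) (x n) S := by
  have hstep : ∀ n, IsPartialWeighting hT (ω n) n →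
      ∃ S, IsExtension hT (ω n) (x n) S ∧ ω (n + 1) = reweight (ω n) (x n) S := by
    intro n hn
    rcases Nat.eq_zero_or_pos n with rfl | hpos
    · obtain ⟨e, he, h1⟩ := h.first
      rw [h.first_vertex]
      exact ⟨_, isExtension_one hT hn.antitone (Or.inl rfl) (Or.inl rfl) he (by simp [h.zero]), h1⟩
    · exact (h.step n hpos).exists_isExtension hT hn hpos.ne'
  have hall : IsPartialWeighting hT (ω n) n := by
    induction n with
    | zero => rw [h.zero]; exact isPartialWeighting_zero
    | succ n ih =>
      obtain ⟨S, hS, h1⟩ := hstep n ih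
      rw [h1]
      exact ih.reweight hS
  exact ⟨hall, hstep n hall⟩

end TreeFactorial

namespace TreeFactorial
variable {T : RootedTree}
open scoped Classical

variable {hT : IsLocallyFinite T} {ℓ : Edge T → ℝ}

/-! ### Weighted lengths and the energy of a weighting -/

theorem finsum_ite_le_eq_pot (g : Edge T → ℝ) (v : T) :
    ∑ᶠ e : Edge T, (if e.tgt ≤ v then g e else 0) = pot g v := by
  rw [finsum_eq_sum_of_support_subset (s := pathEdges v)]
  · exact Finset.sum_congr rfl fun e he => if_pos (mem_pathEdges.mp he)
  · intro e he
    by_contra h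
    exact he (if_neg fun h' => h (by simpa using h'))

/-- The energy of an integral flow `ω` in which every unit of flow interacts with all the others,
but not with itself. -/
noncomputable def pairEnergy (ℓ : Edge T → ℝ) (ω : Edge T → ℕ) : ℝ :=
  ∑ᶠ e, ((ω e).choose 2 : ℝ) * ℓ e

theorem finite_support_pairEnergy {ω : Edge T → ℕ} (h : {e | 2 ≤ ω e}.Finite) :
    (Function.support fun e => ((ω e).choose 2 : ℝ) * ℓ e).Finite := by
  refine h.subset fun e he => ?_
  by_contra hlt
  have : ω e < 2 := not_le.mp hlt
  exact he (by simp [Nat.choose_eq_zero_of_lt this])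

theorem pairEnergy_nonneg (hℓ : ∀ e, 0 < ℓ e) (ω : Edge T → ℕ) : 0 ≤ pairEnergy ℓ ω :=
  finsum_nonneg fun e => mul_nonneg (Nat.cast_nonneg _) (hℓ e).le

theorem pairEnergy_zero : pairEnergy ℓ (0 : Edge T → ℕ) = 0 := by
  simp [pairEnergy]

/-- The increase of the energy when a unit of flow is added along the path to `v`. -/
theorem pairEnergy_add {ω ω' : Edge T → ℕ} {v : T} (h : {e | 2 ≤ ω e}.Finite)
    (h' : ∀ e, (ω' e).choose 2 = (ω e).choose 2 + if e.tgt ≤ v then ω e else 0) :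
    pairEnergy ℓ ω' = pairEnergy ℓ ω + pot (fun e => (ω e : ℝ) * ℓ e) v := by
  rw [pairEnergy, pairEnergy, ← finsum_ite_le_eq_pot, ← finsum_add_distrib]
  · refine finsum_congr fun e => ?_
    rw [h' e]
    split_ifs <;> push_cast <;> ring
  · exact finite_support_pairEnergy h
  · refine (finite_edges_le v).subset fun e he => ?_
    by_contra h
    exact he (if_neg h)

theorem choose_two_succ (k : ℕ) : (k + 1).choose 2 = k.choose 2 + k := by
  rw [Nat.choose_succ_succ' k 1, Nat.choose_one_right, add_comm]

theorem IsExtension.pairEnergy_reweight {ω : Edge T → ℕ} {n : ℕ} (h : IsPartialWeighting hT ω n)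
    {x : T} {S : Set (Edge T)} (hS : IsExtension hT ω x S) :
    pairEnergy ℓ (reweight ω x S) = pairEnergy ℓ ω + weightedLength ℓ ω x := by
  rw [weightedLength_eq_pot]
  refine pairEnergy_add h.finite_two fun e => ?_
  by_cases h1 : e ∈ S
  · rw [reweight_of_mem h1, if_neg (hS.new.gt e h1).not_ge, hS.zero e h1]
    rfl
  by_cases h2 : e.tgt ≤ x
  · rw [reweight_of_le hS.new h2, if_pos h2, choose_two_succ]
  · rw [reweight_of_not h1 h2, if_neg h2, add_zero]

theorem weightedLength_mono (hℓ : ∀ e, 0 < ℓ e) {ω ω' : Edge T → ℕ} (h : ∀ e, ω e ≤ ω' e)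
    (v : T) : weightedLength ℓ ω v ≤ weightedLength ℓ ω' v := by
  rw [weightedLength_eq_pot, weightedLength_eq_pot]
  exact Finset.sum_le_sum fun e _ =>
    mul_le_mul_of_nonneg_right (Nat.cast_le.mpr (h e)) (hℓ e).le

theorem weightedLength_mono_right (hℓ : ∀ e, 0 < ℓ e) (ω : Edge T → ℕ) {u v : T} (h : u ≤ v) :
    weightedLength ℓ ω u ≤ weightedLength ℓ ω v := by
  rw [weightedLength_eq_pot, weightedLength_eq_pot]
  exact pot_mono (fun e => mul_nonneg (Nat.cast_nonneg _) (hℓ e).le) h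

theorem weightedLength_bot (ω : Edge T → ℕ) : weightedLength ℓ ω ⊥ = 0 := by
  rw [weightedLength_eq_pot, pot_bot]

theorem weightedLength_tgt (ω : Edge T → ℕ) (e : Edge T) :
    weightedLength ℓ ω e.tgt = weightedLength ℓ ω e.src + ω e * ℓ e := by
  rw [weightedLength_eq_pot, weightedLength_eq_pot, pot_tgt]

theorem weightedLength_nonneg (hℓ : ∀ e, 0 < ℓ e) (ω : Edge T → ℕ) (v : T) :
    0 ≤ weightedLength ℓ ω v :=
  (weightedLength_bot ω).symm.le.trans (weightedLength_mono_right hℓ ω bot_le)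

theorem IsExtension.isUnsaturated_of_reweight {ω : Edge T → ℕ} {n : ℕ}
    (h : IsPartialWeighting hT ω n) {x : T} {S : Set (Edge T)} (hS : IsExtension hT ω x S) {v : T}
    (hv : IsUnsaturated (reweight ω x S) v) : IsUnsaturated ω v ∨ x < v := by
  obtain ⟨hv, c, hcv, hc⟩ := hv
  have hc' : ω c = 0 := Nat.le_zero.mp (hc ▸ hS.le_reweight c)
  rcases hv with hv | ⟨e, rfl, he⟩
  · exact Or.inl ⟨Or.inl hv, c, hcv, hc'⟩
  by_cases heS : e ∈ S
  · exact Or.inr (hS.new.gt e heS)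
  · refine Or.inl ⟨Or.inr ⟨e, rfl, ?_⟩, c, hcv, hc'⟩
    by_cases hex : e.tgt ≤ x
    · exact h.ne_zero_of_le hS.inTree hex
    · rwa [reweight_of_not heS hex] at he

namespace IsWeightingSequence

variable {ω : ℕ → Edge T → ℕ} {x : ℕ → T} (h : IsWeightingSequence ℓ ω x)

include h

theorem weightedLength_zero : weightedLength ℓ (ω 0) (x 0) = 0 := by
  rw [h.first_vertex, weightedLength_bot]

theorem weightedLength_le (hℓ : ∀ e, 0 < ℓ e) {n : ℕ} {v : T} (hv : IsUnsaturated (ω n) v) :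
    weightedLength ℓ (ω n) (x n) ≤ weightedLength ℓ (ω n) v := by
  rcases Nat.eq_zero_or_pos n with rfl | hn
  · rw [h.weightedLength_zero]; exact weightedLength_nonneg hℓ _ _
  · exact (h.step n hn).2.1 v hv

include hT

theorem le_succ (n : ℕ) (e : Edge T) : ω n e ≤ ω (n + 1) e := by
  obtain ⟨S, hS, h1⟩ := (h.isPartialWeighting hT n).2
  rw [h1]; exact hS.le_reweight e

theorem monotone_weight (e : Edge T) : Monotone fun n => ω n e :=
  monotone_nat_of_le_succ fun n => h.le_succ (hT := hT) n e

theorem pairEnergy_eq (n : ℕ) :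
    pairEnergy ℓ (ω n) = ∑ j ∈ Finset.range n, weightedLength ℓ (ω j) (x j) := by
  induction n with
  | zero => rw [h.zero, pairEnergy_zero, Finset.sum_range_zero]
  | succ n ih =>
    obtain ⟨h0, S, hS, h1⟩ := h.isPartialWeighting hT n
    rw [h1, hS.pairEnergy_reweight h0, Finset.sum_range_succ, ih]

theorem monotone_weightedLength (hℓ : ∀ e, 0 < ℓ e) :
    Monotone fun n => weightedLength ℓ (ω n) (x n) := by
  refine monotone_nat_of_le_succ fun n => ?_
  obtain ⟨h0, S, hS, h1⟩ := h.isPartialWeighting hT n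
  have h2 : ∀ v, weightedLength ℓ (ω n) v ≤ weightedLength ℓ (ω (n + 1)) v :=
    weightedLength_mono hℓ (h.le_succ (hT := hT) n)
  have h3 := (h.step (n + 1) (Nat.le_add_left 1 n)).1
  rw [h1] at h3
  rcases hS.isUnsaturated_of_reweight h0 h3 with h4 | h4
  · exact (h.weightedLength_le hℓ h4).trans (h2 _)
  · exact (h2 _).trans (weightedLength_mono_right hℓ _ h4.le)

end IsWeightingSequence

/-! ### Exits of the multiply weighted subtree -/

namespace IsPartialWeighting

variable {ω : Edge T → ℕ} {n : ℕ} (h : IsPartialWeighting hT ω n)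

include h

/-- The edges of weight at least two. -/
noncomputable def core : Finset (Edge T) := h.finite_two.toFinset

theorem mem_core {e : Edge T} : e ∈ h.core ↔ 2 ≤ ω e := by
  simp [core]

theorem isLowerEdges_core : IsLowerEdges h.core := fun _ _ hef hf =>
  h.mem_core.mpr ((h.mem_core.mp hf).trans (h.antitone hef))

theorem conserve_core : ∀ e ∈ h.core, (ω e : ℝ) = ∑ f ∈ childEdges hT e.tgt, (ω f : ℝ) := by
  intro e he
  have h2 := h.mem_core.mp he
  rw [h.conserve e fun hc => ?_, Nat.cast_sum]
  have := (h.clear e (by omega) hc).1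
  omega

theorem sum_exitEdges_core : ∑ f ∈ exitEdges hT h.core, (ω f : ℝ) = n := by
  rw [sum_exitEdges_one hT h.isLowerEdges_core h.conserve_core, ← Nat.cast_sum, h.total]

theorem le_one_of_mem_exitEdges {f : Edge T} (hf : f ∈ exitEdges hT h.core) : ω f ≤ 1 := by
  have := ((mem_exitEdges hT).mp hf).2
  rw [h.mem_core] at this
  omega

theorem inTree_src_of_mem_exitEdges {f : Edge T} (hf : f ∈ exitEdges hT h.core) :
    InTree ω f.src :=
  ((mem_exitEdges hT).mp hf).1.imp_right fun ⟨e, he, h'⟩ =>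
    ⟨e, h', by have := h.mem_core.mp he; omega⟩

theorem eq_on_strictPath {f e : Edge T} (hf : ω f ≠ 0) (he : e ∈ strictPath f) : ω e = ω f := by
  suffices H : ∀ v : T, ∀ e : Edge T, e.tgt = v → e ∈ strictPath f → ω e = ω f from H _ e rfl he
  intro v
  induction v using tree_induction with
  | bot => exact fun e he => absurd he e.tgt_ne_bot
  | step g ih =>
    intro e hg he
    obtain rfl := Edge.ext_tgt hg
    rcases he.1.eq_or_lt with h' | h'
    · rw [Edge.ext_tgt h']
    · have h1 := Edge.le_src_iff.mpr h'
      have h2 : e.src ≠ ⊥ := fun h0 => f.tgt_ne_bot (le_bot_iff.mp (h0 ▸ h1))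
      obtain ⟨p, hp⟩ := exists_edge_tgt h2
      have hb : ¬ IsBranching p.tgt := hp ▸ he.2 _ h1 e.src_lt_tgt
      have hps : p ∈ strictPath f :=
        mem_strictPath_of_le he (hp ▸ h1) (hp ▸ e.src_lt_tgt.le)
      have hpe := ih p hp hps
      rw [← hpe, h.conserve p, childEdges_eq_singleton hT hb hp.symm, Finset.sum_singleton]
      exact fun hc => ((h.clear p (hpe ▸ hf) hc).2).elim (fun hl => hl e hp.symm) hb

theorem isUnsaturated_of_branching {g : Edge T} (hg : ω g = 1) (hb : IsBranching g.tgt) :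
    IsUnsaturated ω g.tgt := by
  refine ⟨Or.inr ⟨g, rfl, by omega⟩, ?_⟩
  by_contra! hcon
  obtain ⟨a, b, ha, hb, hne⟩ := hb
  have h1 := h.conserve g fun hc => hcon a ha (hc a ha)
  have h2 : ∑ c ∈ ({a, b} : Finset (Edge T)), ω c ≤ ∑ c ∈ childEdges hT g.tgt, ω c :=
    Finset.sum_le_sum_of_subset fun c hc => by
      rcases Finset.mem_insert.mp hc with rfl | hc
      · simpa using ha
      · rw [Finset.mem_singleton.mp hc]; simpa using hb
  rw [Finset.sum_pair hne] at h2
  have := hcon a ha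
  have := hcon b hb
  omega

/-- Past an exit `f` there is an unsaturated vertex: the source of `f` if `f` is unweighted, and
the end of the strict path starting with `f` otherwise. -/
theorem exists_isUnsaturated {f g : Edge T} (hf : f ∈ exitEdges hT h.core) (hg : g ∈ strictPath f)
    (hb : IsBranching g.tgt) :
    (ω f = 0 ∧ IsUnsaturated ω f.src) ∨
    (ω f = 1 ∧ IsUnsaturated ω g.tgt ∧ ∀ e : Edge T, f.tgt ≤ e.tgt → e.tgt ≤ g.tgt → ω e = 1) := by
  rcases Nat.le_one_iff_eq_zero_or_eq_one.mp (h.le_one_of_mem_exitEdges hf) with h0 | h1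
  · exact Or.inl ⟨h0, h.inTree_src_of_mem_exitEdges hf, f, rfl, h0⟩
  · have hone : ∀ e ∈ strictPath f, ω e = 1 := fun e he => by
      rw [h.eq_on_strictPath (by omega) he, h1]
    exact Or.inr ⟨h1, h.isUnsaturated_of_branching (hone g hg) hb, fun e h2 h3 =>
      hone e (mem_strictPath_of_le hg h2 h3)⟩

include ℓ in
theorem exists_isUnsaturated_of_flow (hwc : IsWeaklyComplete ℓ) {θ : Edge T → ℝ}
    (hθ : IsBoundedUnitFlow ℓ θ) : ∃ v, IsUnsaturated ω v := by
  have h1 := (sum_exitEdges_one hT h.isLowerEdges_core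
    fun e _ => hθ.1.conserve_sum hT e).trans (hθ.1.total_sum hT)
  obtain ⟨f, hf, hpos⟩ := Finset.exists_lt_of_sum_lt
    (s := exitEdges hT h.core) (f := fun _ => (0 : ℝ)) (g := θ) (by rw [h1]; simp)
  obtain ⟨g, hg, hb⟩ := exists_branching_of_pos hT hwc hθ hpos
  rcases h.exists_isUnsaturated hf hg hb with h' | h'
  exacts [⟨_, h'.2⟩, ⟨_, h'.2.1⟩]

end IsPartialWeighting

/-! ### Existence of weighting sequences -/

/-- Weighting sequences with prescribed invariants are constructed step by step. -/
theorem exists_isWeightingSequence_of_step (I : ℕ → (Edge T → ℕ) → Prop)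
    (Q : ℕ → (Edge T → ℕ) → T → Prop)
    (hfirst : ∃ e : Edge T, e.src = ⊥ ∧ I 1 (reweight 0 ⊥ (strictPath e)))
    (hstep : ∀ n, 1 ≤ n → ∀ ω, I n ω → ∃ x ω', IsWeightingStep ℓ ω x ω' ∧ I (n + 1) ω' ∧ Q n ω x) :
    ∃ ω x, IsWeightingSequence ℓ ω x ∧ ∀ n, 1 ≤ n → I n (ω n) ∧ Q n (ω n) (x n) := by
  obtain ⟨e, he, hI⟩ := hfirst
  have hstep' : ∀ n (ω : {ω // I (n + 1) ω}), ∃ p : T × {ω // I (n + 2) ω},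
      IsWeightingStep ℓ ω.1 p.1 p.2.1 ∧ Q (n + 1) ω.1 p.1 := by
    rintro n ⟨ω, hω⟩
    obtain ⟨x, ω', h1, h2, h3⟩ := hstep (n + 1) (Nat.le_add_left 1 n) ω hω
    exact ⟨(x, ⟨ω', h2⟩), h1, h3⟩
  choose next hnext using hstep'
  let s : ∀ n, {ω // I (n + 1) ω} := fun n => Nat.rec ⟨_, hI⟩ (fun n ω => (next n ω).2) n
  refine ⟨fun n => Nat.casesOn n 0 fun n => (s n).1,
    fun n => Nat.casesOn n ⊥ fun n => (next n (s n)).1, ⟨rfl, rfl, ⟨e, he, rfl⟩, ?_⟩, ?_⟩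
  · rintro (_ | n) hn
    · omega
    · exact (hnext n (s n)).1
  · rintro (_ | n) hn
    · omega
    · exact ⟨(s n).2, (hnext n (s n)).2⟩

include hT in
theorem exists_isWeightingSequence (hwc : IsWeaklyComplete ℓ) {θ : Edge T → ℝ}
    (hθ : IsBoundedUnitFlow ℓ θ) : ∃ ω x, IsWeightingSequence ℓ ω x := by
  refine (exists_isWeightingSequence_of_step (ℓ := ℓ) (fun n ω => IsPartialWeighting hT ω n)
    (fun _ _ _ => True) ?_ ?_).imp fun ω h => h.imp fun x h => h.1
  · obtain ⟨e, he, -⟩ := Finset.exists_ne_zero_of_sum_ne_zero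
      ((hθ.1.total_sum hT).trans_ne one_ne_zero)
    rw [mem_childEdges] at he
    have h0 : IsPartialWeighting hT (0 : Edge T → ℕ) 0 := isPartialWeighting_zero
    exact ⟨e, he, h0.reweight (isExtension_one hT h0.antitone (Or.inl rfl) (Or.inl rfl) he rfl)⟩
  · intro n hn ω hω
    obtain ⟨x, hx, hmin⟩ := Set.exists_min_image _ (weightedLength ℓ ω) hω.finite_unsaturated
      (hω.exists_isUnsaturated_of_flow hwc hθ)
    have hstep : ∃ ω', IsWeightingStep ℓ ω x ω' := by
      by_cases hc : IsClear ω x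
      · rcases hx.1 with rfl | ⟨a, rfl, ha⟩
        · exact absurd hc (hω.not_isClear_bot (by omega))
        · obtain ⟨e, he, -⟩ := hx.2
          obtain ⟨e, f, he, hf, hne⟩ := (hω.clear a ha hc).2.resolve_left fun hl => hl e he
          exact ⟨_, hx, hmin, Or.inr ⟨hc, e, f, he, hf, hne, rfl⟩⟩
      · obtain ⟨e, he, h0⟩ := hx.2
        exact ⟨_, hx, hmin, Or.inl ⟨hc, e, he, h0, rfl⟩⟩
    obtain ⟨ω', hω'⟩ := hstep
    obtain ⟨S, hS, rfl⟩ := hω'.exists_isExtension hT hω (by omega)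
    exact ⟨x, _, hω', hω.reweight hS, trivial⟩

end TreeFactorial

namespace TreeFactorial
variable {T : RootedTree}
open scoped Classical

variable {hT : IsLocallyFinite T} {ℓ : Edge T → ℝ}

/-! ### Optimality of the weighting process -/

/-- An integral flow of total amount `n`, which is only required to be conserved where its amount is
at least two. -/
structure IsIntegralFlow (hT : IsLocallyFinite T) (w : Edge T → ℕ) (n : ℕ) : Prop where
  total : ∑ f ∈ childEdges hT ⊥, w f = n
  conserve : ∀ e : Edge T, 2 ≤ w e → w e = ∑ f ∈ childEdges hT e.tgt, w f
  finite_two : {e | 2 ≤ w e}.Finite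

theorem IsPartialWeighting.isIntegralFlow {ω : Edge T → ℕ} {n : ℕ}
    (h : IsPartialWeighting hT ω n) : IsIntegralFlow hT ω n where
  total := h.total
  conserve e he := h.conserve e fun hc => by
    have := (h.clear e (by omega) hc).1
    omega
  finite_two := h.finite_two

/-- A unit of an integral flow can be removed along a path ending in an edge of amount one. -/
theorem IsIntegralFlow.remove {w : Edge T → ℕ} {n : ℕ} (h : IsIntegralFlow hT w (n + 1))
    {t : Edge T} (ht : w t = 1) (hlt : ∀ e : Edge T, e.tgt < t.tgt → 2 ≤ w e) :
    ∃ w', IsIntegralFlow hT w' n ∧ (∀ e, w e = w' e + if e.tgt ≤ t.tgt then 1 else 0) ∧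
      pairEnergy ℓ w = pairEnergy ℓ w' + pot (fun e => (w' e : ℝ) * ℓ e) t.tgt := by
  set w' : Edge T → ℕ := fun e => if e.tgt ≤ t.tgt then w e - 1 else w e with hw'
  have hadd : ∀ e, w e = w' e + if e.tgt ≤ t.tgt then 1 else 0 := by
    intro e
    simp only [hw']
    split_ifs with h1
    · rcases h1.eq_or_lt with h2 | h2
      · rw [Edge.ext_tgt h2, ht]
      · have := hlt e h2
        omega
    · rfl
  have hfin : {e | 2 ≤ w' e}.Finite := h.finite_two.subset fun e he => by
    have h1 := hadd e
    have h2 : 2 ≤ w' e := he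
    show 2 ≤ w e
    omega
  refine ⟨w', ⟨?_, ?_, hfin⟩, hadd, pairEnergy_add hfin fun e => ?_⟩
  · have h1 := h.total
    rw [Finset.sum_congr rfl fun e _ => hadd e, Finset.sum_add_distrib,
      sum_boole_of_lt hT (bot_lt_iff_ne_bot.mpr t.tgt_ne_bot)] at h1
    omega
  · intro e he
    have h1 := hadd e
    have h2 := h.conserve e (by omega)
    rw [Finset.sum_congr rfl fun e _ => hadd e, Finset.sum_add_distrib] at h2
    by_cases h3 : e.tgt ≤ t.tgt
    · rcases h3.eq_or_lt with h4 | h4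
      · rw [Edge.ext_tgt h4, ht, if_pos le_rfl] at h1
        rw [Edge.ext_tgt h4] at he
        omega
      · rw [sum_boole_of_lt hT h4] at h2
        rw [if_pos h3] at h1
        omega
    · rw [if_neg h3] at h1
      rw [Finset.sum_eq_zero fun f hf => if_neg fun hft => h3 ?_] at h2
      · omega
      · rw [mem_childEdges] at hf
        exact (hf ▸ f.src_lt_tgt).le.trans hft
  · rw [hadd e]
    split_ifs
    · exact choose_two_succ _
    · rfl

/-- The weighting process minimizes the energy: the sum of the first `n` factorials is at most the
energy of any integral flow of amount `n`. An integral flow of larger total amount than the current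
weighting exceeds the weighting along a path to an unsaturated vertex, and removing a unit along this
path gains at least the current factorial. -/
theorem IsWeightingSequence.sum_le_pairEnergy (hT : IsLocallyFinite T) (hℓ : ∀ e, 0 < ℓ e)
    {ω : ℕ → Edge T → ℕ} {x : ℕ → T} (hω : IsWeightingSequence ℓ ω x) (n : ℕ) :
    ∀ {w : Edge T → ℕ}, IsIntegralFlow hT w n →
      ∑ j ∈ Finset.range n, weightedLength ℓ (ω j) (x j) ≤ pairEnergy ℓ w := by
  induction n with
  | zero => intro w _; simpa using pairEnergy_nonneg hℓ w
  | succ n ih =>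
    intro w hw
    rcases Nat.eq_zero_or_pos n with rfl | hn
    · simpa [hω.weightedLength_zero] using pairEnergy_nonneg hℓ w
    have hp := (hω.isPartialWeighting hT n).1
    have htgt : ({⊥} ∪ Edge.tgt '' {e | 2 ≤ w e}).Finite :=
      (Set.finite_singleton _).union (hw.finite_two.image _)
    have hsub : ∀ P : Edge T → Prop, (∀ e, P e → 2 ≤ w e) → ∀ v, (∀ e : Edge T, e.tgt ≤ v → P e) →
        v ∈ ({⊥} ∪ Edge.tgt '' {e | 2 ≤ w e} : Set T) := by
      intro P hP v hv
      by_cases h0 : v = ⊥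
      · exact Or.inl h0
      · obtain ⟨e, rfl⟩ := exists_edge_tgt h0
        exact Or.inr ⟨e, hP e (hv e le_rfl), rfl⟩
    have hext : ∀ (P : Edge T → Prop) (e : Edge T), (∀ f : Edge T, f.tgt ≤ e.src → P f) → P e →
        ∀ f : Edge T, f.tgt ≤ e.tgt → P f := by
      intro P e h1 h2 f hf
      rcases hf.eq_or_lt with h' | h'
      · rwa [Edge.ext_tgt h']
      · exact h1 f (Edge.le_src_iff.mpr h')
    -- a maximal vertex up to which `w` exceeds the weighting
    set P : Edge T → Prop := fun e => 2 ≤ w e ∧ ω n e < w e ∧ ω n e ≠ 0 with hP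
    obtain ⟨v, hv, hvmax⟩ := (htgt.subset fun v hv => hsub P (fun e he => he.1) v hv).exists_maximal
      (s := {v | ∀ e : Edge T, e.tgt ≤ v → P e})
      ⟨⊥, fun e he => absurd (le_bot_iff.mp he) e.tgt_ne_bot⟩
    have hunsat : IsUnsaturated (ω n) v := by
      have hin : InTree (ω n) v := by
        by_cases h0 : v = ⊥
        · exact Or.inl h0
        · obtain ⟨e, rfl⟩ := exists_edge_tgt h0
          exact Or.inr ⟨e, rfl, (hv e le_rfl).2.2⟩
      by_contra hcon
      have hsat : ∀ f : Edge T, f.src = v → ω n f ≠ 0 := fun f hf h0 => hcon ⟨hin, f, hf, h0⟩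
      have hlt : ∑ f ∈ childEdges hT v, ω n f < ∑ f ∈ childEdges hT v, w f := by
        by_cases h0 : v = ⊥
        · rw [h0, hp.total, hw.total]; omega
        · obtain ⟨e, rfl⟩ := exists_edge_tgt h0
          have he := hv e le_rfl
          rw [← hw.conserve e he.1]
          by_cases hc : IsClear (ω n) e.tgt
          · rw [Finset.sum_eq_zero fun f hf => hc f ((mem_childEdges hT).mp hf)]
            omega
          · rw [← hp.conserve e hc]; exact he.2.1
      obtain ⟨f, hf, hlt⟩ := Finset.exists_lt_of_sum_lt hlt
      rw [mem_childEdges] at hf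
      have h0 := hsat f hf
      have := hvmax (y := f.tgt) (hext P f (hf ▸ hv) ⟨by omega, hlt, h0⟩) (hf ▸ f.src_lt_tgt.le)
      exact absurd (hf ▸ f.src_lt_tgt) this.not_gt
    -- the path is continued to the first edge at which the amount of `w` is one
    obtain ⟨u, hu, humax⟩ := (htgt.subset fun v hv => hsub (fun e => 2 ≤ w e) (fun _ he => he) v
      hv.2).exists_maximal (s := {u | v ≤ u ∧ ∀ e : Edge T, e.tgt ≤ u → 2 ≤ w e})
      ⟨v, le_rfl, fun e he => (hv e he).1⟩
    have hsum : ∑ f ∈ childEdges hT u, w f ≠ 0 := by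
      by_cases h0 : u = ⊥
      · rw [h0, hw.total]; omega
      · obtain ⟨e, rfl⟩ := exists_edge_tgt h0
        have := hu.2 e le_rfl
        rw [← hw.conserve e this]; omega
    obtain ⟨t, ht, ht0⟩ := Finset.exists_ne_zero_of_sum_ne_zero hsum
    rw [mem_childEdges] at ht
    have ht1 : w t = 1 := by
      by_contra h1
      have := humax (y := t.tgt) ⟨hu.1.trans (ht ▸ t.src_lt_tgt.le),
        hext (fun e => 2 ≤ w e) t (ht ▸ hu.2) (show 2 ≤ w t by omega)⟩ (ht ▸ t.src_lt_tgt.le)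
      exact absurd (ht ▸ t.src_lt_tgt) this.not_gt
    obtain ⟨w', hw', hadd, hen⟩ := hw.remove (ℓ := ℓ) ht1
      fun e he => hu.2 e (ht ▸ Edge.le_src_iff.mpr he)
    rw [Finset.sum_range_succ, hen]
    refine add_le_add (ih hw') ?_
    have hvt : v ≤ t.tgt := hu.1.trans (ht ▸ t.src_lt_tgt.le)
    refine (hω.weightedLength_le hℓ hunsat).trans (le_trans ?_ (pot_mono
      (fun e => mul_nonneg (Nat.cast_nonneg _) (hℓ e).le) hvt))
    rw [weightedLength_eq_pot]
    refine Finset.sum_le_sum fun e he => mul_le_mul_of_nonneg_right (Nat.cast_le.mpr ?_) (hℓ e).le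
    rw [mem_pathEdges] at he
    have h1 := (hv e he).2.1
    have h2 := hadd e
    rw [if_pos (he.trans hvt)] at h2
    omega

/-- The factorials do not depend on the choices made in the weighting process. -/
theorem IsWeightingSequence.weightedLength_unique (hT : IsLocallyFinite T) (hℓ : ∀ e, 0 < ℓ e)
    {ω ω' : ℕ → Edge T → ℕ} {x x' : ℕ → T} (h : IsWeightingSequence ℓ ω x)
    (h' : IsWeightingSequence ℓ ω' x') (n : ℕ) :
    weightedLength ℓ (ω n) (x n) = weightedLength ℓ (ω' n) (x' n) := by
  have hle : ∀ {ω ω' : ℕ → Edge T → ℕ} {x x' : ℕ → T}, IsWeightingSequence ℓ ω x →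
      IsWeightingSequence ℓ ω' x' → ∀ n, ∑ j ∈ Finset.range n, weightedLength ℓ (ω j) (x j) ≤
      ∑ j ∈ Finset.range n, weightedLength ℓ (ω' j) (x' j) := by
    intro ω ω' x x' h h' n
    rw [← h'.pairEnergy_eq (hT := hT)]
    exact h.sum_le_pairEnergy hT hℓ n (h'.isPartialWeighting hT n).1.isIntegralFlow
  have heq := fun n => le_antisymm (hle h h' n) (hle h' h n)
  have h1 := heq (n + 1)
  rw [Finset.sum_range_succ, Finset.sum_range_succ, heq n] at h1
  exact add_left_cancel h1

end TreeFactorial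

namespace TreeFactorial
variable {T : RootedTree}
open scoped Classical

variable {hT : IsLocallyFinite T} {ℓ : Edge T → ℝ}

/-! ### Every edge is eventually weighted -/

theorem pot_sub (g : Edge T → ℝ) {f : Edge T} {v : T} (h : f.tgt ≤ v) :
    pot g v - pot g f.src = ∑ e ∈ (pathEdges v).filter (f.tgt ≤ ·.tgt), g e := by
  have hsub : pathEdges f.src ⊆ pathEdges v := fun e he => by
    rw [mem_pathEdges] at he ⊢
    exact he.trans (f.src_lt_tgt.le.trans h)
  rw [pot, pot, ← Finset.sum_sdiff_eq_sub hsub]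
  refine Finset.sum_congr ?_ fun _ _ => rfl
  ext e
  simp only [Finset.mem_sdiff, Finset.mem_filter, mem_pathEdges]
  refine and_congr_right fun he => ⟨fun h' => ?_, fun h' hle => ?_⟩
  · rcases le_total_of_le h he with h1 | h1
    · exact h1
    · rcases h1.eq_or_lt with h2 | h2
      · exact h2.symm.le
      · exact absurd (Edge.le_src_iff.mpr h2) h'
  · exact f.src_lt_tgt.not_ge (h'.trans hle)

/-- The weight of the edge into `u` is unbounded (a void condition at the root). -/
def IsUnboundedAt (ω : ℕ → Edge T → ℕ) (u : T) : Prop :=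
  ∀ e : Edge T, e.tgt = u → ∀ K, ∃ n, K ≤ ω n e

namespace IsWeightingSequence

variable {ω : ℕ → Edge T → ℕ} {x : ℕ → T} (h : IsWeightingSequence ℓ ω x)

include h

include hT in
theorem exists_unbounded_child {u : T} (hu : IsUnboundedAt ω u) :
    ∃ f : Edge T, f.src = u ∧ IsUnboundedAt ω f.tgt := by
  by_contra! hcon
  have hbd : ∀ f : Edge T, ∃ K, f.src = u → ∀ n, ω n f < K := by
    intro f
    by_cases hf : f.src = u
    · have := hcon f hf
      unfold IsUnboundedAt at this
      push Not at this
      obtain ⟨e, he, K, hK⟩ := this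
      rw [Edge.ext_tgt he] at hK
      exact ⟨K, fun _ => hK⟩
    · exact ⟨0, fun h' => absurd h' hf⟩
  choose K hK using hbd
  have hsum : ∀ n, ∑ f ∈ childEdges hT u, ω n f ≤ ∑ f ∈ childEdges hT u, K f := fun n =>
    Finset.sum_le_sum fun f hf => (hK f ((mem_childEdges hT).mp hf) n).le
  by_cases h0 : u = ⊥
  · have := hsum (∑ f ∈ childEdges hT u, K f + 1)
    rw [h0, (h.isPartialWeighting hT _).1.total] at this
    omega
  · obtain ⟨e, rfl⟩ := exists_edge_tgt h0
    obtain ⟨n, hn⟩ := hu e rfl (∑ f ∈ childEdges hT e.tgt, K f + 2)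
    have hp := (h.isPartialWeighting hT n).1
    have := hsum n
    rw [← hp.conserve e fun hc => ?_] at this
    · omega
    · have := (hp.clear e (by omega) hc).1
      omega

include hT in
/-- If the path from `u` to an unsaturated vertex `v` stays cheap, then the weights in the branches
at `u` not containing `v` stay bounded. -/
theorem le_of_unbounded_child (hℓ : ∀ e, 0 < ℓ e) {u v : T} {N : ℕ}
    (hv : ∀ n, N ≤ n → IsUnsaturated (ω n) v) {C : ℝ}
    (hC : ∀ n, weightedLength ℓ (ω n) v ≤ weightedLength ℓ (ω n) u + C) {f : Edge T}
    (hf : f.src = u) (hunb : IsUnboundedAt ω f.tgt) : f.tgt ≤ v := by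
  by_contra hcon
  obtain ⟨K, hK⟩ := exists_nat_gt (C / ℓ f)
  obtain ⟨n₀, hn₀⟩ := hunb f rfl (K + 1)
  have hmono := h.monotone_weight (hT := hT) f
  set n₁ := max n₀ N
  have hn₁ : K + 1 ≤ ω n₁ f := hn₀.trans (hmono (le_max_left _ _))
  have hex : ∃ m, n₁ ≤ m ∧ ω m f < ω (m + 1) f := by
    by_contra! hle
    have hconst : ∀ k, ω (n₁ + k) f ≤ ω n₁ f := by
      intro k
      induction k with
      | zero => exact le_rfl
      | succ k ih => exact (hle (n₁ + k) (Nat.le_add_right _ _)).trans ih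
    obtain ⟨n₂, hn₂⟩ := hunb f rfl (ω n₁ f + 1)
    have h1 : ω n₂ f ≤ ω (n₁ + n₂) f := hmono (Nat.le_add_left _ _)
    have := hconst n₂
    omega
  obtain ⟨m, hm, hlt⟩ := hex
  have hmf : K + 1 ≤ ω m f := hn₁.trans (hmono hm)
  obtain ⟨S, hS, h1⟩ := (h.isPartialWeighting hT m).2
  have hfS : f ∉ S := fun hfS => by
    have := hS.zero f hfS
    omega
  have hfx : f.tgt ≤ x m := by
    by_contra hfx
    rw [h1, reweight_of_not hfS hfx] at hlt
    exact lt_irrefl _ hlt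
  have h2 := weightedLength_mono_right hℓ (ω m) hfx
  rw [weightedLength_tgt, hf] at h2
  have h3 := h.weightedLength_le hℓ (hv m ((le_max_right _ _).trans hm))
  have h4 := hC m
  have h5 : C < ω m f * ℓ f := by
    rw [div_lt_iff₀ (hℓ f)] at hK
    refine hK.trans_le (mul_le_mul_of_nonneg_right ?_ (hℓ f).le)
    exact_mod_cast (Nat.le_succ K).trans hmf
  linarith

include hT in
/-- No vertex stays unsaturated: the weights would grow along the path to it and in one of the
branches at its end, but the process would not choose vertices in this branch. -/
theorem not_always_isUnsaturated (hℓ : ∀ e, 0 < ℓ e) {v : T} {N : ℕ}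
    (hv : ∀ n, N ≤ n → IsUnsaturated (ω n) v) : False := by
  -- the weights along the path to `v` are unbounded
  have hunb : ∀ u : T, u ≤ v → IsUnboundedAt ω u := by
    intro u
    induction u using tree_induction with
    | bot => exact fun _ e he => absurd he e.tgt_ne_bot
    | step e ih =>
      intro hev
      by_contra hcon
      unfold IsUnboundedAt at hcon
      push Not at hcon
      obtain ⟨e', he', K, hK⟩ := hcon
      rw [Edge.ext_tgt he'] at hK
      obtain ⟨f, hf, hfu⟩ := h.exists_unbounded_child (hT := hT)
        (ih (e.src_lt_tgt.le.trans hev))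
      have hC : ∀ n, weightedLength ℓ (ω n) v ≤ weightedLength ℓ (ω n) e.src +
          ∑ a ∈ (pathEdges v).filter (e.tgt ≤ ·.tgt), (K : ℝ) * ℓ a := by
        intro n
        rw [weightedLength_eq_pot, weightedLength_eq_pot, ← sub_le_iff_le_add', pot_sub _ hev]
        refine Finset.sum_le_sum fun a ha => mul_le_mul_of_nonneg_right ?_ (hℓ a).le
        have h1 := (h.isPartialWeighting hT n).1.antitone (Finset.mem_filter.mp ha).2
        exact_mod_cast h1.trans (hK n).le
      have hfv := h.le_of_unbounded_child (hT := hT) hℓ hv hC hf hfu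
      rw [Edge.eq_of_le_of_le hf hfv hev] at hfu
      obtain ⟨n, hn⟩ := hfu e rfl K
      exact absurd (hK n) hn.not_gt
  obtain ⟨f, hf, hfu⟩ := h.exists_unbounded_child (hT := hT) (hunb v le_rfl)
  have := h.le_of_unbounded_child (hT := hT) hℓ hv (C := 0) (fun n => by simp) hf hfu
  exact absurd (hf ▸ f.src_lt_tgt) this.not_gt

include hT in
theorem eventually_ne_zero (hℓ : ∀ e, 0 < ℓ e) (e : Edge T) : ∀ᶠ n in atTop, ω n e ≠ 0 := by
  suffices H : ∀ v : T, ∀ e : Edge T, e.tgt = v → ∃ N, ω N e ≠ 0 by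
    obtain ⟨N, hN⟩ := H _ e rfl
    filter_upwards [eventually_ge_atTop N] with n hn
    have : ω N e ≤ ω n e := h.monotone_weight (hT := hT) e hn
    omega
  intro v
  induction v using tree_induction with
  | bot => exact fun e he => absurd he e.tgt_ne_bot
  | step g ih =>
    intro e hg
    obtain rfl := Edge.ext_tgt hg
    by_contra! hcon
    have hin : ∃ N, ∀ n, N ≤ n → InTree (ω n) e.src := by
      by_cases h0 : e.src = ⊥
      · exact ⟨0, fun n _ => Or.inl h0⟩
      · obtain ⟨p, hp⟩ := exists_edge_tgt h0
        obtain ⟨N, hN⟩ := ih p hp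
        refine ⟨N, fun n hn => Or.inr ⟨p, hp, ?_⟩⟩
        have : ω N p ≤ ω n p := h.monotone_weight (hT := hT) p hn
        omega
    obtain ⟨N, hN⟩ := hin
    exact h.not_always_isUnsaturated (hT := hT) hℓ fun n hn => ⟨hN n hn, e, rfl, hcon n⟩

include hT in
theorem eventually_two_le (hℓ : ∀ e, 0 < ℓ e) (hwc : IsWeaklyComplete ℓ) {θ : Edge T → ℝ}
    (hθ : IsBoundedUnitFlow ℓ θ) {e : Edge T} (he : 0 < θ e) : ∀ᶠ n in atTop, 2 ≤ ω n e := by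
  obtain ⟨g, hg, a, b, ha, hb, hne⟩ := exists_branching_of_pos hT hwc hθ he
  filter_upwards [h.eventually_ne_zero (hT := hT) hℓ a, h.eventually_ne_zero (hT := hT) hℓ b]
    with n hna hnb
  have hp := (h.isPartialWeighting hT n).1
  have h1 := hp.le_parent ha
  refine le_trans ?_ (hp.antitone hg.1)
  by_contra hlt
  have hu := hp.isUnsaturated_of_branching (g := g) (by omega) ⟨a, b, ha, hb, hne⟩
  have h2 := hp.conserve g fun hc => hna (hc a ha)
  have h3 : ∑ c ∈ ({a, b} : Finset (Edge T)), ω n c ≤ ∑ c ∈ childEdges hT g.tgt, ω n c :=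
    Finset.sum_le_sum_of_subset fun c hc => by
      rcases Finset.mem_insert.mp hc with rfl | hc
      · simpa using ha
      · rw [Finset.mem_singleton.mp hc]; simpa using hb
  rw [Finset.sum_pair hne] at h3
  omega

end IsWeightingSequence

/-! ### The upper bound for the factorials -/

/-- The part of the energy of `η` on the edges of weight at most one. -/
noncomputable def coreDefect {ω : Edge T → ℕ} {n : ℕ} (h : IsPartialWeighting hT ω n)
    (ℓ η : Edge T → ℝ) : ℝ :=
  energy ℓ η - ∑ e ∈ h.core, ℓ e * η e ^ 2

/-- Averaging the minimality of the factorial over the exits of the multiply weighted subtree, with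
respect to the unit current flow.  Exits followed by strict paths longer than `δ * n` are left out of
the average; at most `n` of them are weighted, so they carry little flow. -/
theorem IsWeightingSequence.weightedLength_mul_le (hℓ : ∀ e, 0 < ℓ e) (hwc : IsWeaklyComplete ℓ)
    {ω : ℕ → Edge T → ℕ} {x : ℕ → T} (hω : IsWeightingSequence ℓ ω x) {η : Edge T → ℝ}
    (hη : IsUnitCurrentFlow ℓ η) {n : ℕ} (hn : 1 ≤ n) {δ : ℝ} (hδ : 0 < δ) :
    weightedLength ℓ (ω n) (x n) *
      (1 - √(coreDefect (hω.isPartialWeighting hT n).1 ℓ η / δ)) ≤ n * (energy ℓ η + δ) := by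
  set h := (hω.isPartialWeighting hT n).1
  set a := weightedLength ℓ (ω n) (x n) with ha
  set F := exitEdges hT h.core
  have hn0 : (0 : ℝ) < n := by exact_mod_cast hn
  have ha0 : 0 ≤ a := weightedLength_nonneg hℓ _ _
  have hend : ∀ f : Edge T, ∃ g, 0 < η f → g ∈ strictPath f ∧ IsBranching g.tgt := by
    intro f
    by_cases hf : 0 < η f
    · obtain ⟨g, hg⟩ := exists_branching_of_pos hT hwc hη.1 hf
      exact ⟨g, fun _ => hg⟩
    · exact ⟨f, fun h => absurd h hf⟩
  choose G hG using hend
  set P : Edge T → Finset (Edge T) :=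
    fun f => (pathEdges (G f).tgt).filter (f.tgt ≤ ·.tgt) with hP
  set len : Edge T → ℝ := fun f => ∑ e ∈ P f, ℓ e with hlen
  set Bad := F.filter fun f => 0 < η f ∧ ω n f = 1 ∧ δ * n < len f with hBad
  have hηF : ∑ f ∈ F, η f = 1 := (sum_exitEdges_one hT h.isLowerEdges_core
    fun e _ => hη.1.1.conserve_sum hT e).trans (hη.1.1.total_sum hT)
  have hωF : ∑ f ∈ F, (ω n f : ℝ) = n := h.sum_exitEdges_core
  have hgood : ∀ f ∈ F \ Bad, η f * a ≤ η f * (weightedLength ℓ (ω n) f.src + δ * n) := by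
    intro f hf
    rw [Finset.mem_sdiff, hBad, Finset.mem_filter, not_and] at hf
    rcases (hη.1.1.nonneg f).eq_or_lt with h0 | hpos
    · rw [← h0, zero_mul, zero_mul]
    refine mul_le_mul_of_nonneg_left ?_ hpos.le
    have hδn : 0 < δ * n := by positivity
    rcases h.exists_isUnsaturated hf.1 (hG f hpos).1 (hG f hpos).2 with ⟨-, hu⟩ | ⟨h1, hu, hone⟩
    · have := hω.weightedLength_le hℓ hu
      linarith
    · have h2 := hω.weightedLength_le hℓ hu
      have h3 : len f ≤ δ * n := not_lt.mp fun hlt => hf.2 hf.1 ⟨hpos, h1, hlt⟩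
      have h4 : weightedLength ℓ (ω n) (G f).tgt - weightedLength ℓ (ω n) f.src = len f := by
        rw [weightedLength_eq_pot, weightedLength_eq_pot, pot_sub _ (hG f hpos).1.1]
        refine Finset.sum_congr rfl fun e he => ?_
        rw [Finset.mem_filter, mem_pathEdges] at he
        rw [hone e he.2 he.1, Nat.cast_one, one_mul]
      linarith
  have hmain : a * (1 - ∑ f ∈ Bad, η f) ≤ n * (energy ℓ η + δ) := by
    have h1 : ∑ f ∈ F \ Bad, η f + ∑ f ∈ Bad, η f = 1 := by
      rw [Finset.sum_sdiff (Finset.filter_subset _ _), hηF]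
    calc a * (1 - ∑ f ∈ Bad, η f) = ∑ f ∈ F \ Bad, η f * a := by
          rw [← Finset.sum_mul, ← h1]; ring
      _ ≤ ∑ f ∈ F \ Bad, η f * (weightedLength ℓ (ω n) f.src + δ * n) := Finset.sum_le_sum hgood
      _ ≤ ∑ f ∈ F, η f * (weightedLength ℓ (ω n) f.src + δ * n) :=
          Finset.sum_le_sum_of_subset_of_nonneg Finset.sdiff_subset fun f _ _ =>
            mul_nonneg (hη.1.1.nonneg f)
              (add_nonneg (weightedLength_nonneg hℓ _ _) (by positivity))
      _ = ∑ f ∈ F, η f * pot (fun e => (ω n e : ℝ) * ℓ e) f.src + δ * n := by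
          simp only [mul_add, Finset.sum_add_distrib, ← Finset.sum_mul, hηF, one_mul,
            weightedLength_eq_pot]
      _ = ∑ f ∈ F, (ω n f : ℝ) * pot (fun e => ℓ e * η e) f.src + δ * n := by
          rw [sum_exitEdges_pot hT h.isLowerEdges_core fun e _ => hη.1.1.conserve_sum hT e,
            sum_exitEdges_pot hT h.isLowerEdges_core h.conserve_core]
          congr 1
          exact Finset.sum_congr rfl fun e _ => by ring
      _ ≤ ∑ f ∈ F, (ω n f : ℝ) * energy ℓ η + δ * n := by
          gcongr with f hf
          exact hη.pot_le hT hℓ _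
      _ = n * (energy ℓ η + δ) := by rw [← Finset.sum_mul, hωF]; ring
  have hBadF : ∀ f ∈ Bad, f ∈ F ∧ 0 < η f ∧ ω n f = 1 ∧ δ * n < len f := fun f hf =>
    Finset.mem_filter.mp hf
  have hcard : (Bad.card : ℝ) ≤ n := by
    rw [← hωF, Finset.card_eq_sum_ones, Nat.cast_sum]
    refine le_trans (Finset.sum_le_sum fun f hf => ?_) (Finset.sum_le_sum_of_subset_of_nonneg
      (Finset.filter_subset _ F) fun f _ _ => Nat.cast_nonneg (ω n f))
    rw [(hBadF f hf).2.2.1]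
  have hlenη : ∀ f ∈ Bad, len f * η f ^ 2 = ∑ e ∈ P f, ℓ e * η e ^ 2 := by
    intro f hf
    have hpos := (hBadF f hf).2.1
    rw [hlen, Finset.sum_mul]
    refine Finset.sum_congr rfl fun e he => ?_
    rw [hP, Finset.mem_filter, mem_pathEdges] at he
    rw [hη.1.1.eq_on_strictPath hT (mem_strictPath_of_le (hG f hpos).1 he.2 he.1)]
  have hcore : ∀ f ∈ Bad, ∀ e ∈ P f, e ∉ h.core := fun f hf e he hec =>
    ((mem_exitEdges hT).mp (hBadF f hf).1).2
      (h.isLowerEdges_core (Finset.mem_filter.mp he).2 hec)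
  have hdisj : ∀ f ∈ Bad, ∀ f' ∈ Bad, f ≠ f' → Disjoint (P f) (P f') := by
    -- an exit is never a proper ancestor of another one
    have hanc : ∀ f ∈ Bad, ∀ f' ∈ Bad, f.tgt < f'.tgt → False := by
      intro f hf f' hf' hlt
      have h1 := (mem_exitEdges hT).mp (hBadF f hf).1
      have h2 := (mem_exitEdges hT).mp (hBadF f' hf').1
      have h3 := Edge.le_src_iff.mpr hlt
      rcases h2.1 with h4 | ⟨p, hp, hpf⟩
      · exact f.tgt_ne_bot (le_bot_iff.mp (h4 ▸ h3))
      · exact h1.2 (h.isLowerEdges_core (hpf.symm ▸ h3) hp)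
    intro f hf f' hf' hne
    refine Finset.disjoint_left.mpr fun e he he' => ?_
    have h1 := (Finset.mem_filter.mp he).2
    have h2 := (Finset.mem_filter.mp he').2
    rcases le_total_of_le h1 h2 with h3 | h3 <;> rcases h3.eq_or_lt with h4 | h4
    · exact hne (Edge.ext_tgt h4)
    · exact hanc f hf f' hf' h4
    · exact hne (Edge.ext_tgt h4.symm)
    · exact hanc f' hf' f hf h4
  have htail : ∑ f ∈ Bad, len f * η f ^ 2 ≤ coreDefect h ℓ η := by
    rw [Finset.sum_congr rfl hlenη, ← Finset.sum_biUnion hdisj, coreDefect, le_sub_iff_add_le,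
      ← Finset.sum_union]
    · exact hη.1.2.sum_le_tsum _ fun e _ => mul_nonneg (hℓ e).le (sq_nonneg _)
    · refine Finset.disjoint_left.mpr fun e he hec => ?_
      obtain ⟨f, hf, hef⟩ := Finset.mem_biUnion.mp he
      exact hcore f hf e hef hec
  have hbad : ∑ f ∈ Bad, η f ≤ √(coreDefect h ℓ η / δ) := by
    refine Real.le_sqrt_of_sq_le ?_
    rw [le_div_iff₀ hδ]
    have h1 : (∑ f ∈ Bad, η f) ^ 2 ≤ Bad.card * ∑ f ∈ Bad, η f ^ 2 := sq_sum_le_card_mul_sum_sq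
    have h2 : δ * n * ∑ f ∈ Bad, η f ^ 2 ≤ ∑ f ∈ Bad, len f * η f ^ 2 := by
      rw [Finset.mul_sum]
      exact Finset.sum_le_sum fun f hf =>
        mul_le_mul_of_nonneg_right (hBadF f hf).2.2.2.le (sq_nonneg _)
    have h3 : (Bad.card : ℝ) * ∑ f ∈ Bad, η f ^ 2 ≤ n * ∑ f ∈ Bad, η f ^ 2 :=
      mul_le_mul_of_nonneg_right hcard (Finset.sum_nonneg fun f _ => sq_nonneg _)
    calc (∑ f ∈ Bad, η f) ^ 2 * δ ≤ n * (∑ f ∈ Bad, η f ^ 2) * δ :=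
          mul_le_mul_of_nonneg_right (h1.trans h3) hδ.le
      _ = δ * n * ∑ f ∈ Bad, η f ^ 2 := by ring
      _ ≤ _ := h2.trans htail
  exact (mul_le_mul_of_nonneg_left (sub_le_sub_left hbad 1) ha0).trans hmain

end TreeFactorial

namespace TreeFactorial
variable {T : RootedTree}
open scoped Classical

variable {hT : IsLocallyFinite T} {ℓ : Edge T → ℝ}

/-! ### Asymptotics of monotone sequences -/

/-- The sums of a sequence of at most linear growth. -/
theorem eventually_sum_le {a : ℕ → ℝ} {H : ℝ}
    (hup : ∀ ε > 0, ∀ᶠ n : ℕ in atTop, a n ≤ (H + ε) * n) (hH : 0 ≤ H) :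
    ∀ ε > 0, ∀ᶠ n : ℕ in atTop, 2 * (∑ j ∈ Finset.range n, a j) / (n : ℝ) ^ 2 ≤ H + ε := by
  intro ε hε
  obtain ⟨N, hN⟩ := eventually_atTop.mp (hup (ε / 2) (half_pos hε))
  have hS : ∀ k : ℕ, ∑ j ∈ Finset.range (N + k), a j ≤
      ∑ j ∈ Finset.range N, a j + (H + ε / 2) * ((N + k : ℕ) : ℝ) ^ 2 / 2 := by
    intro k
    induction k with
    | zero =>
      rw [add_zero, le_add_iff_nonneg_right]
      positivity
    | succ k ih =>
      rw [← add_assoc, Finset.sum_range_succ]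
      have h1 := hN (N + k) (Nat.le_add_right _ _)
      have h2 : 0 ≤ H + ε / 2 := by positivity
      push_cast at *
      nlinarith
  have hlim : Tendsto (fun n : ℕ => 2 * (∑ j ∈ Finset.range N, a j) / (n : ℝ) ^ 2) atTop (𝓝 0) :=
    tendsto_const_nhds.div_atTop ((tendsto_pow_atTop two_ne_zero).comp tendsto_natCast_atTop_atTop)
  filter_upwards [hlim.eventually (ge_mem_nhds (half_pos hε)), eventually_ge_atTop (max N 1)]
    with n hn hnN
  have hn1 : (0 : ℝ) < n := by exact_mod_cast (le_max_right N 1).trans hnN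
  obtain ⟨k, rfl⟩ := Nat.exists_eq_add_of_le ((le_max_left N 1).trans hnN)
  have h1 := hS k
  rw [div_le_iff₀ (by positivity)] at hn ⊢
  nlinarith

/-- If the sums of a monotone sequence of at most linear growth `H` grow as those of the linear
sequence, then so does the sequence. -/
theorem tendsto_div_of_sum {a : ℕ → ℝ} {H : ℝ} (ha : Monotone a)
    (hup : ∀ ε > 0, ∀ᶠ n : ℕ in atTop, a n ≤ (H + ε) * n)
    (hS : Tendsto (fun n : ℕ => 2 * (∑ j ∈ Finset.range n, a j) / (n : ℝ) ^ 2) atTop (𝓝 H)) :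
    Tendsto (fun n : ℕ => a n / n) atTop (𝓝 H) := by
  refine tendsto_order.mpr ⟨fun c hc => ?_, fun c hc => ?_⟩
  · -- compare the sums up to `n` and up to `r * n`, for a number `r` close to one
    have hex : ∃ r : ℝ, 0 < r ∧ r < 1 ∧ 2 * c < H * (1 + r) := by
      have hlim : Tendsto (fun r : ℝ => H * (1 + r)) (𝓝[<] 1) (𝓝 (H * (1 + 1))) :=
        ((continuous_const.mul (continuous_const.add continuous_id)).tendsto 1).mono_left
          nhdsWithin_le_nhds
      have h1 := hlim.eventually (lt_mem_nhds (show 2 * c < H * (1 + 1) by linarith))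
      have h2 : ∀ᶠ r : ℝ in 𝓝[<] 1, r ∈ Set.Ioo (0 : ℝ) 1 := Ioo_mem_nhdsLT zero_lt_one
      obtain ⟨r, hr1, hr2⟩ := (h1.and h2).exists
      exact ⟨r, hr2.1, hr2.2, hr1⟩
    obtain ⟨r, hr0, hr1, hr⟩ := hex
    set m : ℕ → ℕ := fun n => ⌊r * n⌋₊ with hm
    have hm1 : Tendsto (fun n : ℕ => (m n : ℝ) / n) atTop (𝓝 r) :=
      (tendsto_nat_floor_mul_div_atTop hr0.le).comp tendsto_natCast_atTop_atTop
    have hm2 : Tendsto m atTop atTop :=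
      tendsto_nat_floor_atTop.comp (tendsto_natCast_atTop_atTop.const_mul_atTop hr0)
    have h1 : Tendsto (fun n : ℕ => (2 * (∑ j ∈ Finset.range n, a j) / (n : ℝ) ^ 2 -
        2 * (∑ j ∈ Finset.range (m n), a j) / (m n : ℝ) ^ 2 * ((m n : ℝ) / n) ^ 2) /
        (2 * (1 - (m n : ℝ) / n))) atTop (𝓝 ((H - H * r ^ 2) / (2 * (1 - r)))) :=
      (hS.sub ((hS.comp hm2).mul (hm1.pow 2))).div ((hm1.const_sub 1).const_mul 2)
        (by linarith [sub_pos.mpr hr1] : (2 * (1 - r)) ≠ 0)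
    have h2 : c < (H - H * r ^ 2) / (2 * (1 - r)) := by
      rw [lt_div_iff₀ (by linarith)]
      nlinarith
    filter_upwards [h1.eventually (lt_mem_nhds h2), hm1.eventually (gt_mem_nhds hr1),
      hm2.eventually (eventually_ge_atTop 1), eventually_ge_atTop 1] with n hn hmn hmn1 hn1
    refine hn.trans_le ?_
    have hn0 : (0 : ℝ) < n := by exact_mod_cast hn1
    have hm0 : (0 : ℝ) < m n := by exact_mod_cast hmn1
    have hlt : (m n : ℝ) < n := by rwa [div_lt_one hn0] at hmn
    have hle : m n ≤ n := by exact_mod_cast hlt.le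
    have h3 : ∑ j ∈ Finset.range n, a j ≤ ∑ j ∈ Finset.range (m n), a j + (n - m n) * a n := by
      rw [← Finset.sum_range_add_sum_Ico _ hle]
      gcongr
      refine (Finset.sum_le_sum (g := fun _ => a n) fun j hj =>
        ha (Finset.mem_Ico.mp hj).2.le).trans ?_
      rw [Finset.sum_const, Nat.card_Ico, nsmul_eq_mul, Nat.cast_sub hle]
    rw [div_le_div_iff₀ (by nlinarith [sub_pos.mpr hmn]) hn0]
    have e1 : 2 * (∑ j ∈ Finset.range n, a j) / (n : ℝ) ^ 2 -
        2 * (∑ j ∈ Finset.range (m n), a j) / (m n : ℝ) ^ 2 * ((m n : ℝ) / n) ^ 2 =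
        2 * (∑ j ∈ Finset.range n, a j - ∑ j ∈ Finset.range (m n), a j) / (n : ℝ) ^ 2 := by
      field_simp
    have e2 : a n * (2 * (1 - (m n : ℝ) / n)) = 2 * ((n - m n) * a n) / (n : ℝ) ^ 2 * n := by
      field_simp
    rw [e1, e2]
    gcongr
    linarith
  · filter_upwards [hup ((c - H) / 2) (by linarith), eventually_ge_atTop 1] with n hn hn1
    have hn0 : (0 : ℝ) < n := by exact_mod_cast hn1
    rw [div_lt_iff₀ hn0]
    refine hn.trans_lt (mul_lt_mul_of_pos_right ?_ hn0)
    linarith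

/-! ### Convergence of the weights and of the factorials -/

namespace IsWeightingSequence

variable {ω : ℕ → Edge T → ℕ} {x : ℕ → T} (h : IsWeightingSequence ℓ ω x) (hℓ : ∀ e, 0 < ℓ e)
  (hwc : IsWeaklyComplete ℓ) {η : Edge T → ℝ} (hη : IsUnitCurrentFlow ℓ η)

include h hℓ hwc hη

/-- Every edge that carries some of the unit current flow eventually has weight at least two. -/
theorem tendsto_coreDefect :
    Tendsto (fun n => coreDefect (h.isPartialWeighting hT n).1 ℓ η) atTop (𝓝 0) := by
  have hnn : ∀ e, 0 ≤ ℓ e * η e ^ 2 := fun e => mul_nonneg (hℓ e).le (sq_nonneg _)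
  refine tendsto_order.mpr ⟨fun c hc => Eventually.of_forall fun n => hc.trans_le ?_,
    fun c hc => ?_⟩
  · exact sub_nonneg.mpr (hη.1.2.sum_le_tsum _ fun e _ => hnn e)
  · obtain ⟨s, hs⟩ := (hη.1.2.hasSum.eventually
      (lt_mem_nhds (show energy ℓ η - c < energy ℓ η by linarith))).exists
    have hev : ∀ᶠ n in atTop, ∀ e ∈ s, 0 < η e → 2 ≤ ω n e := by
      rw [Filter.eventually_all_finset]
      intro e _
      by_cases he : 0 < η e
      · exact (h.eventually_two_le (hT := hT) hℓ hwc hη.1 he).mono fun n hn _ => hn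
      · exact Eventually.of_forall fun n h' => absurd h' he
    filter_upwards [hev] with n hn
    have h1 : ∑ e ∈ s, ℓ e * η e ^ 2 ≤
        ∑ e ∈ (h.isPartialWeighting hT n).1.core, ℓ e * η e ^ 2 := by
      rw [← Finset.sum_filter_of_ne (p := fun e => 0 < η e) fun e _ he => ?_]
      · refine Finset.sum_le_sum_of_subset_of_nonneg (fun e he => ?_) fun e _ _ => hnn e
        rw [Finset.mem_filter] at he
        exact (h.isPartialWeighting hT n).1.mem_core.mpr (hn e he.1 he.2)
      · refine (hη.1.1.nonneg e).lt_of_ne fun h0 => he ?_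
        rw [← h0]; ring
    unfold coreDefect
    linarith

include hT

theorem eventually_weightedLength_le :
    ∀ ε > 0, ∀ᶠ n : ℕ in atTop, weightedLength ℓ (ω n) (x n) ≤ (energy ℓ η + ε) * n := by
  intro ε hε
  have hδ : 0 < ε / 2 := half_pos hε
  have hlim : Tendsto (fun n => (energy ℓ η + ε) *
      (1 - √(coreDefect (h.isPartialWeighting hT n).1 ℓ η / (ε / 2)))) atTop
      (𝓝 ((energy ℓ η + ε) * (1 - √(0 / (ε / 2))))) :=
    (((h.tendsto_coreDefect (hT := hT) hℓ hwc hη).div_const _).sqrt.const_sub 1).const_mul _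
  rw [zero_div, Real.sqrt_zero, sub_zero, mul_one] at hlim
  have hH := energy_nonneg hℓ η
  filter_upwards [hlim.eventually (lt_mem_nhds
    (show energy ℓ η + ε / 2 < energy ℓ η + ε by linarith)), eventually_ge_atTop 1] with n hn hn1
  have h1 := h.weightedLength_mul_le (hT := hT) hℓ hwc hη hn1 hδ
  set c := 1 - √(coreDefect (h.isPartialWeighting hT n).1 ℓ η / (ε / 2))
  have hc : 0 < c := by
    by_contra hc
    nlinarith
  have hn0 : (0 : ℝ) ≤ n := Nat.cast_nonneg n
  refine le_of_mul_le_mul_right (h1.trans ?_) hc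
  nlinarith

theorem eventually_pairEnergy_le : ∀ ε > 0, ∀ᶠ n : ℕ in atTop,
    2 * pairEnergy ℓ (ω n) / (n : ℝ) ^ 2 ≤ energy ℓ η + ε := by
  intro ε hε
  filter_upwards [eventually_sum_le (h.eventually_weightedLength_le (hT := hT) hℓ hwc hη)
    (energy_nonneg hℓ η) ε hε] with n hn
  rwa [h.pairEnergy_eq (hT := hT)]

omit hwc hη in
theorem sum_le_pairEnergy_div (s : Finset (Edge T)) (n : ℕ) :
    ∑ e ∈ s, ℓ e * (normalizedWeight ω n e ^ 2 - normalizedWeight ω n e / n) ≤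
      2 * pairEnergy ℓ (ω n) / (n : ℝ) ^ 2 := by
  have hnn : ∀ e, 0 ≤ ((ω n e).choose 2 : ℝ) * ℓ e := fun e =>
    mul_nonneg (Nat.cast_nonneg _) (hℓ e).le
  have h1 : ∑ e ∈ s, ((ω n e).choose 2 : ℝ) * ℓ e ≤ pairEnergy ℓ (ω n) := by
    have hfin := finite_support_pairEnergy (ℓ := ℓ) (h.isPartialWeighting hT n).1.finite_two
    rw [pairEnergy, finsum_eq_sum_of_support_subset (s := hfin.toFinset ∪ s)]
    · exact Finset.sum_le_sum_of_subset_of_nonneg Finset.subset_union_right fun e _ _ => hnn e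
    · intro e he
      simpa using Or.inl (by simpa using he)
  have h2 : ∑ e ∈ s, ℓ e * (normalizedWeight ω n e ^ 2 - normalizedWeight ω n e / n) =
      2 * (∑ e ∈ s, ((ω n e).choose 2 : ℝ) * ℓ e) / (n : ℝ) ^ 2 := by
    rw [Finset.mul_sum, Finset.sum_div]
    refine Finset.sum_congr rfl fun e _ => ?_
    rw [Nat.cast_choose_two, normalizedWeight]
    rcases eq_or_ne (n : ℝ) 0 with h0 | h0
    · simp [h0]
    · field_simp
  rw [h2]
  gcongr

omit h hT hℓ hwc hη in
theorem tendsto_sum_normalizedWeight {l : Filter ℕ} (hl : l ≤ atTop) {φ : Edge T → ℝ}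
    (hφ : ∀ e, Tendsto (fun n => normalizedWeight ω n e) l (𝓝 (φ e))) (s : Finset (Edge T)) :
    Tendsto (fun n : ℕ => ∑ e ∈ s, ℓ e * (normalizedWeight ω n e ^ 2 - normalizedWeight ω n e / n))
      l (𝓝 (∑ e ∈ s, ℓ e * φ e ^ 2)) := by
  refine tendsto_finsetSum _ fun e _ => Tendsto.const_mul _ ?_
  have h1 := ((hφ e).pow 2).sub ((hφ e).mul ((tendsto_inv_atTop_nhds_zero_nat (𝕜 := ℝ)).mono_left hl))
  rw [mul_zero, sub_zero] at h1
  exact h1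

omit hwc hη hℓ in
theorem normalizedWeight_mem_Icc (n : ℕ) (e : Edge T) :
    normalizedWeight ω n e ∈ Set.Icc (0 : ℝ) 1 := by
  refine ⟨div_nonneg (Nat.cast_nonneg _) (Nat.cast_nonneg _), div_le_one_of_le₀ ?_
    (Nat.cast_nonneg _)⟩
  have hp := (h.isPartialWeighting hT n).1
  obtain ⟨f, hf, hfe⟩ := exists_child_le (bot_lt_iff_ne_bot.mpr e.tgt_ne_bot)
  have h1 : ω n f ≤ n := by
    conv_rhs => rw [← hp.total]
    exact Finset.single_le_sum (fun g _ => Nat.zero_le _) ((mem_childEdges hT).mpr hf)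
  exact_mod_cast (hp.antitone hfe).trans h1

omit hwc hη in
theorem isUnitFlow_of_tendsto {l : Filter ℕ} [l.NeBot] (hl : l ≤ atTop) {φ : Edge T → ℝ}
    (hφ : ∀ e, Tendsto (fun n => normalizedWeight ω n e) l (𝓝 (φ e))) : IsUnitFlow φ := by
  refine TreeFactorial.isUnitFlow_of_tendsto hT hφ
    (Eventually.of_forall fun n e => (h.normalizedWeight_mem_Icc (hT := hT) n e).1) (fun e => ?_) ?_
  · refine Tendsto.mono_left ?_ hl
    by_cases hleaf : IsLeaf e.tgt
    · have hempty : childEdges hT e.tgt = ∅ := by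
        ext f; simpa using hleaf f
      simp only [hempty, Finset.sum_empty, sub_zero]
      refine squeeze_zero (fun n => (h.normalizedWeight_mem_Icc (hT := hT) n e).1) (fun n => ?_)
        (tendsto_inv_atTop_nhds_zero_nat (𝕜 := ℝ))
      have h1 : ω n e ≤ 1 := by
        by_contra hlt
        have := ((h.isPartialWeighting hT n).1.clear e (by omega) fun f hf =>
          absurd hf (hleaf f)).1
        omega
      rw [normalizedWeight, div_eq_mul_inv]
      exact mul_le_of_le_one_left (by positivity) (by exact_mod_cast h1)
    · obtain ⟨f, hf⟩ := exists_child_of_not_isLeaf hleaf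
      refine tendsto_const_nhds.congr' ?_
      filter_upwards [h.eventually_ne_zero (hT := hT) hℓ f] with n hn
      simp only [normalizedWeight]
      rw [← Finset.sum_div, (h.isPartialWeighting hT n).1.conserve e fun hc => hn (hc f hf),
        Nat.cast_sum, sub_self]
  · refine Tendsto.mono_left ?_ hl
    refine tendsto_const_nhds.congr' ?_
    filter_upwards [eventually_ge_atTop 1] with n hn
    simp only [normalizedWeight]
    rw [← Finset.sum_div, ← Nat.cast_sum, (h.isPartialWeighting hT n).1.total, div_self]
    exact Nat.cast_ne_zero.mpr (by omega)

/-- Any limit point of the normalized weights is a unit flow of energy at most that of the unit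
current flow, hence equal to it. -/
theorem tendsto_normalizedWeight (e : Edge T) :
    Tendsto (fun n => normalizedWeight ω n e) atTop (𝓝 (η e)) := by
  rw [tendsto_iff_ultrafilter]
  intro 𝓤 h𝓤
  obtain ⟨φ, hφ⟩ := exists_ultrafilter_limit 𝓤 (θ := fun n e => normalizedWeight ω n e)
    fun e => Eventually.of_forall fun n => h.normalizedWeight_mem_Icc (hT := hT) n e
  have hen := summable_energy_of_sum_le hℓ (φ := φ) (E := energy ℓ η) fun s => by
    refine le_of_forall_pos_le_add fun ε hε => ?_
    refine le_of_tendsto (tendsto_sum_normalizedWeight h𝓤 hφ s) ?_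
    filter_upwards [h𝓤 (h.eventually_pairEnergy_le (hT := hT) hℓ hwc hη ε hε)] with n hn
    exact (h.sum_le_pairEnergy_div (hT := hT) hℓ s n).trans hn
  have heq := hη.eq_of_energy_le hT hℓ
    ⟨h.isUnitFlow_of_tendsto (hT := hT) hℓ h𝓤 hφ, hen.1⟩ hen.2
  rw [← heq]
  exact hφ e

theorem tendsto_pairEnergy :
    Tendsto (fun n : ℕ => 2 * pairEnergy ℓ (ω n) / (n : ℝ) ^ 2) atTop (𝓝 (energy ℓ η)) := by
  refine tendsto_order.mpr ⟨fun c hc => ?_, fun c hc => ?_⟩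
  · obtain ⟨s, hs⟩ := (hη.1.2.hasSum.eventually (lt_mem_nhds hc)).exists
    have h1 := tendsto_sum_normalizedWeight (ℓ := ℓ) le_rfl
      (h.tendsto_normalizedWeight (hT := hT) hℓ hwc hη) s
    filter_upwards [h1.eventually (lt_mem_nhds hs)] with n hn
    exact hn.trans_le (h.sum_le_pairEnergy_div (hT := hT) hℓ s n)
  · filter_upwards [h.eventually_pairEnergy_le (hT := hT) hℓ hwc hη ((c - energy ℓ η) / 2)
      (by linarith)] with n hn
    linarith

theorem tendsto_weightedLength_div :
    Tendsto (fun n : ℕ => weightedLength ℓ (ω n) (x n) / n) atTop (𝓝 (energy ℓ η)) := by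
  refine tendsto_div_of_sum (h.monotone_weightedLength (hT := hT) hℓ)
    (h.eventually_weightedLength_le (hT := hT) hℓ hwc hη) ?_
  simpa only [h.pairEnergy_eq (hT := hT)] using h.tendsto_pairEnergy (hT := hT) hℓ hwc hη

end IsWeightingSequence

end TreeFactorial

namespace TreeFactorial
variable {T : RootedTree}
open scoped Classical

/-! ### The boundary and the extended boundary -/

theorem isRay_iff {s : Set T} : IsRay s ↔ ⊥ ∈ s ∧ (∀ u v, u ≤ v → v ∈ s → u ∈ s) ∧
    (∀ u ∈ s, ∀ v ∈ s, u ≤ v ∨ v ≤ u) ∧ ∀ v ∈ s, ∃ e : Edge T, e.src = v ∧ e.tgt ∈ s := by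
  constructor
  · rintro ⟨p, h0, hp, rfl⟩
    have hmono : StrictMono p := strictMono_nat_of_lt_succ fun n => (hp n).lt
    refine ⟨⟨0, h0⟩, ?_, ?_, ?_⟩
    · rintro u _ huv ⟨n, rfl⟩
      induction n with
      | zero => exact ⟨0, by rw [h0] at huv ⊢; exact (le_bot_iff.mp huv).symm⟩
      | succ n ih =>
        rcases huv.eq_or_lt with h | h
        · exact ⟨n + 1, h.symm⟩
        · refine ih ?_
          rw [← (hp n).pred_eq]
          exact Order.le_pred_of_lt h
    · rintro _ ⟨n, rfl⟩ _ ⟨m, rfl⟩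
      exact (le_total n m).imp (fun h => hmono.monotone h) fun h => hmono.monotone h
    · rintro _ ⟨n, rfl⟩
      exact ⟨⟨p (n + 1), (bot_le.trans_lt (hp n).lt).ne'⟩, (hp n).pred_eq, ⟨n + 1, rfl⟩⟩
  · rintro ⟨h0, hlow, htot, hchild⟩
    have : Nonempty (Edge T) := ⟨(hchild ⊥ h0).choose⟩
    choose! c hc hcs using hchild
    set p : ℕ → T := fun n => Nat.rec ⊥ (fun _ v => (c v).tgt) n with hpdef
    have hps : ∀ n, p n ∈ s := by
      intro n
      induction n with
      | zero => exact h0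
      | succ n ih => exact hcs _ ih
    refine ⟨p, rfl, fun n => ?_, ?_⟩
    · have := (c (p n)).src_covBy_tgt
      rwa [hc _ (hps n)] at this
    · refine Set.Subset.antisymm (fun v => ?_) (by rintro _ ⟨n, rfl⟩; exact hps n)
      induction v using tree_induction with
      | bot => exact fun _ => ⟨0, rfl⟩
      | step e ih =>
        intro he
        obtain ⟨n, hn⟩ := ih (hlow _ _ e.src_lt_tgt.le he)
        have h1 : (c (p n)).src = e.src := (hc _ (hps n)).trans hn
        refine ⟨n + 1, congrArg Edge.tgt (?_ : c (p n) = e)⟩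
        rcases htot _ (hcs _ (hps n)) _ he with h | h
        · exact Edge.eq_of_le h1 h
        · exact (Edge.eq_of_le h1.symm h).symm

namespace ExtBoundary

variable (ρ : ExtBoundary T)

theorem bot_mem : ⊥ ∈ ρ.1 := by
  rcases ρ.2 with h | ⟨v, -, h⟩
  · exact (isRay_iff.mp h).1
  · rw [h]; exact bot_le

variable {ρ}

theorem mem_of_le {u v : T} (huv : u ≤ v) (hv : v ∈ ρ.1) : u ∈ ρ.1 := by
  rcases ρ.2 with h | ⟨w, -, h⟩
  · exact (isRay_iff.mp h).2.1 u v huv hv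
  · rw [h] at hv ⊢; exact huv.trans hv

theorem le_total {u v : T} (hu : u ∈ ρ.1) (hv : v ∈ ρ.1) : u ≤ v ∨ v ≤ u := by
  rcases ρ.2 with h | ⟨w, -, h⟩
  · exact (isRay_iff.mp h).2.2.1 u hu v hv
  · rw [h] at hu hv; exact le_total_of_le hu hv

theorem exists_child {v : T} (hv : v ∈ ρ.1) (hleaf : ¬ IsLeaf v) :
    ∃ e : Edge T, e.src = v ∧ e.tgt ∈ ρ.1 := by
  rcases ρ.2 with h | ⟨w, hw, h⟩
  · exact (isRay_iff.mp h).2.2.2 v hv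
  · rw [h] at hv ⊢
    exact exists_child_le (lt_of_le_of_ne hv fun h' => hleaf (h' ▸ hw))

theorem eq_of_mem {e f : Edge T} (h : e.src = f.src) (he : e.tgt ∈ ρ.1) (hf : f.tgt ∈ ρ.1) :
    e = f := by
  rcases le_total he hf with h' | h'
  · exact Edge.eq_of_le h h'
  · exact (Edge.eq_of_le h.symm h').symm

theorem subset_Iic_of_isLeaf {v : T} (hv : v ∈ ρ.1) (hleaf : IsLeaf v) : ρ.1 ⊆ Set.Iic v := by
  intro u hu
  rcases le_total hu hv with h | h
  · exact h
  · rcases h.eq_or_lt with h' | h'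
    · exact h'.symm.le
    · obtain ⟨e, he, -⟩ := exists_child_le h'
      exact absurd he (hleaf e)

end ExtBoundary

theorem Boundary.not_isLeaf {s : Boundary T} {v : T} (hv : v ∈ s.1) : ¬ IsLeaf v := fun h => by
  obtain ⟨e, he, -⟩ := (isRay_iff.mp s.2).2.2.2 v hv
  exact h e he

theorem ExtBoundary.cyl_bot : ExtBoundary.cyl (⊥ : T) = Set.univ :=
  Set.eq_univ_of_forall fun ρ => ρ.bot_mem

theorem Boundary.preimage_cyl (v : T) : Boundary.toExt ⁻¹' ExtBoundary.cyl v = Boundary.cyl v := rfl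

theorem Boundary.cyl_bot : Boundary.cyl (⊥ : T) = Set.univ := by
  rw [← Boundary.preimage_cyl, ExtBoundary.cyl_bot, Set.preimage_univ]

theorem ExtBoundary.cyl_anti {u v : T} (h : u ≤ v) : ExtBoundary.cyl v ⊆ ExtBoundary.cyl u :=
  fun _ hρ => ExtBoundary.mem_of_le h hρ

theorem ExtBoundary.inter_cyl {u v : T} (h : u ≤ v) :
    ExtBoundary.cyl u ∩ ExtBoundary.cyl v = ExtBoundary.cyl v :=
  Set.inter_eq_right.mpr (ExtBoundary.cyl_anti h)

theorem ExtBoundary.inter_cyl_or {u v : T} {ρ : ExtBoundary T}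
    (h : ρ ∈ ExtBoundary.cyl u ∩ ExtBoundary.cyl v) :
    ∃ w, ExtBoundary.cyl w = ExtBoundary.cyl u ∩ ExtBoundary.cyl v := by
  rcases ExtBoundary.le_total h.1 h.2 with h' | h'
  · exact ⟨v, (ExtBoundary.inter_cyl h').symm⟩
  · exact ⟨u, by rw [Set.inter_comm, ExtBoundary.inter_cyl h']⟩

theorem ExtBoundary.isPiSystem_cyl : IsPiSystem (Set.range (ExtBoundary.cyl (T := T))) := by
  rintro _ ⟨u, rfl⟩ _ ⟨v, rfl⟩ ⟨ρ, hρ⟩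
  obtain ⟨w, hw⟩ := ExtBoundary.inter_cyl_or hρ
  exact ⟨w, hw⟩

theorem Boundary.isPiSystem_cyl : IsPiSystem (Set.range (Boundary.cyl (T := T))) := by
  rintro _ ⟨u, rfl⟩ _ ⟨v, rfl⟩ ⟨s, hs⟩
  obtain ⟨w, hw⟩ := ExtBoundary.inter_cyl_or (ρ := s.toExt) hs
  refine ⟨w, ?_⟩
  rw [← Boundary.preimage_cyl, hw]
  rfl

theorem ExtBoundary.isOpen_cyl (v : T) : IsOpen (ExtBoundary.cyl v) :=
  TopologicalSpace.isOpen_generateFrom_of_mem ⟨v, rfl⟩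

theorem Boundary.isOpen_cyl (v : T) : IsOpen (Boundary.cyl v) :=
  TopologicalSpace.isOpen_generateFrom_of_mem ⟨v, rfl⟩

theorem Boundary.continuous_toExt : Continuous (Boundary.toExt (T := T)) := by
  refine continuous_generateFrom_iff.mpr ?_
  rintro _ ⟨v, rfl⟩
  exact Boundary.isOpen_cyl v

/-- The cylinder sets form a basis of the topology. -/
theorem ExtBoundary.exists_cyl_subset {U : Set (ExtBoundary T)} (hU : IsOpen U) :
    ∀ ρ ∈ U, ∃ v, ρ ∈ ExtBoundary.cyl v ∧ ExtBoundary.cyl v ⊆ U := by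
  induction hU with
  | basic s hs =>
    obtain ⟨v, rfl⟩ := hs
    exact fun ρ hρ => ⟨v, hρ, subset_rfl⟩
  | univ => exact fun ρ _ => ⟨⊥, ρ.bot_mem, Set.subset_univ _⟩
  | inter s t _ _ ihs iht =>
    intro ρ hρ
    obtain ⟨u, hu, hus⟩ := ihs ρ hρ.1
    obtain ⟨v, hv, hvt⟩ := iht ρ hρ.2
    obtain ⟨w, hw⟩ := ExtBoundary.inter_cyl_or (ρ := ρ) ⟨hu, hv⟩
    exact ⟨w, hw ▸ ⟨hu, hv⟩, hw ▸ Set.inter_subset_inter hus hvt⟩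
  | sUnion S _ ih =>
    rintro ρ ⟨t, ht, hρ⟩
    obtain ⟨v, hv, hvt⟩ := ih t ht ρ hρ
    exact ⟨v, hv, hvt.trans (Set.subset_sUnion_of_mem ht)⟩

variable (hT : IsLocallyFinite T)

include hT in
theorem ExtBoundary.secondCountableTopology : SecondCountableTopology (ExtBoundary T) :=
  have := countable_vertex hT
  ⟨Set.range ExtBoundary.cyl, Set.countable_range _, rfl⟩

include hT in
theorem Boundary.secondCountableTopology : SecondCountableTopology (Boundary T) :=
  have := countable_vertex hT
  ⟨Set.range Boundary.cyl, Set.countable_range _, rfl⟩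

include hT in
theorem Boundary.borel_eq :
    (inferInstance : MeasurableSpace (Boundary T)) = .generateFrom (Set.range Boundary.cyl) :=
  have := Boundary.secondCountableTopology hT
  borel_eq_generateFrom_of_subbasis rfl

/-! ### The measure of a unit flow -/

include hT in
theorem IsFlowMeasure.unique {θ : Edge T → ℝ} {μ ν : Measure (Boundary T)}
    (hμ : IsFlowMeasure θ μ) (hν : IsFlowMeasure θ ν) : ν = μ := by
  have := hμ.1
  have := hν.1
  refine ext_of_generate_finite _ (Boundary.borel_eq hT) Boundary.isPiSystem_cyl ?_ (by simp)
  rintro _ ⟨v, rfl⟩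
  by_cases h0 : v = ⊥
  · rw [h0, Boundary.cyl_bot, measure_univ, measure_univ]
  · obtain ⟨e, rfl⟩ := exists_edge_tgt h0
    rw [hμ.2, hν.2]

/-- A half-open interval is cut into consecutive half-open intervals of given lengths. -/
theorem exists_interval {ι : Type*} (enc : ι → ℕ) (θ : ι → ℝ) (K : Finset ι)
    (henc : Function.Injective enc) {y : ℝ} (h0 : 0 ≤ y) (hy : y < ∑ e ∈ K, θ e) :
    ∃ e ∈ K, ∑ c ∈ K with enc c < enc e, θ c ≤ y ∧
      y < ∑ c ∈ K with enc c < enc e, θ c + θ e := by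
  induction K using Finset.induction_on_max_value enc with
  | empty => rw [Finset.sum_empty] at hy; linarith
  | insert a s ha hmax ih =>
    have hlt : ∀ c ∈ s, enc c < enc a := fun c hc =>
      lt_of_le_of_ne (hmax c hc) fun h => ha (henc h ▸ hc)
    by_cases hys : y < ∑ e ∈ s, θ e
    · obtain ⟨e, he, h1⟩ := ih hys
      refine ⟨e, Finset.mem_insert_of_mem he, ?_⟩
      rwa [Finset.filter_insert, if_neg (hlt e he).not_gt]
    · refine ⟨a, Finset.mem_insert_self _ _, ?_⟩
      rw [Finset.filter_insert, if_neg (lt_irrefl _), Finset.filter_true_of_mem hlt]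
      rw [Finset.sum_insert ha] at hy
      exact ⟨not_lt.mp hys, by linarith⟩

theorem interval_unique {ι : Type*} (enc : ι → ℕ) {θ : ι → ℝ} (hθ : ∀ e, 0 ≤ θ e) (K : Finset ι)
    (henc : Function.Injective enc) {y : ℝ} {e f : ι} (he : e ∈ K) (hf : f ∈ K)
    (hye : ∑ c ∈ K with enc c < enc e, θ c ≤ y ∧ y < ∑ c ∈ K with enc c < enc e, θ c + θ e)
    (hyf : ∑ c ∈ K with enc c < enc f, θ c ≤ y ∧ y < ∑ c ∈ K with enc c < enc f, θ c + θ f) :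
    e = f := by
  have key : ∀ e f, e ∈ K → enc e < enc f →
      ∑ c ∈ K with enc c < enc e, θ c + θ e ≤ ∑ c ∈ K with enc c < enc f, θ c := by
    intro e f he hlt
    rw [add_comm, ← Finset.sum_insert (by simp)]
    refine Finset.sum_le_sum_of_subset_of_nonneg (fun c hc => ?_) fun c _ _ => hθ c
    rw [Finset.mem_filter]
    rcases Finset.mem_insert.mp hc with rfl | hc
    · exact ⟨he, hlt⟩
    · rw [Finset.mem_filter] at hc
      exact ⟨hc.1, hc.2.trans hlt⟩
  rcases lt_trichotomy (enc e) (enc f) with h | h | h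
  · linarith [key e f he h]
  · exact henc h
  · linarith [key f e hf h]

section FlowMeasure

variable {hT} {θ : Edge T → ℝ}

/-- The left end-point of the interval assigned to `v`, when the unit interval is subdivided
according to the flow `θ` and the enumeration `enc` of the edges. -/
noncomputable def intervalStart (hT : IsLocallyFinite T) (θ : Edge T → ℝ) (enc : Edge T → ℕ)
    (v : T) : ℝ :=
  pot (fun e => ∑ c ∈ childEdges hT e.src with enc c < enc e, θ c) v

/-- The interval assigned to `v` has the flow out of `v` as its length. -/
noncomputable def flowInterval (hT : IsLocallyFinite T) (θ : Edge T → ℝ) (enc : Edge T → ℕ)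
    (v : T) : Set ℝ :=
  Set.Ico (intervalStart hT θ enc v) (intervalStart hT θ enc v + ∑ f ∈ childEdges hT v, θ f)

theorem mem_flowInterval_tgt (hθ : IsUnitFlow θ) (enc : Edge T → ℕ) (e : Edge T) (y : ℝ) :
    y ∈ flowInterval hT θ enc e.tgt ↔
      ∑ c ∈ childEdges hT e.src with enc c < enc e, θ c ≤ y - intervalStart hT θ enc e.src ∧
      y - intervalStart hT θ enc e.src <
        ∑ c ∈ childEdges hT e.src with enc c < enc e, θ c + θ e := by
  rw [flowInterval, ← hθ.conserve_sum hT e, intervalStart, pot_tgt, Set.mem_Ico]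
  simp only [intervalStart]
  constructor <;> rintro ⟨h1, h2⟩ <;> constructor <;> linarith

theorem flowInterval_subset (hθ : IsUnitFlow θ) (enc : Edge T → ℕ) {u v : T} (huv : u ≤ v) :
    flowInterval hT θ enc v ⊆ flowInterval hT θ enc u := by
  induction v using tree_induction with
  | bot => rw [le_bot_iff.mp huv]
  | step e ih =>
    rcases huv.eq_or_lt with rfl | h
    · exact subset_rfl
    refine subset_trans (fun y hy => ?_) (ih (Edge.le_src_iff.mpr h))
    rw [mem_flowInterval_tgt hθ] at hy
    have h1 : 0 ≤ ∑ c ∈ childEdges hT e.src with enc c < enc e, θ c :=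
      Finset.sum_nonneg fun c _ => hθ.nonneg c
    have h2 : ∑ c ∈ childEdges hT e.src with enc c < enc e, θ c + θ e ≤
        ∑ c ∈ childEdges hT e.src, θ c := by
      rw [add_comm, ← Finset.sum_insert (by simp)]
      refine Finset.sum_le_sum_of_subset_of_nonneg (fun c hc => ?_) fun c _ _ => hθ.nonneg c
      rcases Finset.mem_insert.mp hc with rfl | hc
      · simp
      · exact (Finset.mem_filter.mp hc).1
    rw [flowInterval, Set.mem_Ico]
    constructor <;> linarith

theorem flowInterval_bot (hθ : IsUnitFlow θ) (enc : Edge T → ℕ) :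
    flowInterval hT θ enc ⊥ = Set.Ico 0 1 := by
  rw [flowInterval, intervalStart, pot_bot, hθ.total_sum hT, zero_add]

/-- A point of the unit interval determines the ray of the vertices whose interval contains it. -/
theorem isRay_flowInterval (hθ : IsUnitFlow θ) {enc : Edge T → ℕ} (henc : Function.Injective enc)
    {y : ℝ} (hy : y ∈ Set.Ico (0 : ℝ) 1) : IsRay {v : T | y ∈ flowInterval hT θ enc v} := by
  have hlow : ∀ u v : T, u ≤ v → y ∈ flowInterval hT θ enc v → y ∈ flowInterval hT θ enc u :=
    fun u v huv hv => flowInterval_subset hθ enc huv hv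
  refine isRay_iff.mpr ⟨by rw [← flowInterval_bot (hT := hT) hθ enc] at hy; exact hy,
    hlow, ?_, ?_⟩
  · intro u hu v hv
    by_contra! hcon
    obtain ⟨a, ha, hau⟩ := exists_child_le
      (lt_of_le_of_ne inf_le_left fun h => hcon.1 (h ▸ inf_le_right) : u ⊓ v < u)
    obtain ⟨b, hb, hbv⟩ := exists_child_le
      (lt_of_le_of_ne inf_le_right fun h => hcon.2 (h ▸ inf_le_left) : u ⊓ v < v)
    have h1 := hlow _ _ hau hu
    have h2 := hlow _ _ hbv hv
    rw [mem_flowInterval_tgt hθ, ha] at h1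
    rw [mem_flowInterval_tgt hθ, hb] at h2
    have := interval_unique enc hθ.nonneg _ henc ((mem_childEdges hT).mpr ha)
      ((mem_childEdges hT).mpr hb) h1 h2
    exact absurd (le_inf hau (this ▸ hbv)) (ha ▸ a.src_lt_tgt).not_ge
  · intro v hv
    have hv' : y ∈ flowInterval hT θ enc v := hv
    rw [flowInterval, Set.mem_Ico] at hv'
    obtain ⟨e, he, h1⟩ := exists_interval enc θ (childEdges hT v) henc
      (y := y - intervalStart hT θ enc v) (by linarith) (by linarith)
    rw [mem_childEdges] at he
    subst he
    exact ⟨e, rfl, (mem_flowInterval_tgt hθ enc e y).mpr h1⟩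

/-- The measure of a unit flow exists: it is the image of the uniform distribution on the unit
interval. -/
theorem exists_isFlowMeasure (hT : IsLocallyFinite T) (hθ : IsUnitFlow θ) :
    ∃ μ : Measure (Boundary T), IsFlowMeasure θ μ := by
  have := countable_edge hT
  obtain ⟨enc, henc⟩ := exists_injective_nat (Edge T)
  set F : ℝ → Boundary T := fun y => ⟨_, isRay_flowInterval (hT := hT) hθ henc
    (y := Int.fract y) ⟨Int.fract_nonneg y, Int.fract_lt_one y⟩⟩ with hF
  have hpre : ∀ v, F ⁻¹' Boundary.cyl v = Int.fract ⁻¹' flowInterval hT θ enc v := fun v => rfl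
  have hmeas : Measurable F := by
    have h1 := Boundary.borel_eq hT
    have h2 : @Measurable _ _ _ (.generateFrom (Set.range (Boundary.cyl (T := T)))) F := by
      refine measurable_generateFrom ?_
      rintro _ ⟨v, rfl⟩
      rw [hpre]
      exact measurable_fract measurableSet_Ico
    rwa [← h1] at h2
  refine ⟨(volume.restrict (Set.Ico (0 : ℝ) 1)).map F, ⟨?_⟩, fun e => ?_⟩
  · rw [Measure.map_apply hmeas MeasurableSet.univ]
    simp
  · rw [Measure.map_apply hmeas (Boundary.isOpen_cyl _).measurableSet, hpre,
      Measure.restrict_apply (measurable_fract (by exact measurableSet_Ico))]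
    have h1 : Int.fract ⁻¹' flowInterval hT θ enc e.tgt ∩ Set.Ico (0 : ℝ) 1 =
        flowInterval hT θ enc e.tgt := by
      ext y
      constructor
      · rintro ⟨h1, h2⟩
        rwa [Set.mem_preimage, Int.fract_eq_self.mpr h2] at h1
      · intro h1
        have h2 : y ∈ Set.Ico (0 : ℝ) 1 :=
          flowInterval_bot (hT := hT) hθ enc ▸ flowInterval_subset hθ enc bot_le h1
        exact ⟨by rwa [Set.mem_preimage, Int.fract_eq_self.mpr h2], h2⟩
    rw [h1, flowInterval, Real.volume_Ico, add_sub_cancel_left, ← hθ.conserve_sum hT e]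

end FlowMeasure

end TreeFactorial

namespace TreeFactorial
variable {T : RootedTree}
open scoped Classical

variable {hT : IsLocallyFinite T} {ℓ : Edge T → ℝ}

/-! ### Weak convergence of consistent measures -/

theorem Boundary.cyl_eq_empty_of_isLeaf {v : T} (hv : IsLeaf v) : Boundary.cyl v = ∅ :=
  Set.eq_empty_of_forall_notMem fun _ hs => Boundary.not_isLeaf hs hv

include hT in
/-- Convergence on the cylinders of the vertices that are not leaves implies convergence on the
cylinder of a leaf, which is negligible for the limit. -/
theorem tendsto_cyl_of_isLeaf {θ : Edge T → ℝ} (hθ : IsUnitFlow θ)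
    {μ : ℕ → Measure (ExtBoundary T)} [∀ n, IsProbabilityMeasure (μ n)]
    (hμ : ∀ e : Edge T, ¬ IsLeaf e.tgt →
      Tendsto (fun n => (μ n).real (ExtBoundary.cyl e.tgt)) atTop (𝓝 (θ e)))
    {e : Edge T} (he : IsLeaf e.tgt) :
    Tendsto (fun n => (μ n).real (ExtBoundary.cyl e.tgt)) atTop (𝓝 0) := by
  set K := (childEdges hT e.src).filter fun c => ¬ IsLeaf c.tgt
  have hsum : ∑ c ∈ K, θ c = ∑ c ∈ childEdges hT e.src, θ c :=
    Finset.sum_filter_of_ne fun c _ hc hl => hc (hθ.eq_zero_of_isLeaf hl)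
  have hsrc : Tendsto (fun n => (μ n).real (ExtBoundary.cyl e.src)) atTop (𝓝 (∑ c ∈ K, θ c)) := by
    rw [hsum]
    by_cases h0 : e.src = ⊥
    · rw [h0, hθ.total_sum hT, ExtBoundary.cyl_bot]
      simp
    · obtain ⟨p, hp⟩ := exists_edge_tgt h0
      rw [← hp, ← hθ.conserve_sum hT p]
      exact hμ p fun hl => hl e hp.symm
  have hlim : Tendsto (fun n => (μ n).real (ExtBoundary.cyl e.src) -
      ∑ c ∈ K, (μ n).real (ExtBoundary.cyl c.tgt)) atTop (𝓝 (∑ c ∈ K, θ c - ∑ c ∈ K, θ c)) :=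
    hsrc.sub (tendsto_finsetSum _ fun c hc => hμ c (Finset.mem_filter.mp hc).2)
  rw [sub_self] at hlim
  refine squeeze_zero (fun n => measureReal_nonneg) (fun n => ?_) hlim
  have hdisj : Set.PairwiseDisjoint (↑(insert e K) : Set (Edge T))
      fun c => ExtBoundary.cyl c.tgt := by
    have hsrc : ∀ c ∈ (↑(insert e K) : Set (Edge T)), c.src = e.src := by
      intro c hc
      rcases Finset.mem_insert.mp (Finset.mem_coe.mp hc) with rfl | hc
      · rfl
      · exact (mem_childEdges hT).mp (Finset.mem_filter.mp hc).1
    intro a ha b hb hne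
    refine Set.disjoint_left.mpr fun ρ hρa hρb => hne ?_
    exact ExtBoundary.eq_of_mem ((hsrc a ha).trans (hsrc b hb).symm) hρa hρb
  have heK : e ∉ K := fun h => (Finset.mem_filter.mp h).2 he
  have h1 := measureReal_biUnion_finset (μ := μ n) hdisj
    fun c _ => (ExtBoundary.isOpen_cyl c.tgt).measurableSet
  rw [Finset.sum_insert heK] at h1
  rw [le_sub_iff_add_le, ← h1]
  refine measureReal_mono (Set.iUnion₂_subset fun c hc => ExtBoundary.cyl_anti ?_)
  rcases Finset.mem_insert.mp hc with rfl | hc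
  · exact c.src_lt_tgt.le
  · exact (mem_childEdges hT).mp (Finset.mem_filter.mp hc).1 ▸ c.src_lt_tgt.le

include hT in
/-- Weak convergence can be tested on the cylinders of the vertices that are not leaves. -/
theorem weaklyTendsTo_of_cyl {θ : Edge T → ℝ} (hθ : IsUnitFlow θ) {ν : Measure (Boundary T)}
    (hν : IsFlowMeasure θ ν) {μ : ℕ → Measure (ExtBoundary T)}
    (hprob : ∀ n, IsProbabilityMeasure (μ n))
    (hμ : ∀ e : Edge T, ¬ IsLeaf e.tgt →
      Tendsto (fun n => (μ n).real (ExtBoundary.cyl e.tgt)) atTop (𝓝 (θ e))) :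
    WeaklyTendsTo μ ν := by
  have := hν.1
  have := ExtBoundary.secondCountableTopology hT
  have hmeas : Measurable (Boundary.toExt (T := T)) := Boundary.continuous_toExt.measurable
  set ν' : ProbabilityMeasure (ExtBoundary T) :=
    ⟨ν.map Boundary.toExt, Measure.isProbabilityMeasure_map hmeas.aemeasurable⟩
  set μ' : ℕ → ProbabilityMeasure (ExtBoundary T) := fun n => ⟨μ n, hprob n⟩
  have hν' : ∀ v, ν'.1 (ExtBoundary.cyl v) = ν (Boundary.cyl v) := fun v => by
    rw [show ν'.1 = ν.map Boundary.toExt from rfl,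
      Measure.map_apply hmeas (ExtBoundary.isOpen_cyl v).measurableSet, Boundary.preimage_cyl]
  have hconv : Tendsto μ' atTop (𝓝 ν') := by
    refine ExtBoundary.isPiSystem_cyl.tendsto_probabilityMeasure_of_tendsto_of_mem ?_ ?_ ?_
    · rintro _ ⟨v, rfl⟩
      exact (ExtBoundary.isOpen_cyl v).measurableSet
    · intro U hU ρ hρ
      obtain ⟨v, hv, hvU⟩ := ExtBoundary.exists_cyl_subset hU ρ hρ
      exact ⟨_, ⟨v, rfl⟩, (ExtBoundary.isOpen_cyl v).mem_nhds hv, hvU⟩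
    · rintro _ ⟨v, rfl⟩
      rw [← NNReal.tendsto_coe]
      show Tendsto (fun n => (μ n).real (ExtBoundary.cyl v)) atTop
        (𝓝 (ν'.1 (ExtBoundary.cyl v)).toReal)
      rw [hν']
      by_cases h0 : v = ⊥
      · rw [h0, ExtBoundary.cyl_bot, Boundary.cyl_bot]
        simp
      · obtain ⟨e, rfl⟩ := exists_edge_tgt h0
        by_cases hl : IsLeaf e.tgt
        · rw [Boundary.cyl_eq_empty_of_isLeaf hl, measure_empty]
          exact tendsto_cyl_of_isLeaf (hT := hT) hθ hμ hl
        · rw [hν.2, ENNReal.toReal_ofReal (hθ.nonneg e)]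
          exact hμ e hl
  intro f
  have h1 := ProbabilityMeasure.tendsto_iff_forall_integral_tendsto.mp hconv f
  have h2 : ∫ s, f s ∂(ν' : Measure (ExtBoundary T)) = ∫ s, f s.toExt ∂ν :=
    integral_map hmeas.aemeasurable f.continuous.aestronglyMeasurable
  rw [h2] at h1
  exact h1

include hT in
theorem IsWeightingSequence.weaklyTendsTo (hℓ : ∀ e, 0 < ℓ e) (hwc : IsWeaklyComplete ℓ)
    {ω : ℕ → Edge T → ℕ} {x : ℕ → T} (h : IsWeightingSequence ℓ ω x) {η : Edge T → ℝ}
    (hη : IsUnitCurrentFlow ℓ η) {ν : Measure (Boundary T)} (hν : IsFlowMeasure η ν)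
    {μ : ℕ → Measure (ExtBoundary T)} (hμ : ∀ n, 1 ≤ n → IsConsistent ω n (μ n)) :
    WeaklyTendsTo μ ν := by
  -- the measure `μ 0` is irrelevant for the limit
  have key : WeaklyTendsTo (fun n => μ (max n 1)) ν := by
    refine weaklyTendsTo_of_cyl (hT := hT) hη.1.1 hν (fun n => (hμ _ (le_max_right _ _)).1)
      fun e hl => ?_
    refine (h.tendsto_normalizedWeight (hT := hT) hℓ hwc hη e).congr' ?_
    obtain ⟨f, hf⟩ := exists_child_of_not_isLeaf hl
    filter_upwards [h.eventually_ne_zero (hT := hT) hℓ e, h.eventually_ne_zero (hT := hT) hℓ f,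
      eventually_ge_atTop 1] with n he hfn hn
    rw [max_eq_left hn, measureReal_def, (hμ n hn).2 e (Or.inr ⟨e, rfl, he⟩)
      fun hc => hfn (hc f hf), ENNReal.toReal_ofReal]
    exact div_nonneg (Nat.cast_nonneg _) (Nat.cast_nonneg _)
  intro f
  refine (key f).congr' ?_
  filter_upwards [eventually_ge_atTop 1] with n hn
  rw [max_eq_left hn]

end TreeFactorial

namespace TreeFactorial
variable {T : RootedTree}
open scoped Classical

variable {hT : IsLocallyFinite T} {ℓ : Edge T → ℝ}

/-! ### Factorial-determining sequences -/

theorem exists_extBoundary_mem (v : T) : ∃ ρ : ExtBoundary T, v ∈ ρ.1 := by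
  by_cases hleaf : ∃ w, v ≤ w ∧ IsLeaf w
  · obtain ⟨w, hvw, hw⟩ := hleaf
    exact ⟨⟨Set.Iic w, Or.inr ⟨w, hw, rfl⟩⟩, hvw⟩
  push Not at hleaf
  have : Nonempty (Edge T) := ⟨(exists_child_of_not_isLeaf (hleaf v le_rfl)).choose⟩
  have hex : ∀ w, v ≤ w → ∃ e : Edge T, e.src = w := fun w hw =>
    exists_child_of_not_isLeaf (hleaf w hw)
  choose! c hc using hex
  set p : ℕ → T := fun n => Nat.rec v (fun _ w => (c w).tgt) n with hp
  have hlt : ∀ n, v ≤ p n ∧ p n < p (n + 1) := by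
    intro n
    induction n with
    | zero => exact ⟨le_rfl, (hc v le_rfl).symm.trans_lt (c v).src_lt_tgt⟩
    | succ n ih =>
      have h1 := ih.1.trans ih.2.le
      exact ⟨h1, (hc _ h1).symm.trans_lt (c (p (n + 1))).src_lt_tgt⟩
  have hmono : Monotone p := monotone_nat_of_le_succ fun n => (hlt n).2.le
  refine ⟨⟨{u | ∃ n, u ≤ p n}, Or.inl (isRay_iff.mpr ⟨⟨0, bot_le⟩, ?_, ?_, ?_⟩)⟩, ⟨0, le_rfl⟩⟩
  · rintro u w huw ⟨n, hn⟩
    exact ⟨n, huw.trans hn⟩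
  · rintro u ⟨n, hn⟩ w ⟨m, hm⟩
    exact le_total_of_le (hn.trans (hmono (le_max_left n m))) (hm.trans (hmono (le_max_right n m)))
  · rintro u ⟨n, hn⟩
    obtain ⟨e, he, hle⟩ := exists_child_le (hn.trans_lt (hlt n).2)
    exact ⟨e, he, n + 1, hle⟩

theorem ExtBoundary.ext_set {ρ τ : ExtBoundary T} (h : ρ.1 = τ.1) : ρ = τ := Subtype.ext h

theorem ExtBoundary.eq_of_isLeaf {ρ τ : ExtBoundary T} {v : T} (hv : IsLeaf v) (hρ : v ∈ ρ.1)
    (hτ : v ∈ τ.1) : ρ = τ :=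
  ExtBoundary.ext_set (Set.Subset.antisymm
    (fun _ hu => mem_of_le (subset_Iic_of_isLeaf hρ hv hu) hτ)
    (fun _ hu => mem_of_le (subset_Iic_of_isLeaf hτ hv hu) hρ))

/-- Distinct points of the extended boundary have only finitely many vertices in common. -/
theorem ExtBoundary.exists_inter_eq {ρ τ : ExtBoundary T} (hne : ρ ≠ τ) :
    ∃ m, ρ.1 ∩ τ.1 = Set.Iic m := by
  by_contra hcon
  have hchild : ∀ v ∈ ρ.1 ∩ τ.1, ∃ e : Edge T, e.src = v ∧ e.tgt ∈ ρ.1 ∩ τ.1 := by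
    intro v hv
    by_contra! hno
    refine hcon ⟨v, Set.Subset.antisymm (fun u hu => ?_) fun u hu =>
      ⟨mem_of_le hu hv.1, mem_of_le hu hv.2⟩⟩
    by_contra hle
    have hlt : v < u := ((le_total hu.1 hv.1).resolve_left hle).lt_of_not_ge hle
    obtain ⟨e, he, heu⟩ := exists_child_le hlt
    exact hno e he ⟨mem_of_le heu hu.1, mem_of_le heu hu.2⟩
  have hsub : ∀ {ρ τ : ExtBoundary T},
      (∀ v ∈ ρ.1 ∩ τ.1, ∃ e : Edge T, e.src = v ∧ e.tgt ∈ ρ.1 ∩ τ.1) → ρ.1 ⊆ τ.1 := by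
    intro ρ τ h v
    induction v using tree_induction with
    | bot => exact fun _ => τ.bot_mem
    | step e ih =>
      intro he
      have h1 := mem_of_le e.src_lt_tgt.le he
      obtain ⟨f, hf, hfm⟩ := h e.src ⟨h1, ih h1⟩
      rw [← eq_of_mem hf hfm.1 he]
      exact hfm.2
  exact hne (ExtBoundary.ext_set (Set.Subset.antisymm (hsub hchild)
    (hsub fun v hv => by
      obtain ⟨e, he, hm⟩ := hchild v ⟨hv.2, hv.1⟩
      exact ⟨e, he, hm.2, hm.1⟩)))

theorem ExtBoundary.mem_of_mem_strictPath {ρ : ExtBoundary T} {e f : Edge T} (he : e.tgt ∈ ρ.1)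
    (hf : f ∈ strictPath e) : f.tgt ∈ ρ.1 := by
  suffices H : ∀ v : T, ∀ f : Edge T, f.tgt = v → f ∈ strictPath e → f.tgt ∈ ρ.1 from
    H _ f rfl hf
  intro v
  induction v using tree_induction with
  | bot => exact fun f hf => absurd hf f.tgt_ne_bot
  | step g ih =>
    intro f hg hf
    obtain rfl := Edge.ext_tgt hg
    rcases hf.1.eq_or_lt with h' | h'
    · rwa [← h']
    · have h1 := Edge.le_src_iff.mpr h'
      obtain ⟨p, hp⟩ := exists_edge_tgt fun h0 => e.tgt_ne_bot (le_bot_iff.mp (h0 ▸ h1))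
      have hps := ih p hp (mem_strictPath_of_le hf (hp ▸ h1) (hp ▸ f.src_lt_tgt.le))
      obtain ⟨c, hc, hcρ⟩ := exists_child hps fun hl => hl f hp.symm
      have hcf : c = f := by
        by_contra hne
        exact hf.2 _ h1 f.src_lt_tgt ⟨c, f, hc.trans hp, rfl, hne⟩
      exact hcf ▸ hcρ

section PassCount

variable (ρ : ℕ → ExtBoundary T)

/-- The number of points among `ρ 0, …, ρ (n - 1)` that pass through the edge `e`. -/
noncomputable def passCount (n : ℕ) (e : Edge T) : ℕ :=
  ((Finset.range n).filter fun j => e.tgt ∈ (ρ j).1).card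

variable {ρ}

theorem passCount_ne_zero {n : ℕ} {e : Edge T} :
    passCount ρ n e ≠ 0 ↔ ∃ j < n, e.tgt ∈ (ρ j).1 := by
  simp [passCount, Finset.filter_eq_empty_iff]

theorem passCount_eq_zero {n : ℕ} {e : Edge T} :
    passCount ρ n e = 0 ↔ ∀ j < n, e.tgt ∉ (ρ j).1 := by
  simp [passCount, Finset.filter_eq_empty_iff]

theorem passCount_succ (n : ℕ) (e : Edge T) :
    passCount ρ (n + 1) e = passCount ρ n e + if e.tgt ∈ (ρ n).1 then 1 else 0 := by
  rw [passCount, Finset.range_add_one, Finset.filter_insert]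
  split_ifs
  · rw [Finset.card_insert_of_notMem (by simp)]; rfl
  · rfl

theorem eq_of_passCount_eq_one {n : ℕ} {e : Edge T} (h : passCount ρ n e = 1) {i j : ℕ}
    (hi : i < n) (hj : j < n) (hie : e.tgt ∈ (ρ i).1) (hje : e.tgt ∈ (ρ j).1) : i = j :=
  Finset.card_le_one.mp h.le i (by simpa using ⟨hi, hie⟩) j (by simpa using ⟨hj, hje⟩)

/-- If `τ` separates from `ρ 0, …, ρ (n - 1)` not later than at `x`, then the sum of its pairings is
the length of the path to `x` weighted by the pass counts. -/
theorem sum_pairing {n : ℕ} {τ : ExtBoundary T} {x : T} (hx : x ∈ τ.1)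
    (h : ∀ j < n, ∀ u ∈ τ.1, u ∈ (ρ j).1 → u ≤ x) :
    ∑ j ∈ Finset.range n, pairing ℓ τ (ρ j) = weightedLength ℓ (passCount ρ n) x := by
  have h1 : ∀ j ∈ Finset.range n, pairing ℓ τ (ρ j) =
      ∑ e ∈ pathEdges x, if e.tgt ∈ (ρ j).1 then ℓ e else 0 := by
    intro j hj
    rw [← Finset.sum_filter, pairing,
      ← finsum_mem_coe_finset (f := ℓ) (s := (pathEdges x).filter fun e => e.tgt ∈ (ρ j).1)]
    refine finsum_congr fun e => ?_
    have : (e.tgt ∈ τ.1 ∧ e.tgt ∈ (ρ j).1) =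
        (e ∈ (↑((pathEdges x).filter fun e => e.tgt ∈ (ρ j).1) : Set (Edge T))) := by
      simp only [Finset.coe_filter, mem_pathEdges, Set.mem_ofPred_eq, eq_iff_iff]
      exact and_congr_left fun he => ⟨fun h' => h j (Finset.mem_range.mp hj) _ h' he,
        fun h' => ExtBoundary.mem_of_le h' hx⟩
    rw [this]
  rw [Finset.sum_congr rfl h1, Finset.sum_comm, weightedLength_eq_pot]
  refine Finset.sum_congr rfl fun e _ => ?_
  rw [← Finset.sum_filter, Finset.sum_const, nsmul_eq_mul]
  rfl

/-- The last vertex at which `τ` meets one of the points `ρ 0, …, ρ (n - 1)`. -/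
theorem exists_last_common {n : ℕ} (hn : 1 ≤ n) {τ : ExtBoundary T} (hτ : ∀ j < n, τ ≠ ρ j) :
    ∃ x ∈ τ.1, (∃ j < n, x ∈ (ρ j).1) ∧ ∀ j < n, ∀ u ∈ τ.1, u ∈ (ρ j).1 → u ≤ x := by
  have hfin : {u | u ∈ τ.1 ∧ ∃ j < n, u ∈ (ρ j).1}.Finite := by
    refine ((Finset.range n).finite_toSet.biUnion (t := fun j => τ.1 ∩ (ρ j).1)
      fun j hj => ?_).subset ?_
    · obtain ⟨m, hm⟩ := ExtBoundary.exists_inter_eq (hτ j (by simpa using hj))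
      rw [hm]
      exact finite_Iic m
    · rintro u ⟨hu, j, hj, huj⟩
      exact Set.mem_biUnion (x := j) (by simpa using hj) ⟨hu, huj⟩
  obtain ⟨x, hx, hmax⟩ := hfin.exists_maximal ⟨⊥, τ.bot_mem, 0, hn, (ρ 0).bot_mem⟩
  refine ⟨x, hx.1, hx.2, fun j hj u hu huj => ?_⟩
  rcases ExtBoundary.le_total hu hx.1 with h | h
  · exact h
  · exact hmax ⟨hu, j, hj, huj⟩ h

end PassCount

/-- The weight function `ω` records the numbers of points among `ρ 0, …, ρ (n - 1)` that pass
through the weighted edges, and none of these points passes through an unweighted edge whose source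
has another, weighted edge to a child. -/
structure IsAdapted (hT : IsLocallyFinite T) (ρ : ℕ → ExtBoundary T) (n : ℕ) (ω : Edge T → ℕ) :
    Prop where
  partialWeighting : IsPartialWeighting hT ω n
  eq_passCount : ∀ e, ω e ≠ 0 → ω e = passCount ρ n e
  passCount_eq_zero : ∀ e : Edge T, ω e = 0 → ¬ IsClear ω e.src → passCount ρ n e = 0

namespace IsAdapted

variable {ρ : ℕ → ExtBoundary T} {n : ℕ} {ω : Edge T → ℕ} (h : IsAdapted hT ρ n ω)

include h

theorem weightedLength_eq {v : T} (hv : InTree ω v) :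
    weightedLength ℓ ω v = weightedLength ℓ (passCount ρ n) v := by
  rw [weightedLength_eq_pot, weightedLength_eq_pot]
  refine Finset.sum_congr rfl fun e he => ?_
  show (ω e : ℝ) * ℓ e = passCount ρ n e * ℓ e
  rw [h.eq_passCount e (h.partialWeighting.ne_zero_of_le hv (mem_pathEdges.mp he))]

theorem clear_eq_one (hn : 1 ≤ n) {x : T} (hx : InTree ω x) (hc : IsClear ω x) :
    ∃ a : Edge T, a.tgt = x ∧ passCount ρ n a = 1 ∧ (IsLeaf x ∨ IsBranching x) := by
  rcases hx with rfl | ⟨a, rfl, ha⟩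
  · exact absurd hc (h.partialWeighting.not_isClear_bot (by omega))
  · have := h.partialWeighting.clear a ha hc
    exact ⟨a, rfl, by rw [← h.eq_passCount a ha, this.1], this.2⟩

theorem exists_unused_child (hn : 1 ≤ n) {v : T} (hv : IsUnsaturated ω v) :
    ∃ e : Edge T, e.src = v ∧ passCount ρ n e = 0 := by
  obtain ⟨hin, e, he, h0⟩ := hv
  by_cases hc : IsClear ω v
  · obtain ⟨a, rfl, ha, hl⟩ := h.clear_eq_one hn hin hc
    obtain ⟨e₁, e₂, h1, h2, hne⟩ := hl.resolve_left fun hl => hl e he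
    by_contra! hcon
    obtain ⟨i, hi, hie⟩ := passCount_ne_zero.mp (hcon e₁ h1)
    obtain ⟨j, hj, hje⟩ := passCount_ne_zero.mp (hcon e₂ h2)
    have hij := eq_of_passCount_eq_one ha hi hj
      (ExtBoundary.mem_of_le (h1 ▸ e₁.src_lt_tgt.le) hie)
      (ExtBoundary.mem_of_le (h2 ▸ e₂.src_lt_tgt.le) hje)
    rw [hij] at hie
    exact hne (ExtBoundary.eq_of_mem (h1.trans h2.symm) hie hje)
  · exact ⟨e, he, h.passCount_eq_zero e h0 (he ▸ hc)⟩

/-- A new point can branch off at every unsaturated vertex. -/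
theorem exists_sum_pairing_eq (hn : 1 ≤ n) {v : T} (hv : IsUnsaturated ω v) :
    ∃ τ : ExtBoundary T, (∀ j < n, τ ≠ ρ j) ∧
      ∑ j ∈ Finset.range n, pairing ℓ τ (ρ j) = weightedLength ℓ ω v := by
  obtain ⟨e, rfl, he⟩ := h.exists_unused_child hn hv
  rw [TreeFactorial.passCount_eq_zero] at he
  obtain ⟨τ, hτ⟩ := exists_extBoundary_mem e.tgt
  refine ⟨τ, fun j hj heq => he j hj (heq ▸ hτ), ?_⟩
  rw [h.weightedLength_eq hv.1]
  refine sum_pairing (ExtBoundary.mem_of_le e.src_lt_tgt.le hτ) fun j hj u hu huj => ?_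
  by_contra hle
  rw [Edge.le_src_iff] at hle
  rcases ExtBoundary.le_total hu hτ with h1 | h1
  · rcases h1.eq_or_lt with h2 | h2
    · exact he j hj (h2 ▸ huj)
    · exact hle h2
  · exact he j hj (ExtBoundary.mem_of_le h1 huj)

/-- Adaptedness is preserved if the weighting follows the next point, which branches off at `x`
through the edge `e`. -/
theorem reweight {x : T} {e : Edge T} {S : Set (Edge T)} (hS : IsExtension hT ω x S)
    (he : e.src = x) (heS : strictPath e ⊆ S) (heρ : e.tgt ∈ (ρ n).1) (hωe : ω e = 0)
    (hlast : ∀ j < n, ∀ u ∈ (ρ n).1, u ∈ (ρ j).1 → u ≤ x)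
    (hother : ∀ c ∈ S, c ∉ strictPath e → ¬ e.tgt ≤ c.tgt ∧ passCount ρ n c = 1)
    (hfollow : ∀ c ∈ S, c ∉ strictPath e → ∀ j < n, c.src ∈ (ρ j).1 → c.tgt ∈ (ρ j).1)
    (hclear : IsClear ω x → ∀ a : Edge T, a.src = x → a ∉ S → passCount ρ n a = 0) :
    IsAdapted hT ρ (n + 1) (reweight ω x S) := by
  have hx : x ∈ (ρ n).1 := ExtBoundary.mem_of_le (he ▸ e.src_lt_tgt.le) heρ
  -- past `x` the new point runs below `e`, where nothing is weighted and no other point passes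
  have hpast : ∀ {a : Edge T}, ¬ a.tgt ≤ x → a.tgt ∈ (ρ n).1 → e.tgt ≤ a.tgt := by
    intro a hax haρ
    rcases ExtBoundary.le_total heρ haρ with h1 | h1
    · exact h1
    · rcases h1.eq_or_lt with h2 | h2
      · exact h2.symm.le
      · exact absurd (he ▸ Edge.le_src_iff.mpr h2) hax
  have hex : ¬ e.tgt ≤ x := (he ▸ e.src_lt_tgt).not_ge
  have hbelow : ∀ {v : T}, e.tgt ≤ v → ∀ j < n, v ∉ (ρ j).1 := fun {v} hv j hj hvj =>
    hex (hlast j hj _ heρ (ExtBoundary.mem_of_le hv hvj))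
  have hωbelow : ∀ {a : Edge T}, e.tgt ≤ a.tgt → ω a = 0 := fun ha =>
    Nat.le_zero.mp (hωe ▸ h.partialWeighting.antitone ha)
  refine ⟨h.partialWeighting.reweight hS, fun a ha => ?_, fun a ha hc => ?_⟩
  · rw [passCount_succ]
    by_cases haS : a ∈ S
    · rw [reweight_of_mem haS]
      by_cases hae : a ∈ strictPath e
      · rw [TreeFactorial.passCount_eq_zero.mpr fun j hj => hbelow hae.1 j hj,
          if_pos (ExtBoundary.mem_of_mem_strictPath heρ hae)]
      · have h1 := hother a haS hae
        rw [h1.2, if_neg fun haρ => h1.1 (hpast (hS.new.gt a haS).not_ge haρ)]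
    by_cases hax : a.tgt ≤ x
    · rw [reweight_of_le hS.new hax, if_pos (ExtBoundary.mem_of_le hax hx),
        h.eq_passCount a (h.partialWeighting.ne_zero_of_le hS.inTree hax)]
    · rw [reweight_of_not haS hax] at ha ⊢
      rw [if_neg fun haρ => ha (hωbelow (hpast hax haρ)), h.eq_passCount a ha, add_zero]
  · have haS : a ∉ S := fun haS => by rw [reweight_of_mem haS] at ha; omega
    have hax : ¬ a.tgt ≤ x := fun hax => by rw [reweight_of_le hS.new hax] at ha; omega
    have hωa : ω a = 0 := by rwa [reweight_of_not haS hax] at ha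
    unfold IsClear at hc
    push Not at hc
    obtain ⟨c, hca, hc⟩ := hc
    have hmem : ω c = 0 → c ∈ S := fun h0 => by
      by_contra hcS
      by_cases hcx : c.tgt ≤ x
      · exact h.partialWeighting.ne_zero_of_le hS.inTree hcx h0
      · rw [reweight_of_not hcS hcx] at hc
        exact hc h0
    -- the siblings of the edges of the strict path other than `e` lie below `e`
    have hdeep : c ∈ strictPath e → c ≠ e → e.tgt ≤ a.tgt := by
      intro hce hne
      have h1 : e.tgt < c.tgt := hce.1.lt_of_ne fun h' => hne (Edge.ext_tgt h'.symm)
      exact (hca ▸ Edge.le_src_iff.mpr h1).trans a.src_lt_tgt.le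
    rw [passCount_succ, if_neg, add_zero]
    · by_cases hcl : IsClear ω a.src
      · have hcS := hmem (hcl c hca)
        rw [TreeFactorial.passCount_eq_zero]
        intro j hj haj
        by_cases hce : c ∈ strictPath e
        · by_cases hne : c = e
          · have hax' : a.src = x := by rw [← hca, hne, he]
            exact TreeFactorial.passCount_eq_zero.mp
              (hclear (hax' ▸ hcl) a hax' haS) j hj haj
          · exact hbelow (hdeep hce hne) j hj haj
        · have h1 := hfollow c hcS hce j hj (hca ▸ ExtBoundary.mem_of_le a.src_lt_tgt.le haj)
          exact haS (ExtBoundary.eq_of_mem hca h1 haj ▸ hcS)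
      · exact h.passCount_eq_zero a hωa hcl
    · intro haρ
      have hea := hpast hax haρ
      have hne : e ≠ a := fun h' => haS (h' ▸ heS (mem_strictPath_self e))
      have h1 : e.tgt ≤ a.src := Edge.le_src_iff.mpr (hea.lt_of_ne fun h' => hne (Edge.ext_tgt h'))
      have hec : e.tgt ≤ c.tgt := h1.trans (hca ▸ c.src_lt_tgt.le)
      have hcS := hmem (hωbelow hec)
      by_cases hce : c ∈ strictPath e
      · exact haS (ExtBoundary.eq_of_mem hca (ExtBoundary.mem_of_mem_strictPath heρ hce) haρ ▸ hcS)
      · exact (hother c hcS hce).1 hec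

/-- The next point of a factorial-determining sequence determines a step of the weighting process. -/
theorem exists_step (hℓ : ∀ e, 0 < ℓ e) (hn : 1 ≤ n) (hρ : IsFactorialDetermining ℓ ρ) :
    ∃ x ω', IsWeightingStep ℓ ω x ω' ∧ IsAdapted hT ρ (n + 1) ω' ∧
      ∑ j ∈ Finset.range n, pairing ℓ (ρ n) (ρ j) = weightedLength ℓ ω x := by
  obtain ⟨x, hxρ, ⟨j, hj, hxj⟩, hlast⟩ := exists_last_common hn (hρ n).1
  have hcost := sum_pairing (ℓ := ℓ) hxρ hlast
  have hmin : ∀ v, IsUnsaturated ω v →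
      weightedLength ℓ (passCount ρ n) x ≤ weightedLength ℓ ω v := by
    intro v hv
    obtain ⟨τ, hτ, hτv⟩ := h.exists_sum_pairing_eq (ℓ := ℓ) hn hv
    rw [← hcost, ← hτv]
    exact (hρ n).2 τ hτ
  have hin : InTree ω x := by
    by_contra hout
    obtain ⟨y, ⟨hyx, hy⟩, hmax⟩ := ((finite_Iic x).subset (Set.inter_subset_left
      (t := {u | InTree ω u}))).exists_maximal ⟨⊥, bot_le, Or.inl rfl⟩
    have hlt : y < x := lt_of_le_of_ne hyx fun h' => hout (h' ▸ hy)
    obtain ⟨g, rfl, hgx⟩ := exists_child_le hlt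
    have hg0 : ω g = 0 := by
      by_contra hg
      exact absurd g.src_lt_tgt
        (hmax (y := g.tgt) ⟨hgx, Or.inr ⟨g, rfl, hg⟩⟩ g.src_lt_tgt.le).not_gt
    have hgn : passCount ρ n g ≠ 0 :=
      passCount_ne_zero.mpr ⟨j, hj, ExtBoundary.mem_of_le hgx hxj⟩
    have h1 := hmin g.src ⟨hy, g, rfl, hg0⟩
    rw [h.weightedLength_eq hy] at h1
    have h2 := weightedLength_mono_right hℓ (passCount ρ n) hgx
    rw [weightedLength_tgt] at h2
    have h3 : 0 < (passCount ρ n g : ℝ) * ℓ g :=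
      mul_pos (by exact_mod_cast Nat.pos_of_ne_zero hgn) (hℓ g)
    linarith
  have hnl : ¬ IsLeaf x := fun hl => (hρ n).1 j hj (ExtBoundary.eq_of_isLeaf hl hxρ hxj)
  obtain ⟨e, he, heρ⟩ := ExtBoundary.exists_child hxρ hnl
  have hex : ¬ e.tgt ≤ x := (he ▸ e.src_lt_tgt).not_ge
  have hNe : passCount ρ n e = 0 :=
    TreeFactorial.passCount_eq_zero.mpr fun i hi hei => hex (hlast i hi _ heρ hei)
  have hωe : ω e = 0 := by
    by_contra h0
    exact h0 ((h.eq_passCount e h0).trans hNe)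
  have hunsat : IsUnsaturated ω x := ⟨hin, e, he, hωe⟩
  have hmin' : ∀ v, IsUnsaturated ω v → weightedLength ℓ ω x ≤ weightedLength ℓ ω v := by
    rw [h.weightedLength_eq hin]
    exact hmin
  have hfinal := hcost.trans (h.weightedLength_eq hin).symm
  by_cases hc : IsClear ω x
  · obtain ⟨a, rfl, ha, -⟩ := h.clear_eq_one hn hin hc
    obtain ⟨f, hf, hfρ⟩ := ExtBoundary.exists_child hxj hnl
    have hne : e ≠ f := fun h' =>
      TreeFactorial.passCount_eq_zero.mp hNe j hj (h'.symm ▸ hfρ)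
    have huniq : ∀ i < n, a.tgt ∈ (ρ i).1 → f.tgt ∈ (ρ i).1 := fun i hi hai => by
      rw [eq_of_passCount_eq_one ha hi hj hai hxj]
      exact hfρ
    have hcount : ∀ c ∈ strictPath f, passCount ρ n c = 1 := by
      intro c hcf
      rw [← ha]
      refine congrArg Finset.card (Finset.filter_congr fun i hi => ?_)
      refine ⟨fun hci => ExtBoundary.mem_of_le ?_ hci, fun hai =>
        ExtBoundary.mem_of_mem_strictPath (huniq i (by simpa using hi) hai) hcf⟩
      exact (hf ▸ f.src_lt_tgt.le).trans hcf.1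
    refine ⟨a.tgt, _, ⟨hunsat, hmin', Or.inr ⟨hc, e, f, he, hf, hne, rfl⟩⟩, ?_, hfinal⟩
    refine h.reweight (isExtension_two hT h.partialWeighting.antitone hin a.tgt_ne_bot hc he hf hne)
      he Set.subset_union_left heρ hωe hlast ?_ ?_ ?_
    · intro c hcS hce
      have hcf := hcS.resolve_left hce
      exact ⟨fun h' => hne (Edge.eq_of_le_of_le (he.trans hf.symm) h' hcf.1), hcount c hcf⟩
    · intro c hcS hce i hi hci
      have hcf := hcS.resolve_left hce
      have hac : a.tgt ≤ c.src := Edge.le_src_iff.mpr ((hf ▸ f.src_lt_tgt).trans_le hcf.1)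
      exact ExtBoundary.mem_of_mem_strictPath
        (huniq i hi (ExtBoundary.mem_of_le hac hci)) hcf
    · intro _ b hb hbS
      rw [TreeFactorial.passCount_eq_zero]
      intro i hi hbi
      have hfi := huniq i hi (ExtBoundary.mem_of_le (hb ▸ b.src_lt_tgt.le) hbi)
      exact hbS (Or.inr (ExtBoundary.eq_of_mem (hf.trans hb.symm) hfi hbi ▸ mem_strictPath_self f))
  · refine ⟨x, _, ⟨hunsat, hmin', Or.inl ⟨hc, e, he, hωe, rfl⟩⟩, ?_, hfinal⟩
    exact h.reweight (isExtension_one hT h.partialWeighting.antitone hin (Or.inr hc) he hωe) he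
      subset_rfl heρ hωe hlast (fun c hcS hce => absurd hcS hce) (fun c hcS hce => absurd hcS hce)
      fun hc' => absurd hc' hc

end IsAdapted

/-- Every factorial-determining sequence comes from a weighting sequence. -/
theorem IsFactorialDetermining.exists_isWeightingSequence (hT : IsLocallyFinite T)
    (hbot : ¬ IsLeaf (⊥ : T)) (hℓ : ∀ e, 0 < ℓ e) {ρ : ℕ → ExtBoundary T}
    (hρ : IsFactorialDetermining ℓ ρ) :
    ∃ ω x, IsWeightingSequence ℓ ω x ∧ ∀ n, 1 ≤ n → IsAdapted hT ρ n (ω n) ∧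
      ∑ j ∈ Finset.range n, pairing ℓ (ρ n) (ρ j) = weightedLength ℓ (ω n) (x n) := by
  refine exists_isWeightingSequence_of_step (fun n ω => IsAdapted hT ρ n ω)
    (fun n ω x => ∑ j ∈ Finset.range n, pairing ℓ (ρ n) (ρ j) = weightedLength ℓ ω x) ?_
    fun n hn ω hω => hω.exists_step hℓ hn hρ
  obtain ⟨e, he, heρ⟩ := ExtBoundary.exists_child (ρ 0).bot_mem hbot
  have h0 : IsPartialWeighting hT (0 : Edge T → ℕ) 0 := isPartialWeighting_zero
  have hadapt : IsAdapted hT ρ 0 (0 : Edge T → ℕ) :=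
    ⟨h0, fun e he => absurd rfl he, fun e _ _ => by simp [passCount]⟩
  refine ⟨e, he, ?_⟩
  exact hadapt.reweight (isExtension_one hT h0.antitone (Or.inl rfl) (Or.inl rfl) he rfl) he
    subset_rfl heρ rfl (fun j hj => absurd hj (Nat.not_lt_zero j)) (fun c hcS hce => absurd hcS hce)
    (fun c hcS hce => absurd hcS hce) fun _ a _ _ => by simp [passCount]

/-- The empirical measures of an adapted sequence of points are consistent with the weighting. -/
theorem IsAdapted.isConsistent {ρ : ℕ → ExtBoundary T} {ω : ℕ → Edge T → ℕ} {n : ℕ} (hn : 1 ≤ n)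
    (h : IsAdapted hT ρ n (ω n)) :
    IsConsistent ω n ((n : ENNReal)⁻¹ • ∑ j ∈ Finset.range n, Measure.dirac (ρ j)) := by
  have hn0 : (n : ENNReal) ≠ 0 := Nat.cast_ne_zero.mpr (by omega)
  have hcyl : ∀ v, ((n : ENNReal)⁻¹ • ∑ j ∈ Finset.range n, Measure.dirac (ρ j))
      (ExtBoundary.cyl v) = (n : ENNReal)⁻¹ *
        (((Finset.range n).filter fun j => v ∈ (ρ j).1).card : ENNReal) := by
    intro v
    rw [Measure.smul_apply, Measure.finsetSum_apply, smul_eq_mul, Finset.card_filter, Nat.cast_sum]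
    congr 1
    refine Finset.sum_congr rfl fun j _ => ?_
    rw [Measure.dirac_apply' _ (ExtBoundary.isOpen_cyl v).measurableSet, Set.indicator_apply]
    by_cases hv : v ∈ (ρ j).1
    · rw [if_pos (show ρ j ∈ ExtBoundary.cyl v from hv), if_pos hv]; simp
    · rw [if_neg (show ρ j ∉ ExtBoundary.cyl v from hv), if_neg hv]; simp
  refine ⟨⟨?_⟩, fun e hin hc => ?_⟩
  · rw [← ExtBoundary.cyl_bot, hcyl, Finset.filter_true_of_mem fun j _ => (ρ j).bot_mem,
      Finset.card_range, ENNReal.inv_mul_cancel hn0 (ENNReal.natCast_ne_top n)]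
  · rw [hcyl, normalizedWeight,
      h.eq_passCount e (h.partialWeighting.ne_zero_of_le hin le_rfl),
      ENNReal.ofReal_div_of_pos (by exact_mod_cast hn), ENNReal.ofReal_natCast,
      ENNReal.ofReal_natCast, mul_comm, ENNReal.div_eq_inv_mul, mul_comm]
    rfl

theorem IsFactorialDetermining.isEquidistributed (hT : IsLocallyFinite T) (hℓ : ∀ e, 0 < ℓ e)
    (hwc : IsWeaklyComplete ℓ) {ρ : ℕ → ExtBoundary T} (hρ : IsFactorialDetermining ℓ ρ)
    (hbot : ¬ IsLeaf (⊥ : T)) {η : Edge T → ℝ} (hη : IsUnitCurrentFlow ℓ η)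
    {ν : Measure (Boundary T)} (hν : IsFlowMeasure η ν) : IsEquidistributed ρ ν := by
  obtain ⟨ω, x, hω, hadapt⟩ := hρ.exists_isWeightingSequence hT hbot hℓ
  have key := hω.weaklyTendsTo (hT := hT) hℓ hwc hη hν
    fun n hn => (hadapt n hn).1.isConsistent hn
  intro f
  refine (key f).congr fun n => ?_
  have hint : ∀ j ∈ Finset.range n, Integrable f (Measure.dirac (ρ j)) := fun j _ => f.integrable _
  rw [integral_smul_measure, integral_finsetSum_measure hint, ENNReal.toReal_inv,
    ENNReal.toReal_natCast, smul_eq_mul, div_eq_inv_mul]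
  congr 1
  have := ExtBoundary.secondCountableTopology hT
  exact Finset.sum_congr rfl fun j _ =>
    integral_dirac' _ _ f.continuous.stronglyMeasurable

end TreeFactorial

namespace TreeFactorial
variable {T : RootedTree}
open scoped Classical

/-! ### Transience yields a unit flow of finite energy -/

variable (hT : IsLocallyFinite T) (ℓ : Edge T → ℝ)

include hT in
theorem finite_incident (u : T) : {e : Edge T | e.src = u ∨ e.tgt = u}.Finite :=
  (hT u).union (Set.Subsingleton.finite fun _ he _ hf => Edge.ext_tgt (he.trans hf.symm))

/-- The edges that have `u` as an end-point. -/
noncomputable def incidentEdges (u : T) : Finset (Edge T) := (finite_incident hT u).toFinset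

theorem mem_incidentEdges {u : T} {e : Edge T} :
    e ∈ incidentEdges hT u ↔ e.src = u ∨ e.tgt = u := by
  simp [incidentEdges]

/-- The end-point of `e` different from `u`, for an edge `e` that has `u` as an end-point. -/
noncomputable def Edge.other (u : T) (e : Edge T) : T := if e.src = u then e.tgt else e.src

theorem Edge.other_src (e : Edge T) : e.other e.src = e.tgt := if_pos rfl

theorem Edge.other_tgt (e : Edge T) : e.other e.tgt = e.src := if_neg e.src_lt_tgt.ne

theorem Edge.joins_iff {e : Edge T} {u v : T} :
    e.Joins u v ↔ e ∈ incidentEdges hT u ∧ e.other u = v := by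
  rw [mem_incidentEdges]
  constructor
  · rintro (⟨rfl, rfl⟩ | ⟨rfl, rfl⟩)
    · exact ⟨Or.inl rfl, e.other_src⟩
    · exact ⟨Or.inr rfl, e.other_tgt⟩
  · rintro ⟨rfl | rfl, rfl⟩
    · exact Or.inl ⟨rfl, e.other_src.symm⟩
    · exact Or.inr ⟨e.other_tgt.symm, rfl⟩

theorem incidentEdges_bot : incidentEdges hT ⊥ = childEdges hT ⊥ := by
  ext e
  simp [mem_incidentEdges, e.tgt_ne_bot]

theorem sum_incidentEdges_tgt (e : Edge T) (g : Edge T → ℝ) :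
    ∑ f ∈ incidentEdges hT e.tgt, g f = g e + ∑ f ∈ childEdges hT e.tgt, g f := by
  have : incidentEdges hT e.tgt = insert e (childEdges hT e.tgt) := by
    ext f
    rw [mem_incidentEdges, Finset.mem_insert, mem_childEdges, or_comm]
    exact or_congr_left ⟨Edge.ext_tgt, congrArg Edge.tgt⟩
  rw [this, Finset.sum_insert]
  simpa using e.src_lt_tgt.ne

/-- The total conductance of the edges at `u`. -/
noncomputable def totalConductance (u : T) : ℝ := ∑ e ∈ incidentEdges hT u, (ℓ e)⁻¹

/-- The average of `g` over the neighbours of `u`, weighted by the conductances: the expectation of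
`g` after one step of the random walk from `u`. -/
noncomputable def walkAverage (g : T → ℝ) (u : T) : ℝ :=
  (∑ e ∈ incidentEdges hT u, (ℓ e)⁻¹ * g (e.other u)) / totalConductance hT ℓ u

theorem transitionProb_eq (u v : T) :
    transitionProb ℓ u v =
      (∑ e ∈ incidentEdges hT u, if e.other u = v then (ℓ e)⁻¹ else 0) /
        totalConductance hT ℓ u := by
  unfold transitionProb totalConductance
  congr 1
  · rw [← Finset.sum_filter, ← finsum_mem_finset_eq_sum]
    refine finsum_congr fun e => ?_
    have : e.Joins u v ↔ e ∈ (incidentEdges hT u).filter fun e => e.other u = v := by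
      rw [Finset.mem_filter, Edge.joins_iff hT]
    simp only [this]
  · exact finsum_mem_eq_finite_toFinset_sum _ (finite_incident hT u)

variable {ℓ} (hℓ : ∀ e, 0 < ℓ e)

include hℓ

theorem totalConductance_nonneg (u : T) : 0 ≤ totalConductance hT ℓ u :=
  Finset.sum_nonneg fun e _ => (inv_pos.mpr (hℓ e)).le

theorem totalConductance_tgt_pos (e : Edge T) : 0 < totalConductance hT ℓ e.tgt :=
  Finset.sum_pos (fun e _ => inv_pos.mpr (hℓ e)) ⟨e, (mem_incidentEdges hT).mpr (Or.inr rfl)⟩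

include hT in
theorem transitionProb_nonneg (u v : T) : 0 ≤ transitionProb ℓ u v := by
  rw [transitionProb_eq hT]
  refine div_nonneg (Finset.sum_nonneg fun e _ => ?_) (totalConductance_nonneg hT hℓ u)
  split_ifs
  · exact (inv_pos.mpr (hℓ e)).le
  · exact le_rfl

omit hℓ in
theorem transitionProb_eq_zero {u v : T} (h : v ∉ (incidentEdges hT u).image (Edge.other u)) :
    transitionProb ℓ u v = 0 := by
  rw [transitionProb_eq hT, Finset.sum_eq_zero, zero_div]
  intro e he
  exact if_neg fun h' => h (Finset.mem_image.mpr ⟨e, he, h'⟩)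

omit hℓ in
theorem sum_transitionProb_mul (g : T → ℝ) (u : T) :
    ∑ v ∈ (incidentEdges hT u).image (Edge.other u), transitionProb ℓ u v * g v =
      walkAverage hT ℓ g u := by
  simp only [transitionProb_eq hT, walkAverage, div_mul_eq_mul_div]
  rw [← Finset.sum_div]
  congr 1
  simp only [Finset.sum_mul, ite_mul, zero_mul]
  rw [Finset.sum_comm]
  refine Finset.sum_congr rfl fun e he => ?_
  rw [Finset.sum_ite_eq, if_pos (Finset.mem_image_of_mem _ he)]

theorem walkAverage_mono {g g' : T → ℝ} (h : g ≤ g') :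
    walkAverage hT ℓ g ≤ walkAverage hT ℓ g' := fun u =>
  div_le_div_of_nonneg_right
    (Finset.sum_le_sum fun e _ => mul_le_mul_of_nonneg_left (h _) (inv_pos.mpr (hℓ e)).le)
    (totalConductance_nonneg hT hℓ u)

omit hℓ in
theorem walkAverage_one_le : walkAverage hT ℓ 1 ≤ 1 := fun u => by
  simp only [walkAverage, Pi.one_apply, mul_one]
  exact div_self_le_one _

omit hℓ in
theorem walkAverage_zero : walkAverage hT ℓ 0 = 0 := by
  ext u; simp [walkAverage]

omit hℓ

variable (ℓ)

/-- The probability that the random walk started at `v` avoids the root at the times `0, …, M`. -/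
noncomputable def avoidProb : ℕ → T → ℝ
  | 0, v => if v = ⊥ then 0 else 1
  | M + 1, v => if v = ⊥ then 0 else walkAverage hT ℓ (avoidProb M) v

variable {ℓ}

theorem avoidProb_bot (M : ℕ) : avoidProb hT ℓ M ⊥ = 0 := by
  cases M <;> simp [avoidProb]

theorem avoidProb_succ (M : ℕ) {v : T} (hv : v ≠ ⊥) :
    avoidProb hT ℓ (M + 1) v = walkAverage hT ℓ (avoidProb hT ℓ M) v := by
  simp [avoidProb, hv]

include hℓ

theorem avoidProb_nonneg (M : ℕ) (v : T) : 0 ≤ avoidProb hT ℓ M v := by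
  induction M generalizing v with
  | zero => unfold avoidProb; split_ifs <;> norm_num
  | succ M ih =>
    unfold avoidProb
    split_ifs
    · exact le_rfl
    · have := walkAverage_mono hT hℓ (g := 0) ih v
      rwa [walkAverage_zero] at this

theorem avoidProb_succ_le (M : ℕ) (v : T) :
    avoidProb hT ℓ (M + 1) v ≤ avoidProb hT ℓ M v := by
  by_cases hv : v = ⊥
  · rw [hv, avoidProb_bot, avoidProb_bot]
  induction M generalizing v with
  | zero =>
    rw [avoidProb_succ hT 0 hv]
    have h0 : avoidProb hT ℓ 0 ≤ 1 := fun w => by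
      unfold avoidProb; split_ifs <;> norm_num
    refine ((walkAverage_mono hT hℓ h0).trans (walkAverage_one_le hT) v).trans ?_
    simp [avoidProb, hv]
  | succ M ih =>
    rw [avoidProb_succ hT _ hv, avoidProb_succ hT _ hv]
    refine walkAverage_mono hT hℓ (fun w => ?_) v
    by_cases hw : w = ⊥
    · rw [hw, avoidProb_bot, avoidProb_bot]
    · exact ih w hw

theorem avoidProb_antitone (v : T) : Antitone fun M => avoidProb hT ℓ M v :=
  antitone_nat_of_succ_le fun M => avoidProb_succ_le hT hℓ M v

theorem avoidProb_le_one (M : ℕ) (v : T) : avoidProb hT ℓ M v ≤ 1 := by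
  refine (avoidProb_antitone hT hℓ v (Nat.zero_le M)).trans ?_
  show avoidProb hT ℓ 0 v ≤ 1
  unfold avoidProb; split_ifs <;> norm_num

/-- The farther from the root the walk starts, the more likely it avoids the root. -/
theorem avoidProb_src_le_tgt (M : ℕ) (e : Edge T) :
    avoidProb hT ℓ M e.src ≤ avoidProb hT ℓ M e.tgt := by
  induction M generalizing e with
  | zero => simp only [avoidProb, e.tgt_ne_bot, if_false]; split_ifs <;> norm_num
  | succ M ih =>
    refine (avoidProb_succ_le hT hℓ M e.src).trans ?_
    rw [avoidProb_succ hT M e.tgt_ne_bot, walkAverage,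
      le_div_iff₀ (totalConductance_tgt_pos hT hℓ e), totalConductance, Finset.mul_sum]
    refine Finset.sum_le_sum fun f hf => ?_
    rw [mul_comm]
    refine mul_le_mul_of_nonneg_left ?_ (inv_pos.mpr (hℓ f)).le
    rcases (mem_incidentEdges hT).mp hf with h | h
    · rw [← h, f.other_src]
      exact (ih e).trans (h ▸ ih f)
    · rw [← h, f.other_tgt, Edge.ext_tgt h]

omit hℓ in
variable (ℓ) in
/-- The probability that the random walk started at `v` never visits the root, as the limit of the
probabilities that it does not do so in the first steps. -/
noncomputable def escapeProb (v : T) : ℝ := ⨅ M, avoidProb hT ℓ M v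

theorem tendsto_avoidProb (v : T) :
    Tendsto (fun M => avoidProb hT ℓ M v) atTop (𝓝 (escapeProb hT ℓ v)) :=
  tendsto_atTop_ciInf (avoidProb_antitone hT hℓ v)
    ⟨0, by rintro _ ⟨M, rfl⟩; exact avoidProb_nonneg hT hℓ M v⟩

theorem tendsto_walkAverage_avoidProb (v : T) :
    Tendsto (fun M => walkAverage hT ℓ (avoidProb hT ℓ M) v) atTop
      (𝓝 (walkAverage hT ℓ (escapeProb hT ℓ) v)) :=
  (tendsto_finsetSum _ fun e _ => (tendsto_avoidProb hT hℓ (e.other v)).const_mul _).div_const _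

omit hℓ in
theorem escapeProb_bot : escapeProb hT ℓ ⊥ = 0 := by
  simp [escapeProb, avoidProb_bot]

theorem escapeProb_harmonic {v : T} (hv : v ≠ ⊥) :
    escapeProb hT ℓ v = walkAverage hT ℓ (escapeProb hT ℓ) v := by
  refine tendsto_nhds_unique ((tendsto_avoidProb hT hℓ v).comp (tendsto_add_atTop_nat 1)) ?_
  simpa only [Function.comp_def, avoidProb_succ hT _ hv] using tendsto_walkAverage_avoidProb hT hℓ v

theorem escapeProb_le_one (v : T) : escapeProb hT ℓ v ≤ 1 :=
  le_of_tendsto' (tendsto_avoidProb hT hℓ v) fun M => avoidProb_le_one hT hℓ M v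

theorem escapeProb_src_le_tgt (e : Edge T) : escapeProb hT ℓ e.src ≤ escapeProb hT ℓ e.tgt :=
  le_of_tendsto_of_tendsto' (tendsto_avoidProb hT hℓ _) (tendsto_avoidProb hT hℓ _) fun M =>
    avoidProb_src_le_tgt hT hℓ M e

omit hℓ in
variable (ℓ) in
/-- The current through the edge `e` when the vertices have the potential `escapeProb`. -/
noncomputable def escapeCurrent (e : Edge T) : ℝ :=
  (ℓ e)⁻¹ * (escapeProb hT ℓ e.tgt - escapeProb hT ℓ e.src)

theorem escapeCurrent_nonneg (e : Edge T) : 0 ≤ escapeCurrent hT ℓ e :=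
  mul_nonneg (inv_pos.mpr (hℓ e)).le (sub_nonneg.mpr (escapeProb_src_le_tgt hT hℓ e))

theorem escapeCurrent_conserve (e : Edge T) :
    escapeCurrent hT ℓ e = ∑ f ∈ childEdges hT e.tgt, escapeCurrent hT ℓ f := by
  have h := escapeProb_harmonic hT hℓ e.tgt_ne_bot
  rw [walkAverage, eq_div_iff (totalConductance_tgt_pos hT hℓ e).ne', totalConductance,
    Finset.mul_sum, ← sub_eq_zero, ← Finset.sum_sub_distrib, sum_incidentEdges_tgt,
    e.other_tgt] at h
  have h2 : ∑ f ∈ childEdges hT e.tgt, escapeCurrent hT ℓ f = -∑ f ∈ childEdges hT e.tgt,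
      (escapeProb hT ℓ e.tgt * (ℓ f)⁻¹ - (ℓ f)⁻¹ * escapeProb hT ℓ (f.other e.tgt)) := by
    rw [← Finset.sum_neg_distrib]
    refine Finset.sum_congr rfl fun f hf => ?_
    rw [mem_childEdges] at hf
    rw [escapeCurrent, ← hf, f.other_src]
    ring
  rw [h2, escapeCurrent]
  linear_combination h

omit hℓ in
theorem sum_escapeCurrent_bot :
    ∑ f ∈ childEdges hT ⊥, escapeCurrent hT ℓ f =
      ∑ e ∈ incidentEdges hT ⊥, (ℓ e)⁻¹ * escapeProb hT ℓ (e.other ⊥) := by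
  rw [incidentEdges_bot]
  refine Finset.sum_congr rfl fun f hf => ?_
  rw [mem_childEdges] at hf
  rw [escapeCurrent, hf, escapeProb_bot hT, sub_zero, ← hf, f.other_src]

/-- On a finite subtree, the energy of the escape current is the flow through the exits weighted by
the potential, which is at most one. -/
theorem sum_energy_escapeCurrent_le (s : Finset (Edge T)) :
    ∑ e ∈ s, ℓ e * escapeCurrent hT ℓ e ^ 2 ≤ ∑ f ∈ childEdges hT ⊥, escapeCurrent hT ℓ f := by
  set D := s.biUnion fun e => pathEdges e.tgt with hDdef
  have hD : IsLowerEdges D := by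
    intro e f hef hf
    obtain ⟨g, hg, hfg⟩ := Finset.mem_biUnion.mp hf
    exact Finset.mem_biUnion.mpr ⟨g, hg, mem_pathEdges.mpr (hef.trans (mem_pathEdges.mp hfg))⟩
  have hcons : ∀ e ∈ D, escapeCurrent hT ℓ e = ∑ f ∈ childEdges hT e.tgt, escapeCurrent hT ℓ f :=
    fun e _ => escapeCurrent_conserve hT hℓ e
  have hsD : s ⊆ D := fun e he => Finset.mem_biUnion.mpr ⟨e, he, mem_pathEdges.mpr le_rfl⟩
  calc ∑ e ∈ s, ℓ e * escapeCurrent hT ℓ e ^ 2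
      ≤ ∑ e ∈ D, ℓ e * escapeCurrent hT ℓ e ^ 2 :=
        Finset.sum_le_sum_of_subset_of_nonneg hsD fun e _ _ =>
          mul_nonneg (hℓ e).le (sq_nonneg _)
    _ = ∑ e ∈ D, escapeCurrent hT ℓ e * (escapeProb hT ℓ e.tgt - escapeProb hT ℓ e.src) := by
        refine Finset.sum_congr rfl fun e _ => ?_
        have := (hℓ e).ne'
        rw [escapeCurrent]
        field_simp
    _ = ∑ f ∈ exitEdges hT D, escapeCurrent hT ℓ f * escapeProb hT ℓ f.src := by
        rw [sum_exitEdges hT hD hcons, escapeProb_bot hT, zero_mul, zero_add]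
    _ ≤ ∑ f ∈ exitEdges hT D, escapeCurrent hT ℓ f :=
        Finset.sum_le_sum fun f _ =>
          mul_le_of_le_one_right (escapeCurrent_nonneg hT hℓ f) (escapeProb_le_one hT hℓ _)
    _ = _ := sum_exitEdges_one hT hD hcons

/-- If the walk does not surely return to the root, the escape current is a multiple of a unit flow
of finite energy. -/
theorem exists_isBoundedUnitFlow_of_walkAverage_ne_zero
    (h : walkAverage hT ℓ (escapeProb hT ℓ) ⊥ ≠ 0) : ∃ θ, IsBoundedUnitFlow ℓ θ := by
  set q := ∑ f ∈ childEdges hT ⊥, escapeCurrent hT ℓ f with hq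
  have hq0 : q ≠ 0 := by
    rw [hq, sum_escapeCurrent_bot hT]
    exact (div_ne_zero_iff.mp h).1
  have hqpos : 0 < q :=
    lt_of_le_of_ne (Finset.sum_nonneg fun f _ => escapeCurrent_nonneg hT hℓ f) hq0.symm
  refine ⟨fun e => escapeCurrent hT ℓ e / q, ⟨fun e =>
    div_nonneg (escapeCurrent_nonneg hT hℓ e) hqpos.le, fun e => ?_, ?_⟩, ?_⟩
  · rw [finsum_childEdges hT, ← Finset.sum_div, ← escapeCurrent_conserve hT hℓ]
  · rw [finsum_childEdges hT, ← Finset.sum_div, ← hq, div_self hq0]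
  · have : Summable fun e => ℓ e * escapeCurrent hT ℓ e ^ 2 :=
      summable_of_sum_le (fun e => mul_nonneg (hℓ e).le (sq_nonneg _))
        (sum_energy_escapeCurrent_le hT hℓ)
    simpa only [div_pow, mul_div_assoc] using this.div_const (q ^ 2)

/-- A bound for the probability that the walk starts with the path `x 0, …, x n` and then avoids the
root during the next `M + 1` steps.  Only the probabilities of finite paths are used, not the Markov
property for infinite trajectories. -/
theorem IsRandomWalkLaw.measure_avoid_le {P : Measure (ℕ → T)} (hP : IsRandomWalkLaw ℓ P) (M : ℕ) :
    ∀ (n : ℕ) (x : ℕ → T), x 0 = ⊥ →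
      P {X | (∀ i ≤ n, X i = x i) ∧ ∀ m, n < m → m ≤ n + (M + 1) → X m ≠ ⊥} ≤
        ENNReal.ofReal ((∏ i ∈ Finset.range n, transitionProb ℓ (x i) (x (i + 1))) *
          walkAverage hT ℓ (avoidProb hT ℓ M) (x n)) := by
  have hcount := countable_vertex hT
  -- the event is decomposed according to the position `w` after the next step
  have key : ∀ (M : ℕ) (F : ℕ → (ℕ → T) → Set (ℕ → T)),
      (∀ n x, x 0 = ⊥ → ∀ w, w ≠ ⊥ →
        P (F n x ∩ {X | X (n + 1) = w}) ≤
          ENNReal.ofReal ((∏ i ∈ Finset.range n, transitionProb ℓ (x i) (x (i + 1))) *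
            (transitionProb ℓ (x n) w * avoidProb hT ℓ M w))) →
      (∀ n x, ∀ X ∈ F n x, X (n + 1) ≠ ⊥) → ∀ n x, x 0 = ⊥ →
        P (F n x) ≤ ENNReal.ofReal ((∏ i ∈ Finset.range n, transitionProb ℓ (x i) (x (i + 1))) *
          walkAverage hT ℓ (avoidProb hT ℓ M) (x n)) := by
    intro M F hF hne n x hx
    have hprod : 0 ≤ ∏ i ∈ Finset.range n, transitionProb ℓ (x i) (x (i + 1)) :=
      Finset.prod_nonneg fun i _ => transitionProb_nonneg hT hℓ _ _
    calc P (F n x) ≤ P (⋃ w, F n x ∩ {X | X (n + 1) = w}) :=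
          measure_mono fun X hX => Set.mem_iUnion.mpr ⟨X (n + 1), hX, rfl⟩
      _ ≤ ∑' w, P (F n x ∩ {X | X (n + 1) = w}) := measure_iUnion_le _
      _ ≤ ∑' w, ENNReal.ofReal ((∏ i ∈ Finset.range n, transitionProb ℓ (x i) (x (i + 1))) *
            (transitionProb ℓ (x n) w * avoidProb hT ℓ M w)) := by
          refine ENNReal.tsum_le_tsum fun w => ?_
          by_cases hw : w = ⊥
          · have : F n x ∩ {X | X (n + 1) = w} = ∅ :=
              Set.eq_empty_of_forall_notMem fun X hX => hne n x X hX.1 (hX.2.trans hw)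
            rw [this, measure_empty]
            exact zero_le
          · exact hF n x hx w hw
      _ = _ := by
          rw [tsum_eq_sum (s := (incidentEdges hT (x n)).image (Edge.other (x n)))]
          · rw [← ENNReal.ofReal_sum_of_nonneg fun w _ => mul_nonneg hprod
              (mul_nonneg (transitionProb_nonneg hT hℓ _ _) (avoidProb_nonneg hT hℓ M w)),
              ← Finset.mul_sum, sum_transitionProb_mul]
          · intro w hw
            rw [transitionProb_eq_zero hT hw, zero_mul, mul_zero, ENNReal.ofReal_zero]
  have hupd : ∀ (n : ℕ) (x : ℕ → T) (w : T),
      ∏ i ∈ Finset.range (n + 1), transitionProb ℓ (if i ≤ n then x i else w)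
        (if i + 1 ≤ n then x (i + 1) else w) =
      (∏ i ∈ Finset.range n, transitionProb ℓ (x i) (x (i + 1))) * transitionProb ℓ (x n) w := by
    intro n x w
    rw [Finset.prod_range_succ, if_pos le_rfl, if_neg (by omega)]
    congr 1
    refine Finset.prod_congr rfl fun i hi => ?_
    have := Finset.mem_range.mp hi
    rw [if_pos (by omega), if_pos (by omega)]
  induction M with
  | zero =>
    refine key 0 (fun n x => {X | (∀ i ≤ n, X i = x i) ∧ ∀ m, n < m → m ≤ n + (0 + 1) → X m ≠ ⊥})
      (fun n x hx w hw => ?_) fun n x X hX => hX.2 (n + 1) (by omega) (by omega)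
    have h1 := hP.2.2 (n + 1) (fun i => if i ≤ n then x i else w) (by simpa using hx)
    rw [hupd] at h1
    rw [avoidProb, if_neg hw, mul_one, ← h1]
    refine measure_mono fun X hX i hi => ?_
    split_ifs with h
    · exact hX.1.1 i h
    · obtain rfl : i = n + 1 := by omega
      exact hX.2
  | succ M ih =>
    refine key (M + 1)
      (fun n x => {X | (∀ i ≤ n, X i = x i) ∧ ∀ m, n < m → m ≤ n + (M + 1 + 1) → X m ≠ ⊥})
      (fun n x hx w hw => ?_) fun n x X hX => hX.2 (n + 1) (by omega) (by omega)
    have h1 := ih (n + 1) (fun i => if i ≤ n then x i else w) (by simpa using hx)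
    rw [hupd, if_neg (by omega), mul_assoc, ← avoidProb_succ hT M hw] at h1
    refine le_trans (measure_mono fun X hX => ?_) h1
    refine ⟨fun i hi => ?_, fun m hm hm' => ?_⟩
    · split_ifs with h
      · exact hX.1.1 i h
      · obtain rfl : i = n + 1 := by omega
        exact hX.2
    · exact hX.1.2 m (by omega) (by omega)

/-- If the walk surely returned to the root, no visit of the root would be the last one. -/
theorem IsTransient.walkAverage_ne_zero (h : IsTransient ℓ) :
    walkAverage hT ℓ (escapeProb hT ℓ) ⊥ ≠ 0 := by
  intro h0
  obtain ⟨P, hP, hfin⟩ := h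
  have := hP.1
  have hcount := countable_vertex hT
  have hnull : ∀ (n : ℕ) (x : ℕ → T), x 0 = ⊥ → x n = ⊥ →
      P {X | (∀ i ≤ n, X i = x i) ∧ ∀ m, n < m → X m ≠ ⊥} = 0 := by
    intro n x hx hxn
    have hlim := ENNReal.tendsto_ofReal ((tendsto_walkAverage_avoidProb hT hℓ ⊥).const_mul
      (∏ i ∈ Finset.range n, transitionProb ℓ (x i) (x (i + 1))))
    rw [h0, mul_zero, ENNReal.ofReal_zero] at hlim
    refine le_antisymm (ge_of_tendsto' hlim fun M => ?_) zero_le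
    refine (measure_mono fun X hX => ?_).trans (hxn ▸ hP.measure_avoid_le hT hℓ M n x hx)
    exact ⟨hX.1, fun m hm _ => hX.2 m hm⟩
  have hall : ∀ᵐ X ∂P, ∀ (n : ℕ) (y : Fin (n + 1) → T), y 0 = ⊥ → y (Fin.last n) = ⊥ →
      ¬ ((∀ i, X (i : ℕ) = y i) ∧ ∀ m, n < m → X m ≠ ⊥) := by
    rw [ae_all_iff]
    intro n
    rw [ae_all_iff]
    intro y
    by_cases hy : y 0 = ⊥ ∧ y (Fin.last n) = ⊥
    · have hnu := hnull n (fun i => y (Fin.ofNat (n + 1) i)) (by simpa using hy.1)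
        (by simpa using hy.2)
      rw [← compl_compl {X | _}] at hnu
      filter_upwards [mem_ae_iff.mpr hnu] with X hX _ _ hX'
      refine hX ⟨fun i hi => ?_, hX'.2⟩
      rw [← hX'.1]
      simp [Nat.mod_eq_of_lt (Nat.lt_succ_of_le hi)]
    · exact Eventually.of_forall fun X h1 h2 => absurd ⟨h1, h2⟩ hy
  have hstart : ∀ᵐ X ∂P, X 0 = ⊥ :=
    (mem_ae_iff_prob_eq_one ((measurable_pi_apply 0) (measurableSet_singleton _))).mpr hP.2.1
  have hfalse : ∀ᵐ _ ∂P, False := by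
    filter_upwards [hall, hstart, hfin] with X h1 h2 h3
    obtain ⟨n, hn, hmax⟩ := h3.exists_maximal ⟨0, h2⟩
    refine h1 n (fun i => X i) h2 hn ⟨fun i => rfl, fun m hm hXm => ?_⟩
    exact absurd hm (hmax hXm hm.le).not_gt
  exact IsProbabilityMeasure.ne_zero P (ae_eq_bot.mp (eventually_false_iff_eq_bot.mp hfalse))

include hT hℓ in
theorem IsTransient.exists_isBoundedUnitFlow (h : IsTransient ℓ) : ∃ θ, IsBoundedUnitFlow ℓ θ :=
  exists_isBoundedUnitFlow_of_walkAverage_ne_zero hT hℓ (h.walkAverage_ne_zero hT hℓ)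

end TreeFactorial

/-! ### Factorials and harmonic measure of a transient tree -/

theorem mainTheorem1 (T : RootedTree) (hT : TreeFactorial.IsLocallyFinite T)
    (ℓ : TreeFactorial.Edge T → ℝ) (hℓ : ∀ e, 0 < ℓ e)
    (htrans : TreeFactorial.IsTransient ℓ) (hwc : TreeFactorial.IsWeaklyComplete ℓ) :
    ∃ (η : TreeFactorial.Edge T → ℝ) (μhar : Measure (TreeFactorial.Boundary T)) (a : ℕ → ℝ),
      -- `η` is the unit current flow, `μhar` the harmonic measure, `a n` the factorial of `n`
      (TreeFactorial.IsUnitCurrentFlow ℓ η ∧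
        ∀ θ, TreeFactorial.IsUnitCurrentFlow ℓ θ → θ = η) ∧
      (TreeFactorial.IsFlowMeasure η μhar ∧
        ∀ ν, TreeFactorial.IsFlowMeasure η ν → ν = μhar) ∧
      TreeFactorial.IsFactorialSequence ℓ a ∧
      -- the normalized weights converge edge-wise to `η`
      (∀ ω x, TreeFactorial.IsWeightingSequence ℓ ω x →
        ∀ e, Tendsto (fun n => TreeFactorial.normalizedWeight ω n e) atTop (𝓝 (η e))) ∧
      -- consistent measures converge weakly to the harmonic measure
      (∀ ω x, TreeFactorial.IsWeightingSequence ℓ ω x →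
        ∀ μ : ℕ → Measure (TreeFactorial.ExtBoundary T),
          (∀ n, 1 ≤ n → TreeFactorial.IsConsistent ω n (μ n)) →
            TreeFactorial.WeaklyTendsTo μ μhar) ∧
      -- factorial-determining sequences are equidistributed
      (∀ ρ, TreeFactorial.IsFactorialDetermining ℓ ρ →
        TreeFactorial.IsEquidistributed ρ μhar) ∧
      -- `n! / n` converges to the energy of `η`
      Tendsto (fun n : ℕ => a n / n) atTop (𝓝 (TreeFactorial.energy ℓ η)) := by
  obtain ⟨θ, hθ⟩ := htrans.exists_isBoundedUnitFlow hT hℓ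
  obtain ⟨η, hη⟩ := TreeFactorial.exists_isUnitCurrentFlow hT hℓ ⟨θ, hθ⟩
  obtain ⟨μhar, hμ⟩ := TreeFactorial.exists_isFlowMeasure hT hη.1.1
  obtain ⟨ω₀, x₀, h₀⟩ := TreeFactorial.exists_isWeightingSequence (hT := hT) hwc hη.1
  have hbot : ¬ TreeFactorial.IsLeaf (⊥ : T) := fun hl => by
    have h1 := hη.1.1.total
    simp [hl _] at h1
  refine ⟨η, μhar, fun n => TreeFactorial.weightedLength ℓ (ω₀ n) (x₀ n),
    ⟨hη, fun θ hθ => TreeFactorial.IsUnitCurrentFlow.eq_of_energy_le hT hℓ hη hθ.1 (hθ.2 η hη.1)⟩,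
    ⟨hμ, fun ν hν => TreeFactorial.IsFlowMeasure.unique hT hμ hν⟩,
    ⟨⟨ω₀, x₀, h₀⟩, fun ω x h n => h.weightedLength_unique hT hℓ h₀ n, fun ρ hρ n => ?_⟩,
    fun ω x h e => h.tendsto_normalizedWeight (hT := hT) hℓ hwc hη e,
    fun ω x h μ hcons => h.weaklyTendsTo (hT := hT) hℓ hwc hη hμ hcons,
    fun ρ hρ => hρ.isEquidistributed hT hℓ hwc hbot hη hμ,
    h₀.tendsto_weightedLength_div (hT := hT) hℓ hwc hη⟩
  obtain ⟨ω, x, h, hω⟩ := hρ.exists_isWeightingSequence hT hbot hℓ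
  rw [← h.weightedLength_unique hT hℓ h₀ n]
  rcases Nat.eq_zero_or_pos n with rfl | hn
  · simp [h.weightedLength_zero]
  · exact (hω n hn).2
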